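/- **Theorem (Local Birch Lemma).** Let $F$ be a non-archimedean local field with valuation ring $\mathcal O$, maximal ideal $\mathfrak p$, uniformizer $\varpi$, residue field of cardinality $q$, and absolute value normalized by $|\varpi|=q^{-1}$. Let $n\ge 0$, $\alpha\ge 1$, $f=\varpi^\alpha$. Let $\psi:F\to\mathbf C^\times$ be an additive character of conductor $\mathcal O$ (i.e. $\psi(x\mathcal O)=1$ if and only if $x\in\mathcal O$), extended to the group $U_m(F)$ of upper triangular unipotent matrices by $\psi(u)=\prod_{i=1}^{m-1}\psi(u_{i,i+1})$. For a quasi-character $\chi$ of $F^\times$ let $\mathfrak p^{e_\chi}$ be its conductor, and for $e_\chi\geq 1$ let $$G(\chi)=\sum_{x\in(\mathcal O/\mathfrak p^{e_\chi})^\times}\chi(x\varpi^{-e_\chi})\,\psi(x\varpi^{-e_\chi}).$$ Let $I^m_\alpha\subseteq \mathrm{GL}_m(\mathcal O)$ be the subgroup of matrices that are upper triangular modulo $\mathfrak p^\alpha$. Put $j_n(g)=\begin{pmatrix}g&0\\0&1\end{pmatrix}$, $t_x=\mathrm{diag}(x^n,x^{n-1},\dots,x)\in \mathrm{GL}_n(F)$,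 and let $h_n\in\mathrm{GL}_{n+1}(F)$ be the matrix with upper left $n\times n$ block the antidiagonal permutation matrix $w_n$, last column $(1,\dots,1)^t$ and last row $(0,\dots,0,1)$. Let $\theta_1,\dots,\theta_{n+1}$ and $\theta'_1,\dots,\theta'_n$ be quasi-characters of $F^\times$ with conductors dividing $f$. Let $w:\mathrm{GL}_{n+1}(F)\to\mathbf C$ and $v:\mathrm{GL}_n(F)\to\mathbf C$ be a $\psi$- resp. $\psi^{-1}$-Whittaker function, i.e. $w(ug)=\psi(u)w(g)$ for $u\in U_{n+1}(F)$ and $v(ug)=\psi(u)^{-1}v(g)$ for $u\in U_n(F)$, such that $w(gr)=\prod_{i=1}^{n+1}\theta_i(r_{ii})\,w(g)$ for $r\in I^{n+1}_\alpha$ and $v(gr)=\prod_{i=1}^{n}\theta'_i(r_{ii})\,v(g)$ for $r\in I^n_\alpha$. Let $\chi$ be a quasi-character of $F^\times$ with $e_\chi\le\alpha$, and suppose that the characters $$\chi\theta^{w_\mu}_\nu\theta'_\nu:=\chi\,\theta_{\mu+1-\nu}\,\theta'_\nu\qquad(1\le\nu\le\mu\le n)$$ all have the same, non-trivial conductor $\mathfrak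 p^{e}$, $e\ge1$. Put $f_{\chi\theta\theta'}=\varpi^{e}$. Let $dg$ be the quotient measure on $U_n(F)\backslash \mathrm{GL}_n(F)$ of the Haar measures giving $\mathrm{GL}_n(\mathcal O)$ and $U_n(\mathcal O)$ volume $1$. Then for every $s\in\mathbf C$ \begin{align*} &\int_{U_n(F)\backslash\mathrm{GL}_n(F)} w\bigl(j_n(g)\,h_n\,j_n(t_{-f})\bigr)\,v(g\,t_f)\,\chi(\det g)\,|\det g|^{s-\frac12}\,dg\\ &=\prod_{i=1}^n\theta_i(-1)\cdot\prod_{\mu=1}^n(1-q^{-\mu})^{-1}\cdot (q^{e})^{-\frac{(n+2)(n+1)n}{6}}\cdot|\det t_{f_{\chi\theta\theta'}}|^{\frac12-s}\\ &\quad\cdot\prod_{\mu=1}^n\prod_{\nu=1}^\mu\Bigl[\theta_{\mu+1-\nu}\theta'_\nu(f_{\chi\theta\theta'})\,G(\chi\theta_{\mu+1-\nu}\theta'_\nu)\Bigr]\cdot w\bigl(j_n(t_{f f_{\chi\theta\theta'}^{-1}})\bigr)\,v\bigl(t_{f f_{\chi\theta\theta'}^{-1}}\bigr). \end{align*} Here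 the integral is understood as follows: for every $k\in\mathbf Z$ the integrand is absolutely integrable over the set where $|\det g|=q^{-k}$, and the integral is the sum over $k\in\mathbf Z$ of the resulting integrals, which converges absolutely. Where the integrand is absolutely integrable over all of $U_n(F)\backslash \mathrm{GL}_n(F)$, this is the ordinary integral, and the identity holds for it. -/

import Mathlib

open MeasureTheory
open scoped ENNReal

noncomputable section

namespace LocalBirch

/-! ### The quotient measure on `H \ G` -/

/-- The space `H \ G` of right cosets `H g`. -/
abbrev RightCosets {G : Type*} [Group G] (H : Subgroup G) : Type _ :=
  Quotient (QuotientGroup.rightRel H)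

/-- The projection `g ↦ H g`. -/
def toCoset {G : Type*} [Group G] (H : Subgroup G) (g : G) : RightCosets H :=
  Quotient.mk (QuotientGroup.rightRel H) g

/-- The quotient measure `ν / η` on `H \ G`, for Haar measures `ν`, `η` of unimodular groups
`G ≥ H`, that is, the measure `μ` with Weil's formula
`∫_G f dν = ∫_{H \ G} (∫_H f (h g) dη(h)) dμ(H g)` for all measurable `f ≥ 0`.

By this formula the push-forward of `f ν` to `H \ G` is `(∫_H f (h g) dη(h)) μ`.
So `μ` is the largest of these push-forwards when `f ≥ 0` runs through the functions with
`∫_H f (h g) dη(h) ≤ 1` for all `g`; it is attained where this integral is constantly `1`. -/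
def quotientMeasure {G : Type*} [Group G] [MeasurableSpace G] (H : Subgroup G)
    (ν : Measure G) (η : Measure H) : Measure (RightCosets H) :=
  ⨆ (f : G → ℝ≥0∞) (_ : Measurable f) (_ : ∀ g : G, ∫⁻ h : H, f ((h : G) * g) ∂η ≤ 1),
    (ν.withDensity f).map (toCoset H)

section Field

variable (F : Type*) [NontriviallyNormedField F] [IsUltrametricDist F]

/-! ### The field, its characters and Gauss sums -/

/-- The valuation ring `𝒪 = {x | ‖x‖ ≤ 1}`. -/
abbrev integers : ValuationSubring F := (NormedField.valuation (K := F)).valuationSubring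

/-- The number `q` of elements of the residue field. -/
def residueCard : ℕ := Nat.card (IsLocalRing.ResidueField (integers F))

variable {F}

/-- `ϖ` is a uniformizer: `{x | ‖x‖ < 1} = ϖ 𝒪`. -/
def IsUniformizer (ϖ : Fˣ) : Prop := ∀ x : F, ‖x‖ < 1 ↔ ‖x‖ ≤ ‖(ϖ : F)‖

/-- The additive character `ψ` has conductor `𝒪`: `𝒪` is the largest fractional ideal
on which `ψ` is trivial. -/
def HasConductorIntegers (ψ : AddChar F ℂ) : Prop :=
  ∀ x : F, (∀ y : F, ‖y‖ ≤ 1 → ψ (x * y) = 1) ↔ ‖x‖ ≤ 1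

/-- The value of a quasi-character of `Fˣ` at an element of `F`, extended by `0` at `0`. -/
def charVal (χ : Fˣ →ₜ* ℂˣ) (x : F) : ℂ :=
  open Classical in if h : x = 0 then 0 else (χ (Units.mk0 x h) : ℂ)

/-- The exponent `e_χ` of the conductor `𝔭 ^ e_χ` of `χ`: the least `e ≥ 0` such that `χ` is
trivial on the units of `𝒪` that are congruent to `1` modulo `𝔭 ^ e`. -/
def conductorExp (ϖ : Fˣ) (χ : Fˣ →ₜ* ℂˣ) : ℕ :=
  sInf {e : ℕ | ∀ u : Fˣ, ‖(u : F)‖ = 1 → ‖(u : F) - 1‖ ≤ ‖(ϖ : F)‖ ^ e → χ u = 1}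

/-- The Gauss sum `G(χ) = ∑ χ(x / f_χ) ψ(x / f_χ)` over `x ∈ (𝒪 / 𝔣_χ)ˣ`, where
`f_χ = ϖ ^ e_χ` generates the conductor `𝔣_χ`; used for ramified `χ` only. -/
def gaussSum (ϖ : Fˣ) (ψ : AddChar F ℂ) (χ : Fˣ →ₜ* ℂˣ) : ℂ :=
  ∑ᶠ x : (integers F ⧸ IsLocalRing.maximalIdeal (integers F) ^ conductorExp ϖ χ)ˣ,
    charVal χ (((Quotient.out x.val : integers F) : F) / (ϖ : F) ^ conductorExp ϖ χ) *
      ψ (((Quotient.out x.val : integers F) : F) / (ϖ : F) ^ conductorExp ϖ χ)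

/-! ### Subgroups of `GL_n(F)` -/

/-- The Borel `σ`-algebra on `GL_n(F)`. -/
instance (n : ℕ) : MeasurableSpace (GL (Fin n) F) := borel _

instance (n : ℕ) : BorelSpace (GL (Fin n) F) := ⟨rfl⟩

variable (F) in
/-- The group `U_n(F)` of upper triangular unipotent matrices. -/
def unipotent (n : ℕ) : Subgroup (GL (Fin n) F) where
  carrier := {u | (u : Matrix (Fin n) (Fin n) F).BlockTriangular id ∧
    ∀ i, (u : Matrix (Fin n) (Fin n) F) i i = 1}
  one_mem' := by
    refine ⟨?_, fun i => by simp⟩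
    simpa using Matrix.blockTriangular_one
  mul_mem' := by
    rintro a b ⟨ha, ha'⟩ ⟨hb, hb'⟩
    refine ⟨by simpa using ha.mul hb, fun i => ?_⟩
    rw [Units.val_mul, Matrix.mul_apply, Finset.sum_eq_single i]
    · simp [ha' i, hb' i]
    · intro j _ hj
      rcases lt_or_gt_of_ne hj with h | h
      · rw [ha h, zero_mul]
      · rw [hb h, mul_zero]
    · simp
  inv_mem' := by
    rintro a ⟨ha, ha'⟩
    have hinv : ((a⁻¹ : GL (Fin n) F) : Matrix (Fin n) (Fin n) F).BlockTriangular id := by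
      rw [Matrix.coe_units_inv]
      have : Invertible (a : Matrix (Fin n) (Fin n) F) := a.invertible
      exact Matrix.blockTriangular_inv_of_blockTriangular ha
    refine ⟨hinv, fun i => ?_⟩
    have h : ((a : Matrix (Fin n) (Fin n) F) *
        ((a⁻¹ : GL (Fin n) F) : Matrix (Fin n) (Fin n) F)) i i = 1 := by
      rw [Units.mul_inv]; simp
    rw [Matrix.mul_apply, Finset.sum_eq_single i] at h
    · simpa [ha' i] using h
    · intro j _ hj
      rcases lt_or_gt_of_ne hj with h | h
      · rw [ha h, zero_mul]
      · rw [hinv h, mul_zero]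
    · simp

variable (F) in
/-- The maximal compact subgroup `GL_n(𝒪)` of `GL_n(F)`. -/
def maximalCompact (n : ℕ) : Subgroup (GL (Fin n) F) :=
  (Matrix.GeneralLinearGroup.map (n := Fin n) (algebraMap (integers F) F)).range

/-- The set `I_α^n` of matrices in `GL_n(𝒪)` that are upper triangular modulo `𝔭 ^ α`. -/
def iwahori (ϖ : Fˣ) (n α : ℕ) : Set (GL (Fin n) F) :=
  {g | g ∈ maximalCompact F n ∧
    ∀ i j : Fin n, j < i → ‖(g : Matrix (Fin n) (Fin n) F) i j‖ ≤ ‖(ϖ : F)‖ ^ α}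

/-- The function `r ↦ ∏ θ_i(r_ii)`. -/
def diagChar {n : ℕ} (θ : Fin n → (Fˣ →ₜ* ℂˣ)) (r : GL (Fin n) F) : ℂ :=
  ∏ i, charVal (θ i) ((r : Matrix (Fin n) (Fin n) F) i i)

/-- The function `u ↦ ∏ ψ(u_{i,i+1})`. -/
def genericChar {n : ℕ} (ψ : AddChar F ℂ) (u : GL (Fin n) F) : ℂ :=
  ∏ i : Fin n, ∏ j : Fin n,
    if (i : ℕ) + 1 = (j : ℕ) then ψ ((u : Matrix (Fin n) (Fin n) F) i j) else 1

/-- `w` is a `ψ`-Whittaker function that transforms under `I_α^n` from the right by the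
character `r ↦ ∏ θ_i(r_ii)` (so `w` is locally constant). -/
structure IsWhittaker (ϖ : Fˣ) {n : ℕ} (ψ : AddChar F ℂ) (α : ℕ)
    (θ : Fin n → (Fˣ →ₜ* ℂˣ)) (w : GL (Fin n) F → ℂ) : Prop where
  left : ∀ u ∈ unipotent F n, ∀ g, w (u * g) = genericChar ψ u * w g
  right : ∀ g, ∀ r ∈ iwahori ϖ n α, w (g * r) = diagChar θ r * w g

/-- The character `χ θ_ν^{w_μ} θ'_ν = χ θ_{μ+1-ν} θ'_ν` for `1 ≤ ν ≤ μ ≤ n`; in the code all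
indices are shifted by one. -/
def twistedChar {n : ℕ} (χ : Fˣ →ₜ* ℂˣ) (θ : Fin (n + 1) → (Fˣ →ₜ* ℂˣ))
    (θ' : Fin n → (Fˣ →ₜ* ℂˣ)) (μ ν : Fin n) : Fˣ →ₜ* ℂˣ :=
  χ * (θ ⟨(μ : ℕ) - (ν : ℕ), by omega⟩ * θ' ν)

end Field

section Matrices

variable {F : Type*} [Field F]

/-! ### The matrices `j_n(g)`, `h_n`, `t_x` -/

/-- The `(n+1) × (n+1)` matrix with upper left block `A`, last column `(c, 1)` and
last row `(0, …, 0, 1)`. -/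
def bordered {n : ℕ} (A : Matrix (Fin n) (Fin n) F) (c : Fin n → F) :
    Matrix (Fin (n + 1)) (Fin (n + 1)) F :=
  Matrix.reindex finSumFinEquiv finSumFinEquiv
    (Matrix.fromBlocks A (Matrix.of fun i (_ : Fin 1) => c i) 0 1)

theorem det_bordered {n : ℕ} (A : Matrix (Fin n) (Fin n) F) (c : Fin n → F) :
    (bordered A c).det = A.det := by
  unfold bordered
  rw [Matrix.det_reindex_self, Matrix.det_fromBlocks_zero₂₁]
  simp

/-- `j_n(g) = diag(g, 1)`. -/
def embed {n : ℕ} (g : GL (Fin n) F) : GL (Fin (n + 1)) F :=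
  Matrix.GeneralLinearGroup.mkOfDetNeZero (bordered g 0) (by
    rw [det_bordered]
    exact (Matrix.isUnits_det_units g).ne_zero)

/-- The longest Weyl element `w_n`: the permutation matrix with ones on the antidiagonal. -/
def longestWeyl (F : Type*) [Field F] (n : ℕ) : Matrix (Fin n) (Fin n) F :=
  Matrix.of fun i j => if j = Fin.rev i then 1 else 0

theorem longestWeyl_mul_self (n : ℕ) : longestWeyl F n * longestWeyl F n = 1 := by
  ext i j
  rw [Matrix.mul_apply, Finset.sum_eq_single (Fin.rev i)]
  · simp [longestWeyl, Matrix.one_apply, eq_comm]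
  · intro k _ hk
    simp [longestWeyl, hk]
  · simp

/-- The matrix `h_n` with upper left block `w_n`, last column `(1, …, 1)` and
last row `(0, …, 0, 1)`. -/
def hMatrix (F : Type*) [Field F] (n : ℕ) : GL (Fin (n + 1)) F :=
  Matrix.GeneralLinearGroup.mkOfDetNeZero (bordered (longestWeyl F n) (fun _ => 1)) (by
    rw [det_bordered]
    intro h
    have := congrArg Matrix.det (longestWeyl_mul_self (F := F) n)
    rw [Matrix.det_mul, h] at this
    simp at this)

/-- `t_x = diag(x ^ n, x ^ (n - 1), …, x)`. -/
def tMatrix {n : ℕ} (x : Fˣ) : GL (Fin n) F :=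
  Units.map (Matrix.diagonalRingHom (Fin n) F : (Fin n → F) →* Matrix (Fin n) (Fin n) F)
    (MulEquiv.piUnits.symm fun i : Fin n => x ^ (n - (i : ℕ)))

end Matrices

section Zeta

variable {F : Type*} [NontriviallyNormedField F] [IsUltrametricDist F]

/-! ### The twisted local zeta integral -/

/-- The complex power `|det g| ^ z`. -/
def absDet {n : ℕ} (g : GL (Fin n) F) (z : ℂ) : ℂ :=
  ((‖(Matrix.GeneralLinearGroup.det g : F)‖ : ℝ) : ℂ) ^ z

/-- The function `g ↦ w(j_n(g) h_n j_n(t_{-f})) v(g t_f) χ(det g) |det g| ^ (s - 1/2)`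
on `GL_n(F)`. -/
def zetaIntegrand {n : ℕ} (f : Fˣ) (w : GL (Fin (n + 1)) F → ℂ) (v : GL (Fin n) F → ℂ)
    (χ : Fˣ →ₜ* ℂˣ) (s : ℂ) (g : GL (Fin n) F) : ℂ :=
  w (embed g * hMatrix F n * embed (tMatrix (-f))) * v (g * tMatrix f) *
    (χ (Matrix.GeneralLinearGroup.det g) : ℂ) * absDet g (s - 1 / 2)

/-- A function on `GL_n(F)` that is invariant under `U_n(F)` from the left, as a function on
`U_n(F) \ GL_n(F)`. -/
def onCosets {n : ℕ} (Φ : GL (Fin n) F → ℂ) (x : RightCosets (unipotent F n)) : ℂ :=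
  Φ x.out

/-- The part of `U_n(F) \ GL_n(F)` on which `|det g| = |ϖ| ^ k`. -/
def shell (ϖ : Fˣ) (n : ℕ) (k : ℤ) : Set (RightCosets (unipotent F n)) :=
  {x | ‖(Matrix.GeneralLinearGroup.det x.out : F)‖ = ‖(ϖ : F)‖ ^ k}

end Zeta

end LocalBirch

end

set_option linter.unusedSectionVars false

namespace LocalBirch

section Algebra

variable {F : Type*} [Field F]

/-! ### Bordered and diagonal matrices -/

@[simp] theorem bordered_castSucc_castSucc {n : ℕ} (A : Matrix (Fin n) (Fin n) F) (c : Fin n → F)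
    (i j : Fin n) : bordered A c i.castSucc j.castSucc = A i j := by
  change bordered A c (Fin.castAdd 1 i) (Fin.castAdd 1 j) = A i j
  simp [bordered, Matrix.reindex_apply, Matrix.submatrix_apply]

@[simp] theorem bordered_castSucc_last {n : ℕ} (A : Matrix (Fin n) (Fin n) F) (c : Fin n → F)
    (i : Fin n) : bordered A c i.castSucc (Fin.last n) = c i := by
  change bordered A c (Fin.castAdd 1 i) (Fin.last n) = c i
  simp [bordered, Matrix.reindex_apply, Matrix.submatrix_apply]

@[simp] theorem bordered_last_castSucc {n : ℕ} (A : Matrix (Fin n) (Fin n) F) (c : Fin n → F)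
    (j : Fin n) : bordered A c (Fin.last n) j.castSucc = 0 := by
  change bordered A c (Fin.last n) (Fin.castAdd 1 j) = 0
  simp [bordered, Matrix.reindex_apply, Matrix.submatrix_apply]

@[simp] theorem bordered_last_last {n : ℕ} (A : Matrix (Fin n) (Fin n) F) (c : Fin n → F) :
    bordered A c (Fin.last n) (Fin.last n) = 1 := by
  simp [bordered, Matrix.reindex_apply, Matrix.submatrix_apply]

theorem eq_bordered {n : ℕ} (M : Matrix (Fin (n + 1)) (Fin (n + 1)) F)
    (hM : ∀ j : Fin n, M (Fin.last n) j.castSucc = 0) (hM' : M (Fin.last n) (Fin.last n) = 1) :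
    M = bordered (Matrix.of fun i j => M i.castSucc j.castSucc) (fun i => M i.castSucc (Fin.last n)) := by
  ext i j
  refine Fin.lastCases ?_ (fun i => ?_) i <;> refine Fin.lastCases ?_ (fun j => ?_) j <;>
    simp [hM, hM']

theorem bordered_mul {n : ℕ} (A B : Matrix (Fin n) (Fin n) F) (c d : Fin n → F) :
    bordered A c * bordered B d = bordered (A * B) (Matrix.mulVec A d + c) := by
  ext i j
  refine Fin.lastCases ?_ (fun i => ?_) i <;> refine Fin.lastCases ?_ (fun j => ?_) j <;>
    simp [Matrix.mul_apply, Fin.sum_univ_castSucc, Matrix.mulVec, dotProduct]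

theorem bordered_one_zero {n : ℕ} : bordered (1 : Matrix (Fin n) (Fin n) F) 0 = 1 := by
  ext i j
  refine Fin.lastCases ?_ (fun i => ?_) i <;> refine Fin.lastCases ?_ (fun j => ?_) j <;>
    simp [Matrix.one_apply, Fin.castSucc_ne_last, (Fin.castSucc_ne_last _).symm]

@[simp] theorem embed_val {n : ℕ} (g : GL (Fin n) F) :
    ((embed g : GL (Fin (n + 1)) F) : Matrix (Fin (n + 1)) (Fin (n + 1)) F) = bordered g 0 := rfl

@[simp] theorem hMatrix_val (n : ℕ) :
    ((hMatrix F n : GL (Fin (n + 1)) F) : Matrix (Fin (n + 1)) (Fin (n + 1)) F) =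
      bordered (longestWeyl F n) (fun _ => 1) := rfl

theorem embed_mul {n : ℕ} (g h : GL (Fin n) F) : embed (g * h) = embed g * embed h := by
  apply Units.ext
  simp [bordered_mul]

theorem embed_one {n : ℕ} : embed (1 : GL (Fin n) F) = 1 := by
  apply Units.ext
  simp [bordered_one_zero]

/-- `g ↦ diag(g, 1)` as a homomorphism. -/
def embedHom (F : Type*) [Field F] (n : ℕ) : GL (Fin n) F →* GL (Fin (n + 1)) F where
  toFun := embed
  map_one' := embed_one
  map_mul' := embed_mul

theorem embed_inv {n : ℕ} (g : GL (Fin n) F) : embed g⁻¹ = (embed g)⁻¹ :=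
  map_inv (embedHom F n) g

theorem det_embed {n : ℕ} (g : GL (Fin n) F) :
    Matrix.GeneralLinearGroup.det (embed g) = Matrix.GeneralLinearGroup.det g := by
  apply Units.ext
  simp [Matrix.GeneralLinearGroup.val_det_apply, det_bordered]

/-- The unipotent matrix with last column `(c, 1)`. -/
def translation {n : ℕ} (c : Fin n → F) : GL (Fin (n + 1)) F :=
  Matrix.GeneralLinearGroup.mkOfDetNeZero (bordered 1 c) (by simp [det_bordered])

@[simp] theorem translation_val {n : ℕ} (c : Fin n → F) :
    ((translation c : GL (Fin (n + 1)) F) : Matrix (Fin (n + 1)) (Fin (n + 1)) F) =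
      bordered 1 c := rfl

theorem embed_mul_translation {n : ℕ} (g : GL (Fin n) F) (c : Fin n → F) :
    embed g * translation c =
      translation (Matrix.mulVec (g : Matrix (Fin n) (Fin n) F) c) * embed g := by
  apply Units.ext
  simp [bordered_mul]

theorem exists_eq_translation_mul_embed {n : ℕ} (g : GL (Fin (n + 1)) F)
    (h : ∀ j : Fin n, (g : Matrix _ _ F) (Fin.last n) j.castSucc = 0)
    (h' : (g : Matrix _ _ F) (Fin.last n) (Fin.last n) = 1) :
    ∃ (c : Fin n → F) (g' : GL (Fin n) F), g = translation c * embed g' := by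
  have hg := eq_bordered (g : Matrix (Fin (n + 1)) (Fin (n + 1)) F) h h'
  set A : Matrix (Fin n) (Fin n) F :=
    Matrix.of fun i j => (g : Matrix _ _ F) i.castSucc j.castSucc with hA
  have hdet : A.det ≠ 0 := by
    rw [← det_bordered A, ← hg]
    exact (Matrix.isUnits_det_units g).ne_zero
  refine ⟨fun i => (g : Matrix _ _ F) i.castSucc (Fin.last n),
    Matrix.GeneralLinearGroup.mkOfDetNeZero A hdet, Units.ext ?_⟩
  rw [Units.val_mul, translation_val, embed_val, bordered_mul]
  simp only [Matrix.mulVec_zero, zero_add, one_mul]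
  exact hg

/-- The diagonal matrix with the given units on the diagonal. -/
def diagGL {n : ℕ} : (Fin n → Fˣ) →* GL (Fin n) F :=
  (Units.map (Matrix.diagonalRingHom (Fin n) F : (Fin n → F) →* Matrix (Fin n) (Fin n) F)).comp
    ((MulEquiv.piUnits (M := fun _ : Fin n => F)).symm : (Fin n → Fˣ) →* (Fin n → F)ˣ)

@[simp] theorem diagGL_val {n : ℕ} (a : Fin n → Fˣ) :
    ((diagGL a : GL (Fin n) F) : Matrix (Fin n) (Fin n) F) =
      Matrix.diagonal (fun i => (a i : F)) := rfl

theorem diagGL_mul_apply {n : ℕ} (a : Fin n → Fˣ) (g : GL (Fin n) F) (i j : Fin n) :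
    ((diagGL a * g : GL (Fin n) F) : Matrix (Fin n) (Fin n) F) i j =
      a i * (g : Matrix (Fin n) (Fin n) F) i j := by
  simp [Matrix.diagonal_mul]

theorem mul_diagGL_apply {n : ℕ} (a : Fin n → Fˣ) (g : GL (Fin n) F) (i j : Fin n) :
    ((g * diagGL a : GL (Fin n) F) : Matrix (Fin n) (Fin n) F) i j =
      (g : Matrix (Fin n) (Fin n) F) i j * a j := by
  simp [Matrix.mul_diagonal]

theorem diagGL_conj_apply {n : ℕ} (a b : Fin n → Fˣ) (g : GL (Fin n) F) (i j : Fin n) :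
    ((diagGL a * g * diagGL b : GL (Fin n) F) : Matrix (Fin n) (Fin n) F) i j =
      a i * (g : Matrix (Fin n) (Fin n) F) i j * b j := by
  rw [mul_diagGL_apply, diagGL_mul_apply]

theorem tMatrix_eq {n : ℕ} (x : Fˣ) :
    (tMatrix x : GL (Fin n) F) = diagGL fun i => x ^ (n - (i : ℕ)) := rfl

theorem embed_diagGL {n : ℕ} (a : Fin n → Fˣ) :
    embed (diagGL a) = diagGL (Fin.snoc a 1 : Fin (n + 1) → Fˣ) := by
  apply Units.ext
  ext i j
  refine Fin.lastCases ?_ (fun i => ?_) i <;> refine Fin.lastCases ?_ (fun j => ?_) j <;>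
    simp [Matrix.diagonal_apply, Fin.castSucc_ne_last, (Fin.castSucc_ne_last _).symm]

/-- The scalar matrix `x`. -/
def scalarGL (n : ℕ) (x : Fˣ) : GL (Fin n) F := diagGL fun _ => x

theorem scalarGL_comm {n : ℕ} (x : Fˣ) (g : GL (Fin n) F) :
    scalarGL n x * g = g * scalarGL n x := by
  apply Units.ext
  ext i j
  rw [scalarGL, diagGL_mul_apply, mul_diagGL_apply, mul_comm]

theorem scalarGL_mul {n : ℕ} (x y : Fˣ) : scalarGL n (x * y) = scalarGL n x * scalarGL n y := by
  simp only [scalarGL, ← map_mul]; rfl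

theorem diagGL_eq_scalar_mul {n : ℕ} (a : Fin (n + 1) → Fˣ) :
    diagGL a = scalarGL (n + 1) (a (Fin.last n)) *
      embed (diagGL fun i : Fin n => (a (Fin.last n))⁻¹ * a i.castSucc) := by
  rw [embed_diagGL, scalarGL, ← map_mul]
  congr 1
  ext i
  refine Fin.lastCases ?_ (fun i => ?_) i <;> simp

theorem tMatrix_succ {n : ℕ} (x : Fˣ) :
    (tMatrix x : GL (Fin (n + 1)) F) = scalarGL (n + 1) x * embed (tMatrix x) := by
  rw [tMatrix_eq, diagGL_eq_scalar_mul, tMatrix_eq]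
  have h1 : x ^ (n + 1 - ((Fin.last n : Fin (n + 1)) : ℕ)) = x := by simp
  rw [h1]
  congr 3
  ext i
  have : n + 1 - (i : ℕ) = (n - i) + 1 := by omega
  simp [this, pow_succ]

theorem det_diagGL {n : ℕ} (a : Fin n → Fˣ) :
    Matrix.GeneralLinearGroup.det (diagGL a) = ∏ i, a i := by
  apply Units.ext
  simp [Matrix.GeneralLinearGroup.val_det_apply, Units.coe_prod]

/-- The longest Weyl element as an element of `GL_n`. -/
def weylGL (F : Type*) [Field F] (n : ℕ) : GL (Fin n) F where
  val := longestWeyl F n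
  inv := longestWeyl F n
  val_inv := longestWeyl_mul_self n
  inv_val := longestWeyl_mul_self n

@[simp] theorem weylGL_val (n : ℕ) :
    ((weylGL F n : GL (Fin n) F) : Matrix (Fin n) (Fin n) F) = longestWeyl F n := rfl

theorem mul_weylGL_apply {n : ℕ} (g : GL (Fin n) F) (i j : Fin n) :
    ((g * weylGL F n : GL (Fin n) F) : Matrix (Fin n) (Fin n) F) i j =
      (g : Matrix (Fin n) (Fin n) F) i (Fin.rev j) := by
  rw [Units.val_mul, Matrix.mul_apply, Finset.sum_eq_single (Fin.rev j)]
  · simp [longestWeyl]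
  · intro k _ hk
    have : j ≠ Fin.rev k := fun h => hk (by rw [h, Fin.rev_rev])
    simp [longestWeyl, this]
  · simp

theorem weylGL_mul_apply {n : ℕ} (g : GL (Fin n) F) (i j : Fin n) :
    ((weylGL F n * g : GL (Fin n) F) : Matrix (Fin n) (Fin n) F) i j =
      (g : Matrix (Fin n) (Fin n) F) (Fin.rev i) j := by
  rw [Units.val_mul, Matrix.mul_apply, Finset.sum_eq_single (Fin.rev i)]
  · simp [longestWeyl]
  · intro k _ hk
    simp [longestWeyl, hk]
  · simp

theorem diagGL_mul_weylGL {n : ℕ} (a : Fin n → Fˣ) :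
    diagGL a * weylGL F n = weylGL F n * diagGL (fun i => a (Fin.rev i)) := by
  apply Units.ext
  ext i j
  rw [mul_weylGL_apply, weylGL_mul_apply, diagGL_val, diagGL_val, Matrix.diagonal_apply,
    Matrix.diagonal_apply]
  by_cases h : i = Fin.rev j
  · subst h; simp
  · have : Fin.rev i ≠ j := fun h' => h (by rw [← h', Fin.rev_rev])
    simp [h, this]

theorem hMatrix_eq (n : ℕ) : hMatrix F n = translation (fun _ => 1) * embed (weylGL F n) := by
  apply Units.ext
  simp [bordered_mul]

theorem embed_mul_hMatrix {n : ℕ} (g t : GL (Fin n) F) :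
    embed g * hMatrix F n * embed t =
      translation (fun i => ∑ j, (g : Matrix (Fin n) (Fin n) F) i j) *
        embed (g * weylGL F n * t) := by
  rw [hMatrix_eq, embed_mul, embed_mul, ← mul_assoc, embed_mul_translation]
  simp only [mul_assoc]
  congr 2
  ext i
  simp [Matrix.mulVec, dotProduct]

/-- The lower triangular matrix with all entries on and below the diagonal equal to one. -/
def lowerOnes (F : Type*) [Field F] (n : ℕ) : GL (Fin n) F :=
  Matrix.GeneralLinearGroup.mkOfDetNeZero (Matrix.of fun i j => if j ≤ i then 1 else 0) (by
    rw [Matrix.det_of_isLowerTriangular]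
    · simp
    · intro i j hij
      have : ¬ (j ≤ i) := not_le.2 hij
      simp [this])

theorem lowerOnes_apply {n : ℕ} (i j : Fin n) :
    ((lowerOnes F n : GL (Fin n) F) : Matrix (Fin n) (Fin n) F) i j = if j ≤ i then 1 else 0 := rfl

theorem det_lowerOnes {n : ℕ} : Matrix.GeneralLinearGroup.det (lowerOnes F n) = 1 := by
  apply Units.ext
  rw [Matrix.GeneralLinearGroup.val_det_apply, Matrix.det_of_isLowerTriangular]
  · simp [lowerOnes_apply]
  · intro i j hij
    have : ¬ (j ≤ i) := not_le.2 hij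
    simp [this, lowerOnes_apply]

/-- The lower unipotent matrix `t_x⁻¹ L t_x`, where `L` is `lowerOnes`. -/
def lowerConj (n : ℕ) (x : Fˣ) : GL (Fin n) F := (tMatrix x)⁻¹ * lowerOnes F n * tMatrix x

theorem lowerConj_apply {n : ℕ} (x : Fˣ) (i j : Fin n) :
    ((lowerConj n x : GL (Fin n) F) : Matrix (Fin n) (Fin n) F) i j =
      if j ≤ i then (x : F) ^ ((i : ℕ) - j) else 0 := by
  rw [lowerConj, tMatrix_eq, ← map_inv, diagGL_conj_apply, lowerOnes_apply]
  split_ifs with h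
  · have h' : (j : ℕ) ≤ i := h
    have : n - (j : ℕ) = (n - i) + (i - j) := by omega
    simp [this, pow_add]
  · simp

/-- The matrix `diag(-1, …, -1, 1)`. -/
def signGL (F : Type*) [Field F] (n : ℕ) : GL (Fin (n + 1)) F :=
  diagGL (Fin.snoc (fun _ : Fin n => -1) 1 : Fin (n + 1) → Fˣ)

/-- The relation that reduces `h_{n+1}` to `h_n`. -/
theorem lowerOnes_mul_weyl {n : ℕ} (x : Fˣ) :
    lowerOnes F (n + 1) * weylGL F (n + 1) * tMatrix x =
      scalarGL (n + 1) x * (hMatrix F n * embed (tMatrix x)) *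
        (signGL F n * lowerConj (n + 1) x) := by
  have hb : hMatrix F n * embed (tMatrix x) = translation (fun _ => 1) *
      embed (weylGL F n * tMatrix x) := by
    rw [hMatrix_eq, embed_mul, mul_assoc]
  rw [hb, mul_assoc (scalarGL _ _)]
  apply Units.ext
  ext i j
  rw [scalarGL, diagGL_mul_apply, tMatrix_eq, mul_diagGL_apply, mul_weylGL_apply, lowerOnes_apply]
  have hw : ∀ k l : Fin n, ((weylGL F n * tMatrix x : GL (Fin n) F) : Matrix _ _ F) k l =
      if l = Fin.rev k then (x : F) ^ (n - (l : ℕ)) else 0 := by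
    intro k l
    rw [weylGL_mul_apply, tMatrix_eq, diagGL_val, Matrix.diagonal_apply]
    by_cases h : l = Fin.rev k
    · subst h; simp
    · simp [h, Ne.symm h]
  have hs : ∀ k, ((signGL F n * lowerConj (n + 1) x : GL (Fin (n + 1)) F) : Matrix _ _ F) k j =
      (if k = Fin.last n then 1 else -1) * if j ≤ k then (x : F) ^ ((k : ℕ) - j) else 0 := by
    intro k
    rw [signGL, diagGL_mul_apply, lowerConj_apply]
    congr 1
    refine Fin.lastCases ?_ (fun k => ?_) k <;> simp [Fin.castSucc_ne_last]
  rw [Units.val_mul, Units.val_mul, translation_val, embed_val, bordered_mul, Matrix.mul_apply,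
    Fin.sum_univ_castSucc]
  simp only [hs]
  refine Fin.lastCases ?_ (fun i => ?_) i
  · have h1 : n + 1 - (j : ℕ) = (n - j) + 1 := by omega
    simp [Fin.le_last, h1, pow_succ, mul_comm]
  · simp only [bordered_castSucc_castSucc, bordered_castSucc_last, Matrix.one_mul, hw]
    rw [Finset.sum_eq_single (Fin.rev i)]
    · have h0 := i.2
      have h1 : n + 1 - (j : ℕ) = (n - j) + 1 := by omega
      have h2 : n - (n - ((i : ℕ) + 1)) = i + 1 := by omega
      simp only [if_true, Fin.val_rev, h2, h1, Fin.castSucc_ne_last, if_false,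
        Matrix.mulVec_zero, Pi.add_apply, Pi.zero_apply, zero_add, Units.val_pow_eq_pow_val,
        one_mul, Fin.val_last, Fin.val_castSucc, Fin.le_def]
      by_cases hij : n ≤ (i : ℕ) + j
      · have h3 : (j : ℕ) ≤ n := by omega
        have h4 : ¬ ((j : ℕ) ≤ n - (i + 1)) := by omega
        simp [hij, h3, h4, pow_succ, mul_comm]
      · have h3 : ¬ (n + 1 - ((j : ℕ) + 1) ≤ i) := by omega
        have h6 : (j : ℕ) ≤ n := by omega
        have h4 : ((j : ℕ) ≤ n - (i + 1)) := by omega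
        have h5 : n - (j : ℕ) = (i + 1) + (n - (i + 1) - j) := by omega
        simp only [h3, h4, h5, h6, if_true, if_false, pow_add]
        ring
    · intro l _ hl
      simp [hl]
    · simp

end Algebra

end LocalBirch

namespace LocalBirch

section Groups

variable {F : Type*} [NontriviallyNormedField F] [IsUltrametricDist F]

/-! ### The maximal compact subgroup and the groups `I_α` -/

theorem mem_integers_iff (x : F) : x ∈ integers F ↔ ‖x‖ ≤ 1 := by
  rw [integers, Valuation.mem_valuationSubring_iff]
  rfl

/-- The integers, as a matrix. -/
theorem exists_integral_lift {n : ℕ} (M : Matrix (Fin n) (Fin n) F) (hM : ∀ i j, ‖M i j‖ ≤ 1) :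
    ∃ A : Matrix (Fin n) (Fin n) (integers F), A.map (algebraMap (integers F) F) = M :=
  ⟨Matrix.of fun i j => ⟨M i j, (mem_integers_iff _).2 (hM i j)⟩, rfl⟩

theorem norm_algebraMap_le (x : integers F) : ‖algebraMap (integers F) F x‖ ≤ 1 :=
  (mem_integers_iff _).1 x.2

theorem norm_det_le_one {n : ℕ} (M : Matrix (Fin n) (Fin n) F) (hM : ∀ i j, ‖M i j‖ ≤ 1) :
    ‖M.det‖ ≤ 1 := by
  obtain ⟨A, rfl⟩ := exists_integral_lift M hM
  have := RingHom.map_det (algebraMap (integers F) F) A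
  rw [RingHom.mapMatrix_apply] at this
  rw [← this]
  exact norm_algebraMap_le _

theorem norm_entry_le_one {n : ℕ} {g : GL (Fin n) F} (hg : g ∈ maximalCompact F n) (i j : Fin n) :
    ‖(g : Matrix (Fin n) (Fin n) F) i j‖ ≤ 1 := by
  obtain ⟨k, rfl⟩ := hg
  exact norm_algebraMap_le _

theorem norm_det_eq_one {n : ℕ} {g : GL (Fin n) F} (hg : g ∈ maximalCompact F n) :
    ‖(Matrix.GeneralLinearGroup.det g : F)‖ = 1 := by
  have h1 : ‖(Matrix.GeneralLinearGroup.det g : F)‖ ≤ 1 :=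
    norm_det_le_one _ (norm_entry_le_one hg)
  have h2 : ‖(Matrix.GeneralLinearGroup.det g⁻¹ : F)‖ ≤ 1 :=
    norm_det_le_one _ (norm_entry_le_one (inv_mem hg))
  rw [map_inv, Units.val_inv_eq_inv_val, norm_inv] at h2
  refine le_antisymm h1 ?_
  have h3 : 0 < ‖(Matrix.GeneralLinearGroup.det g : F)‖ := norm_pos_iff.2 (Units.ne_zero _)
  by_contra h
  exact absurd h2 (not_le.2 ((one_lt_inv₀ h3).2 (not_le.1 h)))

theorem mem_maximalCompact_iff {n : ℕ} (g : GL (Fin n) F) :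
    g ∈ maximalCompact F n ↔ (∀ i j, ‖(g : Matrix (Fin n) (Fin n) F) i j‖ ≤ 1) ∧
      ‖(Matrix.GeneralLinearGroup.det g : F)‖ = 1 := by
  refine ⟨fun h => ⟨norm_entry_le_one h, norm_det_eq_one h⟩, fun ⟨h1, h2⟩ => ?_⟩
  obtain ⟨A, hA⟩ := exists_integral_lift _ h1
  have hd : algebraMap (integers F) F A.det = Matrix.GeneralLinearGroup.det g := by
    rw [RingHom.map_det, RingHom.mapMatrix_apply, hA]; rfl
  have hu : IsUnit A.det := by
    refine IsUnit.of_mul_eq_one (⟨(Matrix.GeneralLinearGroup.det g : F)⁻¹, ?_⟩ : integers F) ?_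
    · rw [mem_integers_iff, norm_inv, h2, inv_one]
    · apply Subtype.ext
      change algebraMap (integers F) F A.det * _ = 1
      rw [hd, mul_inv_cancel₀ (Units.ne_zero _)]
  refine ⟨Matrix.GeneralLinearGroup.mk'' A hu, Units.ext ?_⟩
  rw [← hA]
  rfl

theorem diagGL_mem_maximalCompact {n : ℕ} (a : Fin n → Fˣ) (ha : ∀ i, ‖(a i : F)‖ = 1) :
    diagGL a ∈ maximalCompact F n := by
  rw [mem_maximalCompact_iff]
  constructor
  · intro i j
    rw [diagGL_val, Matrix.diagonal_apply]
    split_ifs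
    · exact (ha i).le
    · simp
  · rw [det_diagGL, Units.coe_prod, norm_prod]
    simp [ha]

theorem embed_mem_maximalCompact {n : ℕ} {g : GL (Fin n) F} (hg : g ∈ maximalCompact F n) :
    embed g ∈ maximalCompact F (n + 1) := by
  rw [mem_maximalCompact_iff]
  constructor
  · intro i j
    rw [embed_val]
    refine Fin.lastCases ?_ (fun i => ?_) i <;> refine Fin.lastCases ?_ (fun j => ?_) j <;>
      simp [norm_entry_le_one hg]
  · rw [det_embed, norm_det_eq_one hg]

theorem lowerConj_mem_iwahori (ϖ : Fˣ) (hϖ : ‖(ϖ : F)‖ ≤ 1) (n α : ℕ) :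
    lowerConj n (ϖ ^ α) ∈ iwahori ϖ n α := by
  refine ⟨?_, ?_⟩
  · rw [mem_maximalCompact_iff]
    constructor
    · intro i j
      rw [lowerConj_apply]
      split_ifs
      · simp only [Units.val_pow_eq_pow_val, norm_pow]
        exact pow_le_one₀ (by positivity) (pow_le_one₀ (by positivity) hϖ)
      · simp
    · rw [lowerConj, map_mul, map_mul, det_lowerOnes, map_inv]
      simp
  · intro i j hij
    rw [lowerConj_apply, if_pos hij.le]
    simp only [Units.val_pow_eq_pow_val, norm_pow]
    exact pow_le_of_le_one (by positivity) (pow_le_one₀ (by positivity) hϖ)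
      (by have : (j : ℕ) < i := hij; omega)

theorem lowerOnes_mem_maximalCompact (n : ℕ) : lowerOnes F n ∈ maximalCompact F n := by
  rw [mem_maximalCompact_iff]
  refine ⟨fun i j => ?_, by rw [det_lowerOnes]; simp⟩
  rw [lowerOnes_apply]
  split_ifs <;> simp

theorem diagGL_mem_iwahori (ϖ : Fˣ) {n : ℕ} (α : ℕ) (a : Fin n → Fˣ) (ha : ∀ i, ‖(a i : F)‖ = 1) :
    diagGL a ∈ iwahori ϖ n α := by
  refine ⟨diagGL_mem_maximalCompact a ha, fun i j hij => ?_⟩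
  rw [diagGL_val, Matrix.diagonal_apply_ne _ hij.ne']
  simp

theorem embed_mem_iwahori (ϖ : Fˣ) {n α : ℕ} {g : GL (Fin n) F} (hg : g ∈ iwahori ϖ n α) :
    embed g ∈ iwahori ϖ (n + 1) α := by
  refine ⟨embed_mem_maximalCompact hg.1, fun i j => ?_⟩
  rw [embed_val]
  refine Fin.lastCases ?_ (fun i => ?_) i <;> refine Fin.lastCases ?_ (fun j => ?_) j
  · simp
  · simp
  · intro h; exact absurd h (not_lt.2 (Fin.castSucc_lt_last _).le)
  · intro h
    simpa using hg.2 i j (by simpa using h)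

/-! ### Characters -/

@[simp] theorem charVal_coe (χ : Fˣ →ₜ* ℂˣ) (u : Fˣ) : charVal χ (u : F) = χ u := by
  rw [charVal, dif_neg u.ne_zero]
  simp

theorem charVal_of_ne (χ : Fˣ →ₜ* ℂˣ) {x : F} (hx : x ≠ 0) :
    charVal χ x = χ (Units.mk0 x hx) := by
  rw [charVal, dif_neg hx]

theorem charVal_one (χ : Fˣ →ₜ* ℂˣ) : charVal χ 1 = 1 := by
  rw [← Units.val_one, charVal_coe, map_one, Units.val_one]

theorem charVal_mul (χ : Fˣ →ₜ* ℂˣ) (x y : F) : charVal χ (x * y) = charVal χ x * charVal χ y := by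
  by_cases hx : x = 0
  · simp [charVal, hx]
  by_cases hy : y = 0
  · simp [charVal, hy]
  rw [charVal_of_ne χ hx, charVal_of_ne χ hy, charVal_of_ne χ (mul_ne_zero hx hy), ← Units.val_mul,
    ← map_mul]
  congr 2
  ext
  simp

theorem diagChar_diagGL {n : ℕ} (θ : Fin n → (Fˣ →ₜ* ℂˣ)) (a : Fin n → Fˣ) :
    diagChar θ (diagGL a) = ∏ i, (θ i (a i) : ℂ) := by
  simp [diagChar]

theorem diagChar_lowerConj {n : ℕ} (θ : Fin n → (Fˣ →ₜ* ℂˣ)) (x : Fˣ) :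
    diagChar θ (lowerConj n x) = 1 := by
  simp [diagChar, lowerConj_apply, charVal_one]

theorem genericChar_embed {n : ℕ} (ψ : AddChar F ℂ) (u : GL (Fin n) F) :
    genericChar ψ (embed u) = genericChar ψ u := by
  unfold genericChar
  rw [Fin.prod_univ_castSucc]
  simp only [Fin.prod_univ_castSucc, embed_val]
  have h1 : ∀ x : Fin n, ¬ (n + 1 = (x : ℕ)) := fun x => by have := x.2; omega
  simp [h1]

theorem genericChar_translation {n : ℕ} (ψ : AddChar F ℂ) (c : Fin (n + 1) → F) :
    genericChar ψ (translation c) = ψ (c (Fin.last n)) := by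
  unfold genericChar
  rw [Fin.prod_univ_castSucc]
  simp only [Fin.prod_univ_castSucc (n := n + 1), translation_val]
  have h1 : ∀ x : Fin (n + 1), ¬ (n + 1 + 1 = (x : ℕ)) := fun x => by have := x.2; omega
  have h2 : ∀ i j : Fin (n + 1), (if (i : ℕ) + 1 = j then
      ψ ((1 : Matrix (Fin (n + 1)) (Fin (n + 1)) F) i j) else 1) = 1 := by
    intro i j
    split_ifs with h
    · rw [Matrix.one_apply_ne (fun h' => by subst h'; omega), AddChar.map_zero_eq_one]
    · rfl
  simp [h1, h2]
  rw [Fin.prod_univ_castSucc]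
  have h3 : ∀ x : Fin n, ¬ ((x : ℕ) = n) := fun x => by have := x.2; omega
  simp [h3]

theorem genericChar_inv_mul {n : ℕ} (ψ : AddChar F ℂ) (u : GL (Fin n) F) :
    genericChar ψ u * genericChar ψ⁻¹ u = 1 := by
  unfold genericChar
  rw [← Finset.prod_mul_distrib]
  refine Finset.prod_eq_one fun i _ => ?_
  rw [← Finset.prod_mul_distrib]
  refine Finset.prod_eq_one fun j _ => ?_
  split_ifs
  · rw [AddChar.inv_apply, ← AddChar.map_add_eq_mul, add_neg_cancel, AddChar.map_zero_eq_one]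
  · simp

/-! ### The group `U_n` -/

theorem embed_mem_unipotent {n : ℕ} {u : GL (Fin n) F} (hu : u ∈ unipotent F n) :
    embed u ∈ unipotent F (n + 1) := by
  refine ⟨?_, ?_⟩
  · intro i j
    rw [embed_val]
    refine Fin.lastCases ?_ (fun i => ?_) i <;> refine Fin.lastCases ?_ (fun j => ?_) j
    · simp
    · simp
    · simp
    · intro h
      simpa using hu.1 (show id j < id i by simpa using h)
  · intro i
    rw [embed_val]
    refine Fin.lastCases ?_ (fun i => ?_) i
    · simp
    · simpa using hu.2 i

theorem translation_mem_unipotent {n : ℕ} (c : Fin n → F) :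
    translation c ∈ unipotent F (n + 1) := by
  refine ⟨?_, ?_⟩
  · intro i j
    rw [translation_val]
    refine Fin.lastCases ?_ (fun i => ?_) i <;> refine Fin.lastCases ?_ (fun j => ?_) j
    · simp
    · simp
    · intro h; exact absurd h (not_lt.2 (Fin.castSucc_lt_last _).le)
    · intro h
      have : j < i := by simpa using h
      simp [this.ne']
  · intro i
    rw [translation_val]
    refine Fin.lastCases ?_ (fun i => ?_) i <;> simp

theorem diagGL_conj_mem_unipotent {n : ℕ} (a : Fin n → Fˣ) {u : GL (Fin n) F}
    (hu : u ∈ unipotent F n) : diagGL a * u * (diagGL a)⁻¹ ∈ unipotent F n := by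
  rw [← map_inv]
  refine ⟨?_, ?_⟩
  · intro i j hij
    rw [diagGL_conj_apply, hu.1 hij]
    simp
  · intro i
    rw [diagGL_conj_apply, hu.2 i]
    simp

end Groups

end LocalBirch

namespace LocalBirch

/-! ### Invariance of Haar measures under maps that preserve a set -/

section Haar

open Measure

/-- A multiple of a Haar measure that agrees with it on a compact set with interior is
the same measure. -/
@[to_additive]
theorem isHaarMeasure_eq_of_apply_eq {G : Type*} [Group G] [TopologicalSpace G] [IsTopologicalGroup G]
    [LocallyCompactSpace G] [SecondCountableTopology G] [MeasurableSpace G] [BorelSpace G]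
    (μ μ' : Measure G) [μ.IsHaarMeasure] [μ'.IsHaarMeasure]
    (C : Set G) (h0 : μ C ≠ 0) (h1 : μ C ≠ ∞) (h : μ' C = μ C) : μ' = μ := by
  have h2 := isMulLeftInvariant_eq_smul μ' μ
  rw [h2] at h
  have h3 : haarScalarFactor μ' μ = 1 := by
    rw [Measure.smul_apply, ENNReal.smul_def, smul_eq_mul] at h
    have : (haarScalarFactor μ' μ : ℝ≥0∞) = 1 := by
      rw [← ENNReal.mul_left_inj h0 h1, h, one_mul]
    exact_mod_cast this
  rw [h2, h3, one_smul]

theorem map_mul_right_eq_of_compact {G : Type*} [Group G] [TopologicalSpace G]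
    [IsTopologicalGroup G] [LocallyCompactSpace G] [SecondCountableTopology G] [MeasurableSpace G]
    [BorelSpace G] (μ : Measure G) [μ.IsHaarMeasure] (K : Subgroup G) (hK : IsOpen (K : Set G))
    (hK' : IsCompact (K : Set G)) (k : G) (hk : k ∈ K) : μ.map (· * k) = μ := by
  have : (μ.map (· * k)).IsHaarMeasure := isHaarMeasure_map_mul_right μ k
  refine isHaarMeasure_eq_of_apply_eq _ _ (K : Set G) ?_ hK'.measure_ne_top ?_
  · exact (hK.measure_pos μ ⟨1, K.one_mem⟩).ne'
  · rw [Measure.map_apply (measurable_mul_const k) hK.measurableSet]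
    congr 1
    ext g
    simp [K.mul_mem_cancel_right hk]

/-- A Haar measure on a group that is the union of its compact open subgroups is invariant
under translations from the right. -/
theorem isMulRightInvariant_of_compact_union {G : Type*} [Group G] [TopologicalSpace G]
    [IsTopologicalGroup G] [LocallyCompactSpace G] [SecondCountableTopology G] [MeasurableSpace G]
    [BorelSpace G] (μ : Measure G) [μ.IsHaarMeasure]
    (h : ∀ g : G, ∃ K : Subgroup G, IsOpen (K : Set G) ∧ IsCompact (K : Set G) ∧ g ∈ K) :
    μ.IsMulRightInvariant := by
  refine ⟨fun g => ?_⟩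
  obtain ⟨K, h1, h2, h3⟩ := h g
  exact map_mul_right_eq_of_compact μ K h1 h2 g h3

/-- A Haar measure on a group that is the union of its compact open subgroups is invariant
under inversion. -/
theorem isInvInvariant_of_compact_union {G : Type*} [Group G] [TopologicalSpace G]
    [IsTopologicalGroup G] [LocallyCompactSpace G] [SecondCountableTopology G] [MeasurableSpace G]
    [BorelSpace G] (μ : Measure G) [μ.IsHaarMeasure]
    (h : ∀ g : G, ∃ K : Subgroup G, IsOpen (K : Set G) ∧ IsCompact (K : Set G) ∧ g ∈ K) :
    μ.IsInvInvariant := by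
  have := isMulRightInvariant_of_compact_union μ h
  obtain ⟨K, h1, h2, h3⟩ := h 1
  have : μ.inv.IsHaarMeasure := by
    have : IsFiniteMeasureOnCompacts μ.inv := by
      refine ⟨fun C hC => ?_⟩
      rw [Measure.inv_apply]
      exact hC.inv.measure_lt_top
    have : IsOpenPosMeasure μ.inv := by
      refine ⟨fun U hU hne => ?_⟩
      rw [Measure.inv_apply]
      exact (hU.inv.measure_pos μ hne.inv).ne'
    constructor
  refine ⟨isHaarMeasure_eq_of_apply_eq _ _ (K : Set G) ?_ h2.measure_ne_top ?_⟩
  · exact (h1.measure_pos μ ⟨1, K.one_mem⟩).ne'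
  · rw [Measure.inv_apply]
    congr 1
    ext g
    simp

end Haar

section Topology

variable {F : Type*} [NontriviallyNormedField F] [IsUltrametricDist F]

/-! ### Topology of `GL_n(F)` -/

theorem continuous_entry {n : ℕ} (i j : Fin n) :
    Continuous fun g : GL (Fin n) F => (g : Matrix (Fin n) (Fin n) F) i j :=
  Units.continuous_val.matrix_elem i j

theorem continuous_det_GL {n : ℕ} :
    Continuous fun g : GL (Fin n) F => Matrix.GeneralLinearGroup.det g := by
  rw [Units.continuous_iff]
  constructor
  · exact Continuous.matrix_det Units.continuous_val
  · have : (fun g : GL (Fin n) F => (((Matrix.GeneralLinearGroup.det g)⁻¹ : Fˣ) : F)) =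
        fun g => (((g⁻¹ : GL (Fin n) F)) : Matrix (Fin n) (Fin n) F).det := by
      ext g
      rw [← map_inv]
      rfl
    change Continuous (fun g : GL (Fin n) F => (((Matrix.GeneralLinearGroup.det g)⁻¹ : Fˣ) : F))
    rw [this]
    exact Continuous.matrix_det Units.continuous_coe_inv

theorem continuous_bordered {n : ℕ} :
    Continuous fun p : Matrix (Fin n) (Fin n) F × (Fin n → F) => bordered p.1 p.2 := by
  refine continuous_matrix fun i j => ?_
  refine Fin.lastCases ?_ (fun i => ?_) i <;> refine Fin.lastCases ?_ (fun j => ?_) j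
  · simp [continuous_const]
  · simp [continuous_const]
  · simp only [bordered_castSucc_last]
    fun_prop
  · simp only [bordered_castSucc_castSucc]
    exact continuous_fst.matrix_elem i j

theorem continuous_embed {n : ℕ} : Continuous fun g : GL (Fin n) F => embed g := by
  rw [Units.continuous_iff]
  constructor
  · exact continuous_bordered.comp (Units.continuous_val.prodMk continuous_const)
  · have : (fun g : GL (Fin n) F => (((embed g)⁻¹ : GL (Fin (n + 1)) F) : Matrix (Fin (n + 1)) (Fin (n + 1)) F)) =
        fun g => bordered ((g⁻¹ : GL (Fin n) F) : Matrix (Fin n) (Fin n) F) 0 := by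
      ext1 g
      rw [← embed_inv]
      rfl
    change Continuous (fun g : GL (Fin n) F => (((embed g)⁻¹ : GL (Fin (n + 1)) F) : Matrix (Fin (n + 1)) (Fin (n + 1)) F))
    rw [this]
    exact continuous_bordered.comp (Units.continuous_coe_inv.prodMk continuous_const)

theorem isOpen_maximalCompact (n : ℕ) : IsOpen (maximalCompact F n : Set (GL (Fin n) F)) := by
  have : (maximalCompact F n : Set (GL (Fin n) F)) =
      (⋂ i, ⋂ j, (fun g : GL (Fin n) F => (g : Matrix (Fin n) (Fin n) F) i j) ⁻¹'
        Metric.closedBall 0 1) ∩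
      (fun g : GL (Fin n) F => (Matrix.GeneralLinearGroup.det g : F)) ⁻¹' Metric.sphere 0 1 := by
    ext g
    simp [mem_maximalCompact_iff]
  rw [this]
  refine IsOpen.inter (isOpen_iInter_of_finite fun i => isOpen_iInter_of_finite fun j => ?_) ?_
  · exact (IsUltrametricDist.isOpen_closedBall 0 one_ne_zero).preimage (continuous_entry i j)
  · exact (IsUltrametricDist.isOpen_sphere 0 one_ne_zero).preimage
      (Units.continuous_val.comp continuous_det_GL)

theorem isOpen_iwahori (ϖ : Fˣ) (n α : ℕ) : IsOpen (iwahori ϖ n α : Set (GL (Fin n) F)) := by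
  have : (iwahori ϖ n α : Set (GL (Fin n) F)) = (maximalCompact F n : Set (GL (Fin n) F)) ∩
      ⋂ i, ⋂ j, ⋂ _ : j < i, (fun g : GL (Fin n) F => (g : Matrix (Fin n) (Fin n) F) i j) ⁻¹'
        Metric.closedBall 0 (‖(ϖ : F)‖ ^ α) := by
    ext g
    simp [iwahori]
  rw [this]
  refine (isOpen_maximalCompact n).inter (isOpen_iInter_of_finite fun i =>
    isOpen_iInter_of_finite fun j => isOpen_iInter_of_finite fun _ => ?_)
  refine (IsUltrametricDist.isOpen_closedBall 0 ?_).preimage (continuous_entry i j)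
  exact pow_ne_zero _ (norm_ne_zero_iff.2 ϖ.ne_zero)

theorem one_mem_iwahori (ϖ : Fˣ) (n α : ℕ) : (1 : GL (Fin n) F) ∈ iwahori ϖ n α := by
  have := diagGL_mem_iwahori ϖ (n := n) α (fun _ => 1) (by simp)
  rwa [show (fun _ : Fin n => (1 : Fˣ)) = 1 from rfl, map_one] at this

section Proper

variable [ProperSpace F]

theorem isCompact_maximalCompact (n : ℕ) :
    IsCompact (maximalCompact F n : Set (GL (Fin n) F)) := by
  let S : Set (Matrix (Fin n) (Fin n) F) := {M | ∀ i j, ‖M i j‖ ≤ 1}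
  have hS : IsCompact S := by
    have : S = Set.pi Set.univ fun _ => Set.pi Set.univ fun _ => Metric.closedBall (0 : F) 1 := by
      ext M
      change (∀ i j, ‖M i j‖ ≤ 1) ↔ ∀ i ∈ Set.univ, ∀ j ∈ Set.univ, M i j ∈ Metric.closedBall 0 1
      simp
    rw [this]
    exact isCompact_univ_pi fun _ => isCompact_univ_pi fun _ => isCompact_closedBall _ _
  have h2 : IsCompact (S ×ˢ (MulOpposite.unop ⁻¹' S : Set (Matrix (Fin n) (Fin n) F)ᵐᵒᵖ)) :=
    hS.prod (MulOpposite.opHomeomorph.symm.isCompact_preimage.2 hS)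
  have h3 := Units.isClosedEmbedding_embedProduct.isCompact_preimage h2
  convert h3 using 1
  ext g
  constructor
  · intro hg
    exact ⟨norm_entry_le_one hg, norm_entry_le_one (inv_mem hg)⟩
  · rintro ⟨h1, h2⟩
    rw [SetLike.mem_coe, mem_maximalCompact_iff]
    refine ⟨h1, le_antisymm (norm_det_le_one _ h1) ?_⟩
    have h4 : ‖(Matrix.GeneralLinearGroup.det g⁻¹ : F)‖ ≤ 1 := norm_det_le_one _ h2
    rw [map_inv, Units.val_inv_eq_inv_val, norm_inv] at h4
    by_contra h
    exact absurd h4 (not_le.2 ((one_lt_inv₀ (norm_pos_iff.2 (Units.ne_zero _))).2 (not_le.1 h)))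

instance (n : ℕ) : SecondCountableTopology (GL (Fin n) F) := by
  have : SecondCountableTopology (Matrix (Fin n) (Fin n) F) :=
    inferInstanceAs (SecondCountableTopology (Fin n → Fin n → F))
  have : SecondCountableTopology (Matrix (Fin n) (Fin n) F)ᵐᵒᵖ :=
    MulOpposite.opHomeomorph.symm.secondCountableTopology
  exact Units.isEmbedding_embedProduct.secondCountableTopology

instance (n : ℕ) : LocallyCompactSpace (GL (Fin n) F) := by
  have : LocallyCompactSpace (Matrix (Fin n) (Fin n) F) :=
    inferInstanceAs (LocallyCompactSpace (Fin n → Fin n → F))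
  infer_instance

theorem continuousAt_charVal (χ : Fˣ →ₜ* ℂˣ) {x : F} (hx : x ≠ 0) :
    ContinuousAt (charVal χ) x := by
  have h : ContinuousAt (charVal χ ∘ Units.val) (Units.mk0 x hx) ↔ _ :=
    (Units.isOpenEmbedding_val (R := F)).continuousAt_iff
  rw [Units.val_mk0] at h
  rw [← h]
  have : charVal χ ∘ Units.val = fun u : Fˣ => (χ u : ℂ) := by
    ext u; simp
  rw [this]
  exact (Units.continuous_val.comp χ.continuous_toFun).continuousAt

theorem continuousAt_diagChar {n : ℕ} (θ : Fin n → (Fˣ →ₜ* ℂˣ)) :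
    ContinuousAt (diagChar (F := F) θ) 1 := by
  unfold diagChar
  refine tendsto_finsetProd _ fun i _ => ?_
  have h : ContinuousAt (charVal (θ i)) (((1 : GL (Fin n) F) : Matrix (Fin n) (Fin n) F) i i) :=
    continuousAt_charVal _ (by simp)
  exact ContinuousAt.comp (f := fun g : GL (Fin n) F => (g : Matrix (Fin n) (Fin n) F) i i) h
    (continuous_entry i i).continuousAt

theorem IsWhittaker.continuous {ϖ : Fˣ} {n : ℕ} {ψ : AddChar F ℂ} {α : ℕ}
    {θ : Fin n → (Fˣ →ₜ* ℂˣ)} {w : GL (Fin n) F → ℂ} (hw : IsWhittaker ϖ ψ α θ w) :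
    Continuous w := by
  rw [continuous_iff_continuousAt]
  intro g
  have h1 : Filter.Tendsto (fun g' => diagChar θ (g⁻¹ * g') * w g) (nhds g) (nhds (w g)) := by
    have h2 : ContinuousAt (fun g' : GL (Fin n) F => g⁻¹ * g') g :=
      (continuous_const_mul _).continuousAt
    have h3 : Filter.Tendsto (fun g' => diagChar θ (g⁻¹ * g')) (nhds g) (nhds (diagChar θ 1)) := by
      refine (continuousAt_diagChar θ).tendsto.comp ?_
      have := h2.tendsto
      rwa [inv_mul_cancel] at this
    have h4 : diagChar θ (1 : GL (Fin n) F) = 1 := by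
      simp [diagChar, charVal_one]
    rw [h4] at h3
    simpa using h3.mul_const (w g)
  refine h1.congr' ?_
  have h5 : ∀ᶠ g' in nhds g, g⁻¹ * g' ∈ iwahori ϖ n α := by
    refine (continuous_const_mul g⁻¹).continuousAt.eventually_mem ?_
    rw [inv_mul_cancel]
    exact (isOpen_iwahori ϖ n α).mem_nhds (one_mem_iwahori ϖ n α)
  filter_upwards [h5] with g' hg'
  rw [← hw.right g _ hg', mul_inv_cancel_left]

theorem HasConductorIntegers.continuous {ψ : AddChar F ℂ} (hψ : HasConductorIntegers ψ) :
    Continuous ψ := by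
  rw [continuous_iff_continuousAt]
  intro x
  refine continuousAt_const.congr (f := fun _ => ψ x) ?_
  filter_upwards [Metric.closedBall_mem_nhds x one_pos] with y hy
  have h1 : ‖y - x‖ ≤ 1 := by rwa [Metric.mem_closedBall, dist_eq_norm] at hy
  have h2 := (hψ (y - x)).2 h1 1 (by simp)
  rw [mul_one] at h2
  rw [show y = x + (y - x) by ring, AddChar.map_add_eq_mul, h2, mul_one]

theorem map_mul_right_maximalCompact {n : ℕ} (ν : Measure (GL (Fin n) F)) [ν.IsHaarMeasure]
    {k : GL (Fin n) F} (hk : k ∈ maximalCompact F n) : ν.map (· * k) = ν :=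
  map_mul_right_eq_of_compact ν _ (isOpen_maximalCompact n) (isCompact_maximalCompact n) k hk

end Proper

end Topology

end LocalBirch

namespace LocalBirch

section Gauss

variable {F : Type*} [NontriviallyNormedField F] [IsUltrametricDist F]

/-! ### Uniformizers and conductors -/

theorem IsUniformizer.norm_lt_one {ϖ : Fˣ} (hϖ : IsUniformizer ϖ) : ‖(ϖ : F)‖ < 1 :=
  (hϖ _).2 le_rfl

theorem norm_unit_pos (ϖ : Fˣ) : 0 < ‖(ϖ : F)‖ := norm_pos_iff.2 ϖ.ne_zero

theorem IsUniformizer.exists_norm_eq {ϖ : Fˣ} (hϖ : IsUniformizer ϖ) {x : F} (hx : x ≠ 0) :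
    ∃ m : ℤ, ‖x‖ = ‖(ϖ : F)‖ ^ m := by
  have h0 := norm_unit_pos ϖ
  have h1 := hϖ.norm_lt_one
  obtain ⟨m, hm1, hm2⟩ := exists_mem_Ioc_zpow (x := ‖x‖) (y := ‖(ϖ : F)‖⁻¹) (norm_pos_iff.2 hx)
    ((one_lt_inv₀ h0).2 h1)
  refine ⟨-(m + 1), ?_⟩
  rw [inv_zpow'] at hm1 hm2
  refine le_antisymm hm2 ?_
  by_contra hlt
  have h2 : ‖x * (ϖ : F) ^ (m + 1)‖ < 1 := by
    rw [norm_mul, norm_zpow]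
    calc ‖x‖ * ‖(ϖ : F)‖ ^ (m + 1)
        < ‖(ϖ : F)‖ ^ (-(m + 1)) * ‖(ϖ : F)‖ ^ (m + 1) := by
          apply mul_lt_mul_of_pos_right (not_le.1 hlt) (zpow_pos h0 _)
      _ = 1 := by rw [← zpow_add₀ h0.ne']; simp
  have h3 := (hϖ _).1 h2
  rw [norm_mul, norm_zpow, zpow_add₀ h0.ne', zpow_one, ← mul_assoc] at h3
  have h4 : ‖x‖ * ‖(ϖ : F)‖ ^ m ≤ 1 := by
    by_contra h5
    exact absurd h3 (not_le.2 ((lt_mul_iff_one_lt_left h0).2 (not_le.1 h5)))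
  have h5 : ‖x‖ ≤ ‖(ϖ : F)‖ ^ (-m) := by
    rw [zpow_neg, le_inv_comm₀ (norm_pos_iff.2 hx) (zpow_pos h0 _), inv_eq_one_div,
      le_div_iff₀ (norm_pos_iff.2 hx), mul_comm]
    exact h4
  exact absurd hm1 (not_lt.2 h5)

theorem IsUniformizer.zpow_le_zpow_iff {ϖ : Fˣ} (hϖ : IsUniformizer ϖ) {a b : ℤ} :
    ‖(ϖ : F)‖ ^ a ≤ ‖(ϖ : F)‖ ^ b ↔ b ≤ a :=
  zpow_le_zpow_iff_right_of_lt_one₀ (norm_unit_pos ϖ) hϖ.norm_lt_one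

theorem IsUniformizer.zpow_inj {ϖ : Fˣ} (hϖ : IsUniformizer ϖ) {a b : ℤ}
    (h : ‖(ϖ : F)‖ ^ a = ‖(ϖ : F)‖ ^ b) : a = b :=
  le_antisymm (hϖ.zpow_le_zpow_iff.1 h.ge) (hϖ.zpow_le_zpow_iff.1 h.le)

theorem conductorExp_spec {ϖ : Fˣ} {χ : Fˣ →ₜ* ℂˣ} (h : 1 ≤ conductorExp ϖ χ) {u : Fˣ}
    (hu : ‖(u : F)‖ = 1) (hu' : ‖(u : F) - 1‖ ≤ ‖(ϖ : F)‖ ^ conductorExp ϖ χ) : χ u = 1 := by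
  have hne : {e : ℕ | ∀ u : Fˣ, ‖(u : F)‖ = 1 → ‖(u : F) - 1‖ ≤ ‖(ϖ : F)‖ ^ e → χ u = 1}.Nonempty := by
    rw [Set.nonempty_iff_ne_empty]
    intro h'
    rw [conductorExp, h', Nat.sInf_empty] at h
    omega
  exact Nat.sInf_mem hne u hu hu'

theorem exists_ne_one_of_conductorExp {ϖ : Fˣ} {χ : Fˣ →ₜ* ℂˣ} (h : 1 ≤ conductorExp ϖ χ) :
    ∃ u : Fˣ, ‖(u : F)‖ = 1 ∧ ‖(u : F) - 1‖ ≤ ‖(ϖ : F)‖ ^ (conductorExp ϖ χ - 1) ∧ χ u ≠ 1 := by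
  have : conductorExp ϖ χ - 1 ∉
      {e : ℕ | ∀ u : Fˣ, ‖(u : F)‖ = 1 → ‖(u : F) - 1‖ ≤ ‖(ϖ : F)‖ ^ e → χ u = 1} :=
    Nat.notMem_of_lt_sInf (by unfold conductorExp at h ⊢; omega)
  simpa [and_assoc] using this

theorem charVal_add_of_conductorExp {ϖ : Fˣ} (hϖ : IsUniformizer ϖ) {χ : Fˣ →ₜ* ℂˣ}
    (h : 1 ≤ conductorExp ϖ χ) {x z : F} (hx : ‖x‖ = 1)
    (hz : ‖z‖ ≤ ‖(ϖ : F)‖ ^ conductorExp ϖ χ) : charVal χ (x + z) = charVal χ x := by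
  have hx0 : x ≠ 0 := norm_ne_zero_iff.1 (by rw [hx]; exact one_ne_zero)
  have hz1 : ‖z‖ < 1 := hz.trans_lt (pow_lt_one₀ (norm_nonneg _) hϖ.norm_lt_one (by omega))
  have hxz : ‖x + z‖ = 1 := by
    rw [IsUltrametricDist.norm_add_eq_max_of_norm_ne_norm (by rw [hx]; exact hz1.ne'), hx,
      max_eq_left hz1.le]
  have hxz0 : x + z ≠ 0 := norm_ne_zero_iff.1 (by rw [hxz]; exact one_ne_zero)
  have h1 : x + z = x * ((x + z) / x) := by field_simp
  have h2 : (x + z) / x ≠ 0 := div_ne_zero hxz0 hx0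
  rw [h1, charVal_mul, charVal_of_ne χ h2, conductorExp_spec h]
  · simp
  · rw [Units.val_mk0, norm_div, hxz, hx, div_one]
  · rw [Units.val_mk0, show (x + z) / x - 1 = z / x by field_simp; ring, norm_div, hx, div_one]
    exact hz

/-! ### The residue rings -/

theorem isUnit_integers_iff (x : integers F) : IsUnit x ↔ ‖(x : F)‖ = 1 := by
  constructor
  · rintro ⟨u, rfl⟩
    have h1 := norm_algebraMap_le (u : integers F)
    have h2 := norm_algebraMap_le ((u⁻¹ : (integers F)ˣ) : integers F)
    have h3 : ((u : integers F) : F) * (((u⁻¹ : (integers F)ˣ) : integers F) : F) = 1 := by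
      exact congrArg (fun x : integers F => (x : F)) u.mul_inv
    have h4 := congrArg norm h3
    rw [norm_mul, norm_one] at h4
    refine le_antisymm h1 ?_
    calc (1 : ℝ) = _ := h4.symm
      _ ≤ ‖((u : integers F) : F)‖ * 1 := by gcongr; exact h2
      _ = _ := mul_one _
  · intro h
    have h0 : (x : F) ≠ 0 := norm_ne_zero_iff.1 (by rw [h]; exact one_ne_zero)
    refine IsUnit.of_mul_eq_one (⟨(x : F)⁻¹, ?_⟩ : integers F) ?_
    · rw [mem_integers_iff, norm_inv, h, inv_one]
    · apply Subtype.ext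
      change (x : F) * (x : F)⁻¹ = 1
      exact mul_inv_cancel₀ h0

/-- A uniformizer as an element of the valuation ring. -/
def IsUniformizer.toIntegers {ϖ : Fˣ} (hϖ : IsUniformizer ϖ) : integers F :=
  ⟨ϖ, (mem_integers_iff _).2 hϖ.norm_lt_one.le⟩

theorem IsUniformizer.toIntegers_pow_dvd_iff {ϖ : Fˣ} (hϖ : IsUniformizer ϖ) (m : ℕ)
    (x : integers F) : hϖ.toIntegers ^ m ∣ x ↔ ‖(x : F)‖ ≤ ‖(ϖ : F)‖ ^ m := by
  constructor
  · rintro ⟨y, rfl⟩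
    have : ((hϖ.toIntegers ^ m * y : integers F) : F) = (ϖ : F) ^ m * (y : F) := rfl
    rw [this, norm_mul, norm_pow]
    exact mul_le_of_le_one_right (by positivity) (norm_algebraMap_le y)
  · intro h
    refine ⟨⟨(x : F) / (ϖ : F) ^ m, ?_⟩, ?_⟩
    · rw [mem_integers_iff, norm_div, norm_pow]
      exact div_le_one_of_le₀ h (by positivity)
    · apply Subtype.ext
      change (x : F) = (ϖ : F) ^ m * ((x : F) / (ϖ : F) ^ m)
      rw [mul_div_cancel₀ _ (pow_ne_zero _ ϖ.ne_zero)]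

theorem IsUniformizer.maximalIdeal_eq {ϖ : Fˣ} (hϖ : IsUniformizer ϖ) :
    IsLocalRing.maximalIdeal (integers F) = Ideal.span {hϖ.toIntegers} := by
  ext x
  rw [IsLocalRing.mem_maximalIdeal, mem_nonunits_iff, isUnit_integers_iff,
    Ideal.mem_span_singleton, ← pow_one hϖ.toIntegers, hϖ.toIntegers_pow_dvd_iff, pow_one, ← hϖ]
  exact ⟨fun h => lt_of_le_of_ne (norm_algebraMap_le x) h, fun h => h.ne⟩

theorem IsUniformizer.mem_maximalIdeal_pow_iff {ϖ : Fˣ} (hϖ : IsUniformizer ϖ) (m : ℕ)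
    (x : integers F) :
    x ∈ IsLocalRing.maximalIdeal (integers F) ^ m ↔ ‖(x : F)‖ ≤ ‖(ϖ : F)‖ ^ m := by
  rw [hϖ.maximalIdeal_eq, Ideal.span_singleton_pow, Ideal.mem_span_singleton,
    hϖ.toIntegers_pow_dvd_iff]

theorem residueCard_ne_zero {ϖ : Fˣ} (hnorm : ‖(ϖ : F)‖ = (residueCard F : ℝ)⁻¹) :
    residueCard F ≠ 0 := by
  intro h
  rw [h] at hnorm
  simp at hnorm

theorem one_lt_residueCard {ϖ : Fˣ} (hϖ : IsUniformizer ϖ)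
    (hnorm : ‖(ϖ : F)‖ = (residueCard F : ℝ)⁻¹) : 1 < residueCard F := by
  have h := hϖ.norm_lt_one
  rw [hnorm] at h
  have h0 : 0 < (residueCard F : ℝ) :=
    Nat.cast_pos.2 (Nat.pos_of_ne_zero (residueCard_ne_zero hnorm))
  exact_mod_cast (inv_lt_one₀ h0).1 h

theorem finite_residueRing {ϖ : Fˣ} (hϖ : IsUniformizer ϖ)
    (hnorm : ‖(ϖ : F)‖ = (residueCard F : ℝ)⁻¹) (m : ℕ) :
    Finite (integers F ⧸ IsLocalRing.maximalIdeal (integers F) ^ m) := by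
  have : Finite (integers F ⧸ IsLocalRing.maximalIdeal (integers F)) :=
    Nat.finite_of_card_ne_zero (residueCard_ne_zero hnorm)
  exact Ideal.finite_quotient_pow ⟨{hϖ.toIntegers}, by rw [hϖ.maximalIdeal_eq]; simp⟩ m

theorem norm_sub_out_le {ϖ : Fˣ} (hϖ : IsUniformizer ϖ) (m : ℕ) (y : integers F)
    (x : integers F ⧸ IsLocalRing.maximalIdeal (integers F) ^ m) :
    Ideal.Quotient.mk _ y = x ↔ ‖(y : F) - ((Quotient.out x : integers F) : F)‖ ≤ ‖(ϖ : F)‖ ^ m := by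
  have h1 : Ideal.Quotient.mk (IsLocalRing.maximalIdeal (integers F) ^ m) (Quotient.out x) = x :=
    Quotient.out_eq x
  conv_lhs => rw [← h1]
  rw [Ideal.Quotient.eq, hϖ.mem_maximalIdeal_pow_iff]
  rfl

/-! ### The additive Haar measure -/

section Measure

open Measure

variable [ProperSpace F] [MeasurableSpace F] [BorelSpace F] (lam : Measure F)
  [lam.IsAddHaarMeasure]

theorem measurePreserving_mul_unit {u : F} (hu : ‖u‖ = 1) :
    MeasurePreserving (fun x => u * x) lam lam := by
  have hu0 : u ≠ 0 := norm_ne_zero_iff.1 (by rw [hu]; exact one_ne_zero)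
  refine ⟨measurable_const_mul u, ?_⟩
  have : (lam.map (fun x => u * x)).IsAddHaarMeasure :=
    AddEquiv.isAddHaarMeasure_map lam (AddAut.mulLeft (Units.mk0 u hu0)) (by exact continuous_const_mul u)
      (by exact (Homeomorph.mulLeft₀ u hu0).symm.continuous)
  refine isAddHaarMeasure_eq_of_apply_eq _ _ (Metric.closedBall 0 1) ?_ ?_ ?_
  · exact (Metric.measure_closedBall_pos lam 0 one_pos).ne'
  · exact (isCompact_closedBall (0 : F) 1).measure_ne_top
  · rw [Measure.map_apply (measurable_const_mul u) measurableSet_closedBall]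
    congr 1
    ext x
    simp [hu]

theorem measure_closedBall_uniformizer {ϖ : Fˣ} (hϖ : IsUniformizer ϖ)
    (hnorm : ‖(ϖ : F)‖ = (residueCard F : ℝ)⁻¹) (hlam : lam (Metric.closedBall 0 1) = 1) :
    lam (Metric.closedBall 0 ‖(ϖ : F)‖) = (residueCard F : ℝ≥0∞)⁻¹ := by
  set R := integers F ⧸ IsLocalRing.maximalIdeal (integers F) ^ 1 with hR
  have hfin : Finite R := finite_residueRing hϖ hnorm 1
  have := Fintype.ofFinite R
  have hcard : Fintype.card R = residueCard F := by
    rw [← Nat.card_eq_fintype_card, hR, pow_one]; rfl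
  have hU : Metric.closedBall (0 : F) 1 =
      ⋃ x : R, Metric.closedBall ((Quotient.out x : integers F) : F) ‖(ϖ : F)‖ := by
    ext y
    simp only [Set.mem_iUnion, Metric.mem_closedBall, dist_eq_norm]
    rw [sub_zero]
    constructor
    · intro hy
      refine ⟨Ideal.Quotient.mk _ ⟨y, (mem_integers_iff y).2 hy⟩, ?_⟩
      have := (norm_sub_out_le hϖ 1 ⟨y, (mem_integers_iff y).2 hy⟩
        (Ideal.Quotient.mk _ ⟨y, (mem_integers_iff y).2 hy⟩)).1 rfl
      exact this.trans (pow_one _).le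
    · rintro ⟨x, hx⟩
      rw [← sub_add_cancel y ((Quotient.out x : integers F) : F)]
      refine (IsUltrametricDist.norm_add_le_max _ _).trans (max_le ?_ ((mem_integers_iff _).1 (Quotient.out x).2))
      exact hx.trans hϖ.norm_lt_one.le
  have hdisj : Pairwise (Function.onFun Disjoint fun x : R =>
      Metric.closedBall ((Quotient.out x : integers F) : F) ‖(ϖ : F)‖) := by
    intro x x' hne
    rw [Function.onFun, Set.disjoint_left]
    intro y hy hy'
    have hy1 : ‖y‖ ≤ 1 := by
      rw [← mem_closedBall_zero_iff, hU]
      exact Set.mem_iUnion.2 ⟨x, hy⟩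
    rw [Metric.mem_closedBall, dist_eq_norm, ← pow_one ‖(ϖ : F)‖] at hy hy'
    exact hne (((norm_sub_out_le hϖ 1 ⟨y, (mem_integers_iff y).2 hy1⟩ x).2 hy).symm.trans
      ((norm_sub_out_le hϖ 1 ⟨y, (mem_integers_iff y).2 hy1⟩ x').2 hy'))
  have h1 := measure_iUnion (μ := lam) hdisj fun x => measurableSet_closedBall
  rw [← hU, hlam, tsum_fintype] at h1
  simp only [addHaar_closedBall_center, Finset.sum_const, Finset.card_univ, hcard,
    nsmul_eq_mul] at h1
  have hq : (residueCard F : ℝ≥0∞) ≠ 0 := by exact_mod_cast residueCard_ne_zero hnorm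
  rw [← ENNReal.mul_right_inj hq (ENNReal.natCast_ne_top _), ← h1,
    ENNReal.mul_inv_cancel hq (ENNReal.natCast_ne_top _)]

theorem measure_closedBall_mul {ϖ : Fˣ} (hϖ : IsUniformizer ϖ)
    (hnorm : ‖(ϖ : F)‖ = (residueCard F : ℝ)⁻¹) (hlam : lam (Metric.closedBall 0 1) = 1) (r : ℝ) :
    lam (Metric.closedBall 0 (‖(ϖ : F)‖ * r)) =
      (residueCard F : ℝ≥0∞)⁻¹ * lam (Metric.closedBall 0 r) := by
  have hm : Measurable fun x : F => ((ϖ⁻¹ : Fˣ) : F) * x := measurable_const_mul _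
  have : (lam.map (fun x => ((ϖ⁻¹ : Fˣ) : F) * x)).IsAddHaarMeasure :=
    AddEquiv.isAddHaarMeasure_map lam (AddAut.mulLeft ϖ⁻¹)
      (by exact continuous_const_mul _)
      (by exact continuous_const_mul (((ϖ⁻¹)⁻¹ : Fˣ) : F))
  have h1 := isAddLeftInvariant_eq_smul (lam.map (fun x => ((ϖ⁻¹ : Fˣ) : F) * x)) lam
  set c := addHaarScalarFactor (lam.map (fun x => ((ϖ⁻¹ : Fˣ) : F) * x)) lam
  have h2 : ∀ r : ℝ, lam (Metric.closedBall 0 (‖(ϖ : F)‖ * r)) =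
      c * lam (Metric.closedBall 0 r) := by
    intro r
    have := congrArg (fun μ : Measure F => μ (Metric.closedBall 0 r)) h1
    simp only [Measure.smul_apply, ENNReal.smul_def, smul_eq_mul] at this
    rw [← this, Measure.map_apply hm measurableSet_closedBall]
    congr 1
    ext x
    simp only [mem_closedBall_zero_iff, Set.mem_preimage, norm_mul, Units.val_inv_eq_inv_val,
      norm_inv]
    rw [inv_mul_le_iff₀ (norm_unit_pos ϖ)]
  have h3 := h2 1
  rw [mul_one, measure_closedBall_uniformizer lam hϖ hnorm hlam, hlam, mul_one] at h3
  rw [h2, h3]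

theorem measure_closedBall_pow {ϖ : Fˣ} (hϖ : IsUniformizer ϖ)
    (hnorm : ‖(ϖ : F)‖ = (residueCard F : ℝ)⁻¹) (hlam : lam (Metric.closedBall 0 1) = 1) (m : ℕ) :
    lam (Metric.closedBall 0 (‖(ϖ : F)‖ ^ m)) = ((residueCard F : ℝ≥0∞) ^ m)⁻¹ := by
  induction m with
  | zero => simp [hlam]
  | succ m ih =>
    rw [pow_succ', measure_closedBall_mul lam hϖ hnorm hlam, ih, pow_succ', ENNReal.mul_inv]
    · right; exact ENNReal.pow_ne_top (ENNReal.natCast_ne_top _)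
    · left; exact ENNReal.natCast_ne_top _

theorem measure_closedBall_inv_pow {ϖ : Fˣ} (hϖ : IsUniformizer ϖ)
    (hnorm : ‖(ϖ : F)‖ = (residueCard F : ℝ)⁻¹) (hlam : lam (Metric.closedBall 0 1) = 1) (m : ℕ) :
    lam (Metric.closedBall 0 (‖(ϖ : F)‖ ^ m)⁻¹) = (residueCard F : ℝ≥0∞) ^ m := by
  have hq : (residueCard F : ℝ≥0∞) ≠ 0 := by exact_mod_cast residueCard_ne_zero hnorm
  induction m with
  | zero => simp [hlam]
  | succ m ih =>
    have h1 := measure_closedBall_mul lam hϖ hnorm hlam (‖(ϖ : F)‖ ^ (m + 1))⁻¹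
    have h2 : ‖(ϖ : F)‖ * (‖(ϖ : F)‖ ^ (m + 1))⁻¹ = (‖(ϖ : F)‖ ^ m)⁻¹ := by
      have := (norm_unit_pos ϖ).ne'
      field_simp
      ring
    rw [h2, ih] at h1
    rw [pow_succ' (residueCard F : ℝ≥0∞), h1, ← mul_assoc, ENNReal.mul_inv_cancel hq (ENNReal.natCast_ne_top _), one_mul]

theorem measure_sphere {ϖ : Fˣ} (hϖ : IsUniformizer ϖ)
    (hnorm : ‖(ϖ : F)‖ = (residueCard F : ℝ)⁻¹) (hlam : lam (Metric.closedBall 0 1) = 1) :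
    lam (Metric.sphere 0 1) = 1 - (residueCard F : ℝ≥0∞)⁻¹ := by
  have h : Metric.sphere (0 : F) 1 = Metric.closedBall 0 1 \ Metric.closedBall 0 ‖(ϖ : F)‖ := by
    ext x
    simp only [mem_sphere_zero_iff_norm, Set.mem_sdiff, mem_closedBall_zero_iff]
    rw [← hϖ x, not_lt]
    exact le_antisymm_iff
  rw [h, measure_sdiff (Metric.closedBall_subset_closedBall hϖ.norm_lt_one.le)
    measurableSet_closedBall.nullMeasurableSet (isCompact_closedBall (0 : F) _).measure_ne_top,
    hlam, measure_closedBall_uniformizer lam hϖ hnorm hlam]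

/-! ### Local Gauss integrals -/

/-- The integral of `χ(r) ψ(y r)` over the units `r` of the valuation ring. -/
noncomputable def unitIntegral (ψ : AddChar F ℂ) (χ : Fˣ →ₜ* ℂˣ) (y : F) : ℂ :=
  ∫ r in Metric.sphere 0 1, charVal χ r * ψ (y * r) ∂lam

theorem unitIntegral_mul_unit (ψ : AddChar F ℂ) (χ : Fˣ →ₜ* ℂˣ) (y : F) (u : Fˣ)
    (hu : ‖(u : F)‖ = 1) :
    (χ u : ℂ) * unitIntegral lam ψ χ (y * u) = unitIntegral lam ψ χ y := by
  have h1 := (measurePreserving_mul_unit lam hu).setIntegral_preimage_emb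
    (Homeomorph.mulLeft₀ (u : F) u.ne_zero).measurableEmbedding
    (fun r => charVal χ r * ψ (y * r)) (Metric.sphere 0 1)
  have h2 : (fun x => (u : F) * x) ⁻¹' Metric.sphere 0 1 = Metric.sphere 0 1 := by
    ext x; simp [hu]
  rw [h2] at h1
  rw [unitIntegral, unitIntegral, ← h1, ← integral_const_mul]
  congr 1
  ext r
  rw [charVal_mul, charVal_coe, mul_assoc, mul_assoc]

theorem unitIntegral_add {ψ : AddChar F ℂ} (hψ : HasConductorIntegers ψ) (χ : Fˣ →ₜ* ℂˣ)
    (y z : F) (hz : ‖z‖ ≤ 1) : unitIntegral lam ψ χ (y + z) = unitIntegral lam ψ χ y := by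
  refine setIntegral_congr_fun (Metric.isClosed_sphere.measurableSet) fun r hr => ?_
  have hr' : ‖r‖ = 1 := by simpa using hr
  simp only [add_mul, AddChar.map_add_eq_mul]
  rw [(hψ z).2 hz r hr'.le, mul_one]

theorem continuous_unitIntegral {ψ : AddChar F ℂ} (hψ : HasConductorIntegers ψ) (χ : Fˣ →ₜ* ℂˣ) :
    Continuous (unitIntegral lam ψ χ) := by
  rw [continuous_iff_continuousAt]
  intro x
  refine continuousAt_const.congr (f := fun _ => unitIntegral lam ψ χ x) ?_
  filter_upwards [Metric.closedBall_mem_nhds x one_pos] with y hy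
  have h1 : ‖y - x‖ ≤ 1 := by rwa [Metric.mem_closedBall, dist_eq_norm] at hy
  rw [show y = x + (y - x) by ring, unitIntegral_add lam hψ χ _ _ h1]

theorem unitIntegral_eq_zero_of_lt {ψ : AddChar F ℂ} (hψ : HasConductorIntegers ψ) {ϖ : Fˣ}
    {χ : Fˣ →ₜ* ℂˣ} (he : 1 ≤ conductorExp ϖ χ) {y : F}
    (hy : ‖y‖ * ‖(ϖ : F)‖ ^ (conductorExp ϖ χ - 1) ≤ 1) : unitIntegral lam ψ χ y = 0 := by
  obtain ⟨u, hu1, hu2, hu3⟩ := exists_ne_one_of_conductorExp he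
  have h1 := unitIntegral_mul_unit lam ψ χ y u hu1
  have h2 : ‖y * ((u : F) - 1)‖ ≤ 1 := by
    rw [norm_mul]
    exact (mul_le_mul_of_nonneg_left hu2 (norm_nonneg _)).trans hy
  rw [show y * (u : F) = y + y * ((u : F) - 1) by ring, unitIntegral_add lam hψ χ _ _ h2] at h1
  have h3 : ((χ u : ℂ) - 1) * unitIntegral lam ψ χ y = 0 := by rw [sub_mul, h1]; ring
  refine (mul_eq_zero.1 h3).resolve_left (sub_ne_zero.2 fun h => hu3 (Units.ext h))

theorem unitIntegral_eq_zero_of_gt {ψ : AddChar F ℂ} (hψ : HasConductorIntegers ψ) {ϖ : Fˣ}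
    (hϖ : IsUniformizer ϖ) {χ : Fˣ →ₜ* ℂˣ} (he : 1 ≤ conductorExp ϖ χ) {y : F}
    (hy : 1 < ‖y‖ * ‖(ϖ : F)‖ ^ conductorExp ϖ χ) : unitIntegral lam ψ χ y = 0 := by
  have h0 : ¬ ‖y * (ϖ : F) ^ conductorExp ϖ χ‖ ≤ 1 := by
    rw [norm_mul, norm_pow]; exact not_le.2 hy
  rw [← hψ] at h0
  push Not at h0
  obtain ⟨z', hz', hz2⟩ := h0
  set z := (ϖ : F) ^ conductorExp ϖ χ * z' with hz
  have hzn : ‖z‖ ≤ ‖(ϖ : F)‖ ^ conductorExp ϖ χ := by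
    rw [hz, norm_mul, norm_pow]
    exact mul_le_of_le_one_right (by positivity) hz'
  have hz1 : ‖z‖ < 1 := hzn.trans_lt (pow_lt_one₀ (norm_nonneg _) hϖ.norm_lt_one (by omega))
  have h1 := (measurePreserving_add_right lam z).setIntegral_preimage_emb
    (Homeomorph.addRight z).measurableEmbedding
    (fun r => charVal χ r * ψ (y * r)) (Metric.sphere 0 1)
  have h2 : (fun x => x + z) ⁻¹' Metric.sphere 0 1 = Metric.sphere 0 1 := by
    ext x
    simp only [Set.mem_preimage, mem_sphere_zero_iff_norm]
    constructor
    · intro h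
      have h3 : ‖x‖ = max ‖x + z‖ ‖-z‖ := by
        rw [← IsUltrametricDist.norm_add_eq_max_of_norm_ne_norm
          (by rw [h, norm_neg]; exact hz1.ne'), add_neg_cancel_right]
      rw [h3, h, norm_neg, max_eq_left hz1.le]
    · intro h
      rw [IsUltrametricDist.norm_add_eq_max_of_norm_ne_norm (by rw [h]; exact hz1.ne'), h,
        max_eq_left hz1.le]
  rw [h2] at h1
  have h4 : ψ (y * z) * unitIntegral lam ψ χ y = unitIntegral lam ψ χ y := by
    conv_rhs => rw [unitIntegral, ← h1]
    rw [unitIntegral, ← integral_const_mul]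
    refine setIntegral_congr_fun (Metric.isClosed_sphere.measurableSet) fun r hr => ?_
    have hr' : ‖r‖ = 1 := by simpa using hr
    change _ = charVal χ (r + z) * ψ (y * (r + z))
    rw [charVal_add_of_conductorExp hϖ he hr' hzn, mul_add, AddChar.map_add_eq_mul]
    ring
  have h5 : (ψ (y * z) - 1) * unitIntegral lam ψ χ y = 0 := by rw [sub_mul, h4]; ring
  refine (mul_eq_zero.1 h5).resolve_left (sub_ne_zero.2 fun h => hz2 ?_)
  rw [← h, hz, mul_assoc]

theorem norm_eq_of_unitIntegral_ne_zero {ψ : AddChar F ℂ} (hψ : HasConductorIntegers ψ) {ϖ : Fˣ}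
    (hϖ : IsUniformizer ϖ) {χ : Fˣ →ₜ* ℂˣ} (he : 1 ≤ conductorExp ϖ χ) {y : F}
    (hy : unitIntegral lam ψ χ y ≠ 0) : ‖y‖ = ‖(ϖ : F)‖ ^ (-(conductorExp ϖ χ : ℤ)) := by
  have h0 := norm_unit_pos ϖ
  have h1 : 1 < ‖y‖ * ‖(ϖ : F)‖ ^ (conductorExp ϖ χ - 1) := by
    by_contra h
    exact hy (unitIntegral_eq_zero_of_lt lam hψ he (not_lt.1 h))
  have h2 : ‖y‖ * ‖(ϖ : F)‖ ^ conductorExp ϖ χ ≤ 1 := by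
    by_contra h
    exact hy (unitIntegral_eq_zero_of_gt lam hψ hϖ he (not_le.1 h))
  have hy0 : y ≠ 0 := by
    rintro rfl
    simp at h1
    linarith
  obtain ⟨m, hm⟩ := hϖ.exists_norm_eq hy0
  rw [hm] at h1 h2 ⊢
  rw [← zpow_natCast, ← zpow_add₀ h0.ne', ← zpow_zero ‖(ϖ : F)‖] at h1 h2
  have h3 := mt hϖ.zpow_le_zpow_iff.2 (not_le.2 h1)
  have h4 := hϖ.zpow_le_zpow_iff.1 h2
  congr 1
  omega

theorem gaussSum_eq_unitIntegral {ψ : AddChar F ℂ} (hψ : HasConductorIntegers ψ) {ϖ : Fˣ}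
    (hϖ : IsUniformizer ϖ) (hnorm : ‖(ϖ : F)‖ = (residueCard F : ℝ)⁻¹)
    (hlam : lam (Metric.closedBall 0 1) = 1) {χ : Fˣ →ₜ* ℂˣ} (he : 1 ≤ conductorExp ϖ χ) :
    (χ (ϖ ^ conductorExp ϖ χ) : ℂ) * LocalBirch.gaussSum ϖ ψ χ =
      (residueCard F : ℂ) ^ conductorExp ϖ χ *
        unitIntegral lam ψ χ (((ϖ : F) ^ conductorExp ϖ χ)⁻¹) := by
  set e := conductorExp ϖ χ with hedef
  set R := integers F ⧸ IsLocalRing.maximalIdeal (integers F) ^ e with hR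
  have hfin : Finite R := finite_residueRing hϖ hnorm e
  have := Fintype.ofFinite Rˣ
  have hpe : ‖(ϖ : F)‖ ^ e < 1 := pow_lt_one₀ (norm_nonneg _) hϖ.norm_lt_one (by omega)
  have hout : ∀ x : Rˣ, ‖((Quotient.out x.val : integers F) : F)‖ = 1 := by
    intro x
    rw [← isUnit_integers_iff]
    by_contra h
    have h1 : (Quotient.out x.val : integers F) ∈ IsLocalRing.maximalIdeal (integers F) := h
    have h2 : Ideal.Quotient.mk (IsLocalRing.maximalIdeal (integers F) ^ e)
      (Quotient.out x.val) = x.val := Quotient.out_eq x.val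
    obtain ⟨z, hz⟩ := Ideal.Quotient.mk_surjective ((x⁻¹ : Rˣ) : R)
    have h3 : Ideal.Quotient.mk (IsLocalRing.maximalIdeal (integers F) ^ e)
        (Quotient.out x.val * z) = Ideal.Quotient.mk _ 1 := by
      rw [map_mul, h2, hz, Units.mul_inv, map_one]
    rw [Ideal.Quotient.eq] at h3
    have h4 := Ideal.pow_le_self (by omega : e ≠ 0) h3
    have h5 : (1 : integers F) ∈ IsLocalRing.maximalIdeal (integers F) := by
      simpa using Ideal.sub_mem _ (Ideal.mul_mem_right z _ h1) h4
    exact (Ideal.ne_top_iff_one _).1 (IsLocalRing.maximalIdeal.isMaximal _).ne_top h5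
  have hU : Metric.sphere (0 : F) 1 =
      ⋃ x : Rˣ, Metric.closedBall ((Quotient.out x.val : integers F) : F) (‖(ϖ : F)‖ ^ e) := by
    ext y
    simp only [mem_sphere_zero_iff_norm, Set.mem_iUnion, Metric.mem_closedBall, dist_eq_norm]
    constructor
    · intro hy
      have hu : IsUnit (⟨y, (mem_integers_iff y).2 hy.le⟩ : integers F) :=
        (isUnit_integers_iff _).2 hy
      refine ⟨Units.map (Ideal.Quotient.mk
        (IsLocalRing.maximalIdeal (integers F) ^ e)).toMonoidHom hu.unit, ?_⟩
      exact (norm_sub_out_le hϖ e ⟨y, (mem_integers_iff y).2 hy.le⟩ _).1 rfl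
    · rintro ⟨x, hx⟩
      rw [← sub_add_cancel y ((Quotient.out x.val : integers F) : F),
        IsUltrametricDist.norm_add_eq_max_of_norm_ne_norm, hout x,
        max_eq_right (hx.trans hpe.le)]
      rw [hout x]
      exact (hx.trans_lt hpe).ne
  have hdisj : Pairwise (Function.onFun Disjoint fun x : Rˣ =>
      Metric.closedBall ((Quotient.out x.val : integers F) : F) (‖(ϖ : F)‖ ^ e)) := by
    intro x x' hne
    rw [Function.onFun, Set.disjoint_left]
    intro y hy hy'
    have hy1 : ‖y‖ = 1 := by
      rw [← mem_sphere_zero_iff_norm, hU]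
      exact Set.mem_iUnion.2 ⟨x, hy⟩
    rw [Metric.mem_closedBall, dist_eq_norm] at hy hy'
    exact hne (Units.ext (((norm_sub_out_le hϖ e ⟨y, (mem_integers_iff y).2 hy1.le⟩ x.val).2
      hy).symm.trans ((norm_sub_out_le hϖ e ⟨y, (mem_integers_iff y).2 hy1.le⟩ x'.val).2 hy')))
  have hconst : ∀ x : Rˣ, Set.EqOn (fun r => charVal χ r * ψ (((ϖ : F) ^ e)⁻¹ * r))
      (fun _ => charVal χ ((Quotient.out x.val : integers F) : F) *
        ψ (((ϖ : F) ^ e)⁻¹ * ((Quotient.out x.val : integers F) : F)))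
      (Metric.closedBall ((Quotient.out x.val : integers F) : F) (‖(ϖ : F)‖ ^ e)) := by
    intro x r hr
    rw [Metric.mem_closedBall, dist_eq_norm] at hr
    simp only
    rw [← add_sub_cancel ((Quotient.out x.val : integers F) : F) r,
      charVal_add_of_conductorExp hϖ he (hout x) hr, mul_add, AddChar.map_add_eq_mul]
    have h6 : ‖((ϖ : F) ^ e)⁻¹ * (r - ((Quotient.out x.val : integers F) : F))‖ ≤ 1 := by
      rw [norm_mul, norm_inv, norm_pow, inv_mul_le_iff₀ (pow_pos (norm_unit_pos ϖ) _), mul_one]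
      exact hr
    have h7 := (hψ _).2 h6 1 (by simp)
    rw [mul_one] at h7
    rw [h7, mul_one]
  have hmeas : ∀ x : F, lam.real (Metric.closedBall x (‖(ϖ : F)‖ ^ e)) =
      ((residueCard F : ℝ) ^ e)⁻¹ := by
    intro x
    rw [measureReal_def, addHaar_closedBall_center, measure_closedBall_pow lam hϖ hnorm hlam]
    simp
  have hint : unitIntegral lam ψ χ (((ϖ : F) ^ e)⁻¹) = ((residueCard F : ℂ) ^ e)⁻¹ *
      ∑ x : Rˣ, charVal χ ((Quotient.out x.val : integers F) : F) *
        ψ (((ϖ : F) ^ e)⁻¹ * ((Quotient.out x.val : integers F) : F)) := by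
    rw [unitIntegral, hU, integral_iUnion_fintype (fun x => measurableSet_closedBall) hdisj]
    · rw [Finset.mul_sum]
      refine Finset.sum_congr rfl fun x _ => ?_
      rw [setIntegral_congr_fun measurableSet_closedBall (hconst x), setIntegral_const, hmeas]
      simp
    · intro x
      refine IntegrableOn.congr_fun ?_ (hconst x).symm measurableSet_closedBall
      exact integrableOn_const (isCompact_closedBall _ _).measure_ne_top
  have hq : (residueCard F : ℂ) ^ e ≠ 0 :=
    pow_ne_zero _ (Nat.cast_ne_zero.2 (residueCard_ne_zero hnorm))
  rw [hint, mul_inv_cancel_left₀ hq, LocalBirch.gaussSum, finsum_eq_sum_of_fintype, Finset.mul_sum]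
  refine Finset.sum_congr rfl fun x _ => ?_
  rw [← mul_assoc, ← charVal_coe, ← charVal_mul, Units.val_pow_eq_pow_val,
    mul_div_cancel₀ _ (pow_ne_zero _ ϖ.ne_zero), div_eq_inv_mul]

end Measure

end Gauss

end LocalBirch

namespace LocalBirch

section Primitive

variable {F : Type*} [NontriviallyNormedField F] [IsUltrametricDist F]

/-! ### Rows of matrices in the maximal compact subgroup -/

theorem exists_last_row {n : ℕ} (y : Fin (n + 1) → F) (hy : ∀ i, ‖y i‖ ≤ 1) {i₀ : Fin (n + 1)}
    (hi₀ : ‖y i₀‖ = 1) : ∃ k ∈ maximalCompact F (n + 1),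
      ∀ j, (k : Matrix (Fin (n + 1)) (Fin (n + 1)) F) (Fin.last n) j = y j := by
  set σ : Equiv.Perm (Fin (n + 1)) := Equiv.swap i₀ (Fin.last n) with hσ
  set M : Matrix (Fin (n + 1)) (Fin (n + 1)) F :=
    Matrix.updateRow 1 (Fin.last n) (fun j => y (σ j)) with hM
  have hMdet : M.det = y i₀ := by
    have hlow : M.IsLowerTriangular := by
      intro i j hij
      have h1 : i < j := hij
      have h2 : i ≠ Fin.last n := (h1.trans_le (Fin.le_last j)).ne
      rw [hM, Matrix.updateRow_ne h2, Matrix.one_apply_ne h1.ne]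
    rw [Matrix.det_of_isLowerTriangular _ hlow, Fin.prod_univ_castSucc]
    have h3 : ∀ i : Fin n, M i.castSucc i.castSucc = 1 := fun i => by
      rw [hM, Matrix.updateRow_ne (Fin.castSucc_ne_last i), Matrix.one_apply_eq]
    have h4 : M (Fin.last n) (Fin.last n) = y i₀ := by
      rw [hM, Matrix.updateRow_self, hσ, Equiv.swap_apply_right]
    simp [h3, h4]
  set A : Matrix (Fin (n + 1)) (Fin (n + 1)) F := M.submatrix id σ with hA
  have hAdet : ‖A.det‖ = 1 := by
    rw [hA, Matrix.det_permute', norm_mul, hMdet, hi₀, mul_one]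
    rcases Int.units_eq_one_or (Equiv.Perm.sign σ) with h | h <;> simp [h]
  have hAdet0 : A.det ≠ 0 := norm_ne_zero_iff.1 (by rw [hAdet]; exact one_ne_zero)
  refine ⟨Matrix.GeneralLinearGroup.mkOfDetNeZero A hAdet0, ?_, ?_⟩
  · rw [mem_maximalCompact_iff]
    refine ⟨fun i j => ?_, hAdet⟩
    change ‖M i (σ j)‖ ≤ 1
    by_cases h : i = Fin.last n
    · rw [h, hM, Matrix.updateRow_self]
      exact hy _
    · rw [hM, Matrix.updateRow_ne h, Matrix.one_apply]
      split_ifs <;> simp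
  · intro j
    change M (Fin.last n) (σ j) = y j
    rw [hM, Matrix.updateRow_self, hσ, Equiv.swap_apply_self]

theorem exists_norm_last_row_eq_one {n : ℕ} {k : GL (Fin (n + 1)) F}
    (hk : k ∈ maximalCompact F (n + 1)) :
    ∃ i, ‖(k : Matrix (Fin (n + 1)) (Fin (n + 1)) F) (Fin.last n) i‖ = 1 := by
  have h1 : ((k * k⁻¹ : GL (Fin (n + 1)) F) : Matrix (Fin (n + 1)) (Fin (n + 1)) F)
      (Fin.last n) (Fin.last n) = 1 := by simp
  rw [Units.val_mul, Matrix.mul_apply] at h1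
  obtain ⟨i, -, hi⟩ := IsUltrametricDist.exists_norm_finsetSum_le_of_nonempty
    (Finset.univ_nonempty (α := Fin (n + 1))) (fun i =>
      (k : Matrix (Fin (n + 1)) (Fin (n + 1)) F) (Fin.last n) i *
      ((k⁻¹ : GL (Fin (n + 1)) F) : Matrix (Fin (n + 1)) (Fin (n + 1)) F) i (Fin.last n))
  rw [h1, norm_one, norm_mul] at hi
  refine ⟨i, le_antisymm (norm_entry_le_one hk _ _) (hi.trans ?_)⟩
  exact mul_le_of_le_one_right (norm_nonneg _) (norm_entry_le_one (inv_mem hk) _ _)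

theorem norm_vecMul_le_one {n : ℕ} {k : GL (Fin n) F} (hk : k ∈ maximalCompact F n)
    {y : Fin n → F} (hy : ‖y‖ ≤ 1) :
    ‖Matrix.vecMul y (k : Matrix (Fin n) (Fin n) F)‖ ≤ 1 := by
  rw [pi_norm_le_iff_of_nonneg zero_le_one]
  intro j
  change ‖∑ i, y i * (k : Matrix (Fin n) (Fin n) F) i j‖ ≤ 1
  refine IsUltrametricDist.norm_sum_le_of_forall_le_of_nonneg zero_le_one fun i _ => ?_
  rw [norm_mul]
  exact mul_le_one₀ ((norm_le_pi_norm y i).trans hy) (norm_nonneg _) (norm_entry_le_one hk _ _)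

theorem norm_vecMul_le_one_iff {n : ℕ} {k : GL (Fin n) F} (hk : k ∈ maximalCompact F n)
    {y : Fin n → F} : ‖Matrix.vecMul y (k : Matrix (Fin n) (Fin n) F)‖ ≤ 1 ↔ ‖y‖ ≤ 1 := by
  refine ⟨fun h => ?_, norm_vecMul_le_one hk⟩
  have := norm_vecMul_le_one (inv_mem hk) h
  rwa [Matrix.vecMul_vecMul, ← Units.val_mul, mul_inv_cancel, Units.val_one,
    Matrix.vecMul_one] at this

/-- The matrices in the maximal compact subgroup all of whose entries in the last row are
units. -/
def unitRow (F : Type*) [NontriviallyNormedField F] [IsUltrametricDist F] (n : ℕ) :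
    Set (GL (Fin (n + 1)) F) :=
  {k | k ∈ maximalCompact F (n + 1) ∧
    ∀ i, ‖(k : Matrix (Fin (n + 1)) (Fin (n + 1)) F) (Fin.last n) i‖ = 1}

theorem isOpen_unitRow (n : ℕ) : IsOpen (unitRow F n) := by
  have : unitRow F n = (maximalCompact F (n + 1) : Set (GL (Fin (n + 1)) F)) ∩
      ⋂ i, (fun g : GL (Fin (n + 1)) F => (g : Matrix (Fin (n + 1)) (Fin (n + 1)) F)
        (Fin.last n) i) ⁻¹' Metric.sphere 0 1 := by
    ext g; simp [unitRow]
  rw [this]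
  exact (isOpen_maximalCompact _).inter (isOpen_iInter_of_finite fun i =>
    (IsUltrametricDist.isOpen_sphere 0 one_ne_zero).preimage (continuous_entry _ i))

section Measure

open Measure

variable [ProperSpace F] [MeasurableSpace F] [BorelSpace F] (lam : Measure F)
  [lam.IsAddHaarMeasure]

theorem map_vecMul_maximalCompact {n : ℕ} {k : GL (Fin n) F} (hk : k ∈ maximalCompact F n) :
    MeasurePreserving (fun y : Fin n → F => Matrix.vecMul y (k : Matrix (Fin n) (Fin n) F))
      (Measure.pi fun _ => lam) (Measure.pi fun _ => lam) := by
  have hc : ∀ k : GL (Fin n) F, Continuous fun y : Fin n → F =>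
      Matrix.vecMul y (k : Matrix (Fin n) (Fin n) F) := fun k =>
    continuous_id.matrix_vecMul continuous_const
  refine ⟨(hc k).measurable, ?_⟩
  let φ : (Fin n → F) ≃+ (Fin n → F) :=
    { toFun := fun y => Matrix.vecMul y (k : Matrix (Fin n) (Fin n) F)
      invFun := fun y => Matrix.vecMul y ((k⁻¹ : GL (Fin n) F) : Matrix (Fin n) (Fin n) F)
      left_inv := fun y => by
        beta_reduce
        rw [Matrix.vecMul_vecMul, ← Units.val_mul, mul_inv_cancel, Units.val_one,
          Matrix.vecMul_one]
      right_inv := fun y => by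
        beta_reduce
        rw [Matrix.vecMul_vecMul, ← Units.val_mul, inv_mul_cancel, Units.val_one,
          Matrix.vecMul_one]
      map_add' := fun x y => Matrix.add_vecMul _ _ _ }
  have : (map (fun y : Fin n → F => Matrix.vecMul y (k : Matrix (Fin n) (Fin n) F))
      (Measure.pi fun _ => lam)).IsAddHaarMeasure :=
    AddEquiv.isAddHaarMeasure_map _ φ (hc k) (hc k⁻¹)
  refine isAddHaarMeasure_eq_of_apply_eq _ _ (Metric.closedBall 0 1) ?_ ?_ ?_
  · exact (Metric.measure_closedBall_pos _ 0 one_pos).ne'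
  · exact (isCompact_closedBall (0 : Fin n → F) 1).measure_ne_top
  · rw [Measure.map_apply (hc k).measurable measurableSet_closedBall]
    congr 1
    ext y
    simp only [Set.mem_preimage, mem_closedBall_zero_iff, norm_vecMul_le_one_iff hk]

/-- The volume of the set of matrices all of whose entries in the last row are units. -/
theorem measure_unitRow {ϖ : Fˣ} (hϖ : IsUniformizer ϖ)
    (hnorm : ‖(ϖ : F)‖ = (residueCard F : ℝ)⁻¹) (hlam : lam (Metric.closedBall 0 1) = 1)
    {n : ℕ} (ν : Measure (GL (Fin (n + 1)) F)) [ν.IsHaarMeasure]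
    (hν : ν (maximalCompact F (n + 1)) = 1) :
    ν (unitRow F n) * (1 - (residueCard F : ℝ≥0∞)⁻¹ ^ (n + 1)) =
      lam (Metric.sphere 0 1) ^ (n + 1) := by
  set m : Measure (Fin (n + 1) → F) := Measure.pi fun _ => lam with hm
  set K : Set (GL (Fin (n + 1)) F) := ↑(maximalCompact F (n + 1)) with hK
  have hKm : MeasurableSet K := (isOpen_maximalCompact _).measurableSet
  set P : Set (Fin (n + 1) → F) := Metric.closedBall 0 1 \ Metric.closedBall 0 ‖(ϖ : F)‖ with hP
  have hPm : MeasurableSet P := measurableSet_closedBall.diff measurableSet_closedBall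
  have hball : ∀ r : ℝ, 0 ≤ r → m (Metric.closedBall 0 r) =
      lam (Metric.closedBall 0 r) ^ (n + 1) := by
    intro r hr
    rw [closedBall_pi _ hr, hm, Measure.pi_pi]
    simp
  have hPmeas : m P = 1 - (residueCard F : ℝ≥0∞)⁻¹ ^ (n + 1) := by
    rw [hP, measure_sdiff (Metric.closedBall_subset_closedBall hϖ.norm_lt_one.le)
      measurableSet_closedBall.nullMeasurableSet
      (isCompact_closedBall (0 : Fin (n + 1) → F) _).measure_ne_top,
      hball _ zero_le_one, hball _ (norm_nonneg _), hlam,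
      measure_closedBall_uniformizer lam hϖ hnorm hlam, one_pow]
  set S : Set (Fin (n + 1) → F) := Set.pi Set.univ fun _ => Metric.sphere 0 1 with hS
  have hSopen : IsOpen S := isOpen_set_pi Set.finite_univ fun _ _ =>
    IsUltrametricDist.isOpen_sphere 0 one_ne_zero
  have hSmem : ∀ y, y ∈ S ↔ ∀ i, ‖y i‖ = 1 := fun y => by simp [hS, Set.mem_pi]
  have hmemP : ∀ y, y ∈ P ↔ (∀ i, ‖y i‖ ≤ 1) ∧ ∃ i, ‖y i‖ = 1 := by
    intro y
    rw [hP, Set.mem_sdiff, mem_closedBall_zero_iff, mem_closedBall_zero_iff,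
      pi_norm_le_iff_of_nonneg zero_le_one, pi_norm_le_iff_of_nonneg (norm_nonneg _)]
    refine and_congr_right fun h => ?_
    push Not
    refine exists_congr fun i => ?_
    rw [← not_le, ← hϖ, not_lt]
    exact ⟨fun h' => le_antisymm (h i) h', fun h' => h'.ge⟩
  have hSm : m S = lam (Metric.sphere 0 1) ^ (n + 1) := by
    rw [hS, hm, Measure.pi_pi]; simp
  set T : Set (GL (Fin (n + 1)) F × (Fin (n + 1) → F)) :=
    {p | Matrix.vecMul p.2 (p.1 : Matrix (Fin (n + 1)) (Fin (n + 1)) F) ∈ S} with hT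
  have hTm : MeasurableSet T := by
    have hc : Continuous fun p : GL (Fin (n + 1)) F × (Fin (n + 1) → F) =>
        Matrix.vecMul p.2 (p.1 : Matrix (Fin (n + 1)) (Fin (n + 1)) F) :=
      continuous_snd.matrix_vecMul (Units.continuous_val.comp continuous_fst)
    exact (hSopen.preimage hc).measurableSet
  have h1 : ((ν.restrict K).prod (m.restrict P)) T = lam (Metric.sphere 0 1) ^ (n + 1) := by
    rw [Measure.prod_apply hTm]
    have : ∀ k ∈ K, (m.restrict P) (Prod.mk k ⁻¹' T) = lam (Metric.sphere 0 1) ^ (n + 1) := by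
      intro k hk
      rw [Measure.restrict_apply (measurable_prodMk_left hTm), ← hSm,
        ← (map_vecMul_maximalCompact lam hk).measure_preimage hSopen.measurableSet.nullMeasurableSet]
      congr 1
      refine Set.inter_eq_left.2 fun y hy => ?_
      have hy1 : Matrix.vecMul y (k : Matrix (Fin (n + 1)) (Fin (n + 1)) F) ∈ S := hy
      rw [hP, Set.mem_sdiff, mem_closedBall_zero_iff, mem_closedBall_zero_iff,
        ← norm_vecMul_le_one_iff hk]
      rw [hSmem] at hy1
      refine ⟨(pi_norm_le_iff_of_nonneg zero_le_one).2 fun i => (hy1 i).le, fun h => ?_⟩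
      have h2 : ‖Matrix.vecMul y (k : Matrix (Fin (n + 1)) (Fin (n + 1)) F) 0‖ ≤ ‖(ϖ : F)‖ := by
        change ‖∑ i, y i * (k : Matrix (Fin (n + 1)) (Fin (n + 1)) F) i 0‖ ≤ _
        refine IsUltrametricDist.norm_sum_le_of_forall_le_of_nonneg (norm_nonneg _) fun i _ => ?_
        rw [norm_mul]
        exact (mul_le_of_le_one_right (norm_nonneg _) (norm_entry_le_one hk _ _)).trans
          ((norm_le_pi_norm y i).trans h)
      rw [hy1 0] at h2
      exact absurd hϖ.norm_lt_one (not_lt.2 h2)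
    rw [setLIntegral_congr_fun hKm this, setLIntegral_const, hν, mul_one]
  have h2 : ((ν.restrict K).prod (m.restrict P)) T = ν (unitRow F n) * m P := by
    rw [Measure.prod_apply_symm hTm]
    have : ∀ y ∈ P, (ν.restrict K) ((fun k => (k, y)) ⁻¹' T) = ν (unitRow F n) := by
      intro y hy
      rw [hmemP] at hy
      obtain ⟨hy1, i₀, hi₀⟩ := hy
      obtain ⟨k₀, hk₀, hk₀y⟩ := exists_last_row y hy1 hi₀
      rw [Measure.restrict_apply (measurable_prodMk_right hTm),
        ← measure_preimage_mul ν k₀ (unitRow F n)]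
      congr 1
      ext k
      have h3 : Matrix.vecMul y (k : Matrix (Fin (n + 1)) (Fin (n + 1)) F) =
          ((k₀ * k : GL (Fin (n + 1)) F) : Matrix (Fin (n + 1)) (Fin (n + 1)) F) (Fin.last n) := by
        ext j
        rw [Units.val_mul, Matrix.mul_apply]
        simp only [Matrix.vecMul, dotProduct, hk₀y]
      have h4 : k₀ * k ∈ maximalCompact F (n + 1) ↔ k ∈ K :=
        (maximalCompact F (n + 1)).mul_mem_cancel_left hk₀
      simp only [Set.mem_inter_iff, Set.mem_preimage, hT, Set.mem_ofPred_eq, unitRow, h3, hSmem, h4]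
      exact and_comm
    rw [setLIntegral_congr_fun hPm this, setLIntegral_const]
  rw [← hPmeas, ← h2, h1]

/-- Fubini's theorem for continuous functions on compact sets. -/
theorem setIntegral_swap_of_continuousOn {X Y : Type*} [TopologicalSpace X] [TopologicalSpace Y]
    [T2Space X] [T2Space Y]
    [SecondCountableTopology X] [SecondCountableTopology Y] [MeasurableSpace X]
    [MeasurableSpace Y] [BorelSpace X] [BorelSpace Y] (μ : Measure X) (ν : Measure Y) [SFinite μ]
    [SFinite ν] [IsFiniteMeasureOnCompacts μ] [IsFiniteMeasureOnCompacts ν] {s : Set X} {t : Set Y}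
    (hs : IsCompact s) (ht : IsCompact t) {f : X → Y → ℂ}
    (hf : ContinuousOn (Function.uncurry f) (s ×ˢ t)) :
    ∫ x in s, ∫ y in t, f x y ∂ν ∂μ = ∫ y in t, ∫ x in s, f x y ∂μ ∂ν := by
  refine integral_integral_swap ?_
  rw [Measure.prod_restrict]
  exact hf.integrableOn_compact (hs.prod ht)

theorem exists_isHaarMeasure_maximalCompact (n : ℕ) :
    ∃ ν : Measure (GL (Fin n) F), ν.IsHaarMeasure ∧ ν (maximalCompact F n) = 1 := by
  let K₀ : TopologicalSpace.PositiveCompacts (GL (Fin n) F) :=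
    { carrier := maximalCompact F n
      isCompact' := isCompact_maximalCompact n
      interior_nonempty' := by
        rw [(isOpen_maximalCompact n).interior_eq]
        exact ⟨1, one_mem _⟩ }
  exact ⟨haarMeasure K₀, inferInstance, haarMeasure_self⟩

end Measure

end Primitive

end LocalBirch

namespace LocalBirch

section Reduction

variable {F : Type*} [NontriviallyNormedField F] [IsUltrametricDist F]

/-! ### The integrand -/

/-- The integrand of the zeta integral without the power of `|det g|`. -/
noncomputable def coreIntegrand {n : ℕ} (f : Fˣ) (w : GL (Fin (n + 1)) F → ℂ)
    (v : GL (Fin n) F → ℂ) (χ : Fˣ →ₜ* ℂˣ) (g : GL (Fin n) F) : ℂ :=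
  w (embed g * hMatrix F n * embed (tMatrix (-f))) * v (g * tMatrix f) *
    (χ (Matrix.GeneralLinearGroup.det g) : ℂ)

/-- The part of `coreIntegrand` that transforms by a character under diagonal matrices of
units. -/
noncomputable def torusIntegrand {n : ℕ} (f : Fˣ) (w : GL (Fin (n + 1)) F → ℂ)
    (v : GL (Fin n) F → ℂ) (χ : Fˣ →ₜ* ℂˣ) (g : GL (Fin n) F) : ℂ :=
  w (embed (g * weylGL F n * tMatrix (-f))) * v (g * tMatrix f) *
    (χ (Matrix.GeneralLinearGroup.det g) : ℂ)

variable {ϖ : Fˣ} {ψ : AddChar F ℂ} {α : ℕ}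

theorem coreIntegrand_eq {n : ℕ} {θ : Fin (n + 2) → (Fˣ →ₜ* ℂˣ)} {w : GL (Fin (n + 2)) F → ℂ}
    (hw : IsWhittaker ϖ ψ α θ w) (f : Fˣ) (v : GL (Fin (n + 1)) F → ℂ) (χ : Fˣ →ₜ* ℂˣ)
    (g : GL (Fin (n + 1)) F) :
    coreIntegrand f w v χ g =
      ψ (∑ j, (g : Matrix (Fin (n + 1)) (Fin (n + 1)) F) (Fin.last n) j) *
        torusIntegrand f w v χ g := by
  rw [coreIntegrand, torusIntegrand, embed_mul_hMatrix, hw.left _ (translation_mem_unipotent _),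
    genericChar_translation]
  ring

theorem torusIntegrand_mul_diagGL {n : ℕ} {θ : Fin (n + 2) → (Fˣ →ₜ* ℂˣ)}
    {w : GL (Fin (n + 2)) F → ℂ} (hw : IsWhittaker ϖ ψ α θ w) (f : Fˣ)
    {θ' : Fin (n + 1) → (Fˣ →ₜ* ℂˣ)} {v : GL (Fin (n + 1)) F → ℂ}
    (hv : IsWhittaker ϖ ψ⁻¹ α θ' v) (χ : Fˣ →ₜ* ℂˣ) (g : GL (Fin (n + 1)) F)
    (d : Fin (n + 1) → Fˣ) (hd : ∀ i, ‖(d i : F)‖ = 1) :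
    torusIntegrand f w v χ (g * diagGL d) =
      (∏ i, (twistedChar χ θ θ' (Fin.last n) i (d i) : ℂ)) * torusIntegrand f w v χ g := by
  have h1 : embed (g * diagGL d * weylGL F (n + 1) * tMatrix (-f)) =
      embed (g * weylGL F (n + 1) * tMatrix (-f)) * embed (diagGL fun i => d (Fin.rev i)) := by
    rw [← embed_mul, mul_assoc g, diagGL_mul_weylGL, tMatrix_eq, mul_assoc, mul_assoc, ← map_mul,
      mul_comm, map_mul]
    simp only [mul_assoc]
  have h2 : g * diagGL d * tMatrix f = g * tMatrix f * diagGL d := by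
    rw [tMatrix_eq, mul_assoc, ← map_mul, mul_comm, map_mul, mul_assoc]
  rw [torusIntegrand, torusIntegrand, h1, h2,
    hw.right _ _ (embed_mem_iwahori ϖ (diagGL_mem_iwahori ϖ α _ fun i => hd _)),
    hv.right _ _ (diagGL_mem_iwahori ϖ α _ hd), embed_diagGL, diagChar_diagGL, diagChar_diagGL,
    map_mul, map_mul, det_diagGL, Fin.prod_univ_castSucc]
  simp only [Fin.snoc_castSucc, Fin.snoc_last, map_one, Units.val_one, mul_one, Units.val_mul,
    map_prod, Units.coe_prod]
  have h3 : ∏ i : Fin (n + 1), ((θ i.castSucc) (d (Fin.rev i)) : ℂ) =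
      ∏ i : Fin (n + 1), (θ ⟨((Fin.last n : Fin (n + 1)) : ℕ) - i, by omega⟩ (d i) : ℂ) := by
    rw [← Equiv.prod_comp Fin.revPerm]
    refine Finset.prod_congr rfl fun i _ => ?_
    rw [Fin.revPerm_apply, Fin.rev_rev]
    congr 3
    ext
    simp [Fin.val_rev]
  have h4 : ∀ i, (twistedChar χ θ θ' (Fin.last n) i (d i) : ℂ) =
      χ (d i) * ((θ ⟨((Fin.last n : Fin (n + 1)) : ℕ) - i, by omega⟩ (d i) : ℂ) *
        (θ' i (d i) : ℂ)) := fun i => rfl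
  rw [h3]
  simp only [h4, Finset.prod_mul_distrib]
  ring

theorem det_eq_one_of_mem_unipotent {n : ℕ} {u : GL (Fin n) F} (hu : u ∈ unipotent F n) :
    Matrix.GeneralLinearGroup.det u = 1 := by
  apply Units.ext
  rw [Matrix.GeneralLinearGroup.val_det_apply, Matrix.det_of_isUpperTriangular hu.1]
  simp [hu.2]

theorem torusIntegrand_unipotent_mul {n : ℕ} {θ : Fin (n + 1) → (Fˣ →ₜ* ℂˣ)}
    {w : GL (Fin (n + 1)) F → ℂ} (hw : IsWhittaker ϖ ψ α θ w) (f : Fˣ)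
    {θ' : Fin n → (Fˣ →ₜ* ℂˣ)} {v : GL (Fin n) F → ℂ}
    (hv : IsWhittaker ϖ ψ⁻¹ α θ' v) (χ : Fˣ →ₜ* ℂˣ) {u : GL (Fin n) F} (hu : u ∈ unipotent F n)
    (g : GL (Fin n) F) : torusIntegrand f w v χ (u * g) = torusIntegrand f w v χ g := by
  rw [torusIntegrand, torusIntegrand, map_mul, det_eq_one_of_mem_unipotent hu, one_mul, mul_assoc u,
    mul_assoc u, mul_assoc u, embed_mul, hw.left _ (embed_mem_unipotent hu), hv.left _ hu,
    genericChar_embed]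
  linear_combination (w (embed (g * weylGL F n * tMatrix (-f))) * v (g * tMatrix f) *
    (χ (Matrix.GeneralLinearGroup.det g) : ℂ)) * genericChar_inv_mul ψ u

theorem coreIntegrand_unipotent_mul {n : ℕ} {θ : Fin (n + 1) → (Fˣ →ₜ* ℂˣ)}
    {w : GL (Fin (n + 1)) F → ℂ} (hw : IsWhittaker ϖ ψ α θ w) (f : Fˣ)
    {θ' : Fin n → (Fˣ →ₜ* ℂˣ)} {v : GL (Fin n) F → ℂ}
    (hv : IsWhittaker ϖ ψ⁻¹ α θ' v) (χ : Fˣ →ₜ* ℂˣ) {u : GL (Fin n) F} (hu : u ∈ unipotent F n)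
    (g : GL (Fin n) F) : coreIntegrand f w v χ (u * g) = coreIntegrand f w v χ g := by
  rw [coreIntegrand, coreIntegrand, map_mul, det_eq_one_of_mem_unipotent hu, one_mul, mul_assoc u,
    embed_mul, mul_assoc (embed u), mul_assoc (embed u), hw.left _ (embed_mem_unipotent hu),
    hv.left _ hu, genericChar_embed]
  linear_combination (w (embed g * hMatrix F n * embed (tMatrix (-f))) * v (g * tMatrix f) *
    (χ (Matrix.GeneralLinearGroup.det g) : ℂ)) * genericChar_inv_mul ψ u

/-! ### The reduction from `n + 1` to `n` -/

theorem IsWhittaker.restrict_embed {n : ℕ} {θ : Fin (n + 2) → (Fˣ →ₜ* ℂˣ)}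
    {w : GL (Fin (n + 2)) F → ℂ} (hw : IsWhittaker ϖ ψ α θ w) (c : Fˣ) :
    IsWhittaker ϖ ψ α (fun i : Fin (n + 1) => θ i.castSucc)
      (fun g : GL (Fin (n + 1)) F => w (embed (scalarGL (n + 1) c * g))) := by
  constructor
  · intro u hu g
    rw [← mul_assoc, scalarGL_comm, mul_assoc, embed_mul, hw.left _ (embed_mem_unipotent hu),
      genericChar_embed]
  · intro g r hr
    rw [← mul_assoc, embed_mul, hw.right _ _ (embed_mem_iwahori ϖ hr)]
    congr 1
    simp [diagChar, Fin.prod_univ_castSucc, charVal_one]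

theorem IsWhittaker.restrict_scalar_embed {n : ℕ} {θ : Fin (n + 1) → (Fˣ →ₜ* ℂˣ)}
    {v : GL (Fin (n + 1)) F → ℂ} (hv : IsWhittaker ϖ ψ α θ v) (c : Fˣ) :
    IsWhittaker ϖ ψ α (fun i : Fin n => θ i.castSucc)
      (fun g : GL (Fin n) F => v (scalarGL (n + 1) c * embed g)) := by
  constructor
  · intro u hu g
    rw [embed_mul, ← mul_assoc, scalarGL_comm, mul_assoc, hv.left _ (embed_mem_unipotent hu),
      genericChar_embed]
  · intro g r hr
    rw [embed_mul, ← mul_assoc, hv.right _ _ (embed_mem_iwahori ϖ hr)]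
    congr 1
    simp [diagChar, Fin.prod_univ_castSucc, charVal_one]

theorem scalarGL_neg_one_mul_signGL (n : ℕ) :
    scalarGL (n + 1) (-1 : Fˣ) * signGL F n =
      diagGL (Fin.snoc (fun _ : Fin n => 1) (-1) : Fin (n + 1) → Fˣ) := by
  rw [scalarGL, signGL, ← map_mul]
  congr 1
  ext i
  refine Fin.lastCases ?_ (fun i => ?_) i <;> simp

theorem torusIntegrand_mul_lowerOnes {n : ℕ} (hϖ : ‖(ϖ : F)‖ ≤ 1)
    {θ : Fin (n + 2) → (Fˣ →ₜ* ℂˣ)}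
    {w : GL (Fin (n + 2)) F → ℂ} (hw : IsWhittaker ϖ ψ α θ w)
    {θ' : Fin (n + 1) → (Fˣ →ₜ* ℂˣ)} {v : GL (Fin (n + 1)) F → ℂ}
    (hv : IsWhittaker ϖ ψ⁻¹ α θ' v) (χ : Fˣ →ₜ* ℂˣ) (x : Fˣ) (g : GL (Fin n) F) :
    torusIntegrand (ϖ ^ α) w v χ (scalarGL (n + 1) x * embed g * lowerOnes F (n + 1)) =
      (θ (Fin.last n).castSucc (-1) : ℂ) * (χ x : ℂ) ^ (n + 1) *
      coreIntegrand (ϖ ^ α) (fun g => w (embed (scalarGL (n + 1) (ϖ ^ α * x) * g)))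
        (fun g => v (scalarGL (n + 1) (ϖ ^ α * x) * embed g)) χ g := by
  set f : Fˣ := ϖ ^ α with hf
  have hlow : ∀ y : Fˣ, ‖(y : F)‖ = ‖(f : F)‖ →
      lowerConj (n + 1) y ∈ iwahori ϖ (n + 1) α := by
    intro y hy
    have h0 := lowerConj_mem_iwahori ϖ hϖ (n + 1) α
    refine ⟨?_, fun i j hij => ?_⟩
    · rw [mem_maximalCompact_iff]
      refine ⟨fun i j => ?_, ?_⟩
      · have := norm_entry_le_one h0.1 i j
        rw [lowerConj_apply] at this ⊢
        split_ifs at this ⊢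
        · rwa [norm_pow, hy, ← norm_pow]
        · simp
      · rw [lowerConj, map_mul, map_mul, det_lowerOnes, map_inv]
        simp
    · have := h0.2 i j hij
      rw [lowerConj_apply, if_pos hij.le, norm_pow] at this ⊢
      rwa [hy]
  have hw1 : embed (scalarGL (n + 1) x * embed g * lowerOnes F (n + 1) * weylGL F (n + 1) *
      tMatrix (-f)) = embed (scalarGL (n + 1) (f * x) *
        (embed g * hMatrix F n * embed (tMatrix (-f)))) *
        (embed (diagGL (Fin.snoc (fun _ : Fin n => 1) (-1) : Fin (n + 1) → Fˣ)) *
          embed (lowerConj (n + 1) (-f))) := by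
    have hneg : scalarGL (n + 1) (-f) = scalarGL (n + 1) f * scalarGL (n + 1) (-1) := by
      rw [← scalarGL_mul, mul_neg_one]
    rw [← embed_mul, ← embed_mul, ← scalarGL_neg_one_mul_signGL, mul_assoc, mul_assoc,
      ← mul_assoc (lowerOnes F (n + 1)), lowerOnes_mul_weyl, mul_comm f x, scalarGL_mul x f, hneg,
      mul_assoc (embed g)]
    congr 1
    generalize hMatrix F n * embed (tMatrix (-f)) = H
    generalize lowerConj (n + 1) (-f) = L
    calc scalarGL (n + 1) x * embed g * (scalarGL (n + 1) f * scalarGL (n + 1) (-1) * H *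
          (signGL F n * L))
        = scalarGL (n + 1) x * (embed g * scalarGL (n + 1) f) * (scalarGL (n + 1) (-1) * H) *
          signGL F n * L := by group
      _ = scalarGL (n + 1) x * (scalarGL (n + 1) f * embed g) * (H * scalarGL (n + 1) (-1)) *
          signGL F n * L := by rw [scalarGL_comm f, scalarGL_comm (-1)]
      _ = _ := by group
  have hv1 : scalarGL (n + 1) x * embed g * lowerOnes F (n + 1) * tMatrix f =
      scalarGL (n + 1) (f * x) * embed (g * tMatrix f) * lowerConj (n + 1) f := by
    have h1 : scalarGL (n + 1) (f * x) * embed (g * tMatrix f) =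
        scalarGL (n + 1) x * embed g * tMatrix f := by
      rw [embed_mul, mul_assoc, tMatrix_succ, ← mul_assoc (embed g), ← scalarGL_comm, mul_comm f x,
        scalarGL_mul]
      simp only [mul_assoc]
    rw [h1, lowerConj]
    group
  have hdet : Matrix.GeneralLinearGroup.det
      (scalarGL (n + 1) x * embed g * lowerOnes F (n + 1)) =
      x ^ (n + 1) * Matrix.GeneralLinearGroup.det g := by
    rw [map_mul, map_mul, det_lowerOnes, mul_one, det_embed, scalarGL, det_diagGL]
    simp
  rw [torusIntegrand, coreIntegrand, hw1, hv1, hdet, ← mul_assoc,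
    hw.right _ _ (embed_mem_iwahori ϖ (hlow _ (by simp))),
    hw.right _ _ (embed_mem_iwahori ϖ (diagGL_mem_iwahori ϖ α _ ?_)),
    hv.right _ _ (hlow _ rfl), diagChar_lowerConj, embed_diagGL, diagChar_diagGL]
  · have : diagChar θ (embed (lowerConj (n + 1) (-f))) = 1 := by
      simp [diagChar, Fin.prod_univ_castSucc, lowerConj_apply, charVal_one]
    rw [this]
    simp only [Fin.prod_univ_castSucc, Fin.snoc_castSucc, Fin.snoc_last, map_one, Units.val_one,
      mul_one, Finset.prod_const_one, one_mul, map_mul, map_pow, Units.val_mul,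
      Units.val_pow_eq_pow_val]
    ring
  · intro i
    refine Fin.lastCases ?_ (fun i => ?_) i <;> simp

/-- Matrices with units in the last row. -/
theorem exists_eq_of_mem_unitRow {n : ℕ} {k : GL (Fin (n + 1)) F} (hk : k ∈ unitRow F n) :
    ∃ (c : Fin n → F) (k₀ : GL (Fin n) F) (d : Fin (n + 1) → Fˣ),
      k₀ ∈ maximalCompact F n ∧ (∀ i, ‖(d i : F)‖ = 1) ∧
      (∀ i, (d i : F) = (k : Matrix (Fin (n + 1)) (Fin (n + 1)) F) (Fin.last n) i) ∧
      k = translation c * embed k₀ * lowerOnes F (n + 1) * diagGL d := by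
  have hne : ∀ i, (k : Matrix (Fin (n + 1)) (Fin (n + 1)) F) (Fin.last n) i ≠ 0 := fun i =>
    norm_ne_zero_iff.1 (by rw [hk.2 i]; exact one_ne_zero)
  set d : Fin (n + 1) → Fˣ := fun i => Units.mk0 _ (hne i) with hd
  have hd1 : ∀ i, ‖(d i : F)‖ = 1 := fun i => hk.2 i
  obtain ⟨g, hg⟩ : ∃ g, g = k * (diagGL d)⁻¹ * (lowerOnes F (n + 1))⁻¹ := ⟨_, rfl⟩
  have hgK : g ∈ maximalCompact F (n + 1) := hg ▸
    mul_mem (mul_mem hk.1 (inv_mem (diagGL_mem_maximalCompact d hd1)))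
      (inv_mem (lowerOnes_mem_maximalCompact _))
  have hgL : g * lowerOnes F (n + 1) = k * diagGL d⁻¹ := by rw [hg, map_inv]; group
  have hlast : ∀ j, (g : Matrix (Fin (n + 1)) (Fin (n + 1)) F) (Fin.last n) j =
      if j = Fin.last n then 1 else 0 := by
    have h1 : Matrix.vecMul ((g : Matrix (Fin (n + 1)) (Fin (n + 1)) F) (Fin.last n))
        (lowerOnes F (n + 1) : Matrix (Fin (n + 1)) (Fin (n + 1)) F) = fun _ => 1 := by
      ext j
      have h2 : ((g * lowerOnes F (n + 1) : GL (Fin (n + 1)) F) :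
          Matrix (Fin (n + 1)) (Fin (n + 1)) F) (Fin.last n) j = 1 := by
        rw [hgL, mul_diagGL_apply]
        simp [hd, hne]
      rw [← h2, Units.val_mul, Matrix.mul_apply]
      rfl
    have h3 : Matrix.vecMul (fun j : Fin (n + 1) => if j = Fin.last n then (1 : F) else 0)
        (lowerOnes F (n + 1) : Matrix (Fin (n + 1)) (Fin (n + 1)) F) = fun _ => 1 := by
      ext j
      simp only [Matrix.vecMul, dotProduct, lowerOnes_apply]
      rw [Finset.sum_eq_single (Fin.last n)]
      · simp [Fin.le_last]
      · intro i _ hi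
        simp [hi]
      · simp
    have h4 := congrArg (fun y => Matrix.vecMul y
      ((lowerOnes F (n + 1))⁻¹ : GL (Fin (n + 1)) F).val) (h1.trans h3.symm)
    simp only [Matrix.vecMul_vecMul, ← Units.val_mul, mul_inv_cancel, Units.val_one,
      Matrix.vecMul_one] at h4
    intro j
    rw [h4]
  obtain ⟨c, k₀, hck⟩ := exists_eq_translation_mul_embed g
    (fun j => by rw [hlast, if_neg (Fin.castSucc_ne_last j)]) (by rw [hlast, if_pos rfl])
  refine ⟨c, k₀, d, ?_, hd1, fun i => rfl, ?_⟩
  · rw [mem_maximalCompact_iff] at hgK ⊢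
    constructor
    · intro i j
      have := hgK.1 i.castSucc j.castSucc
      rw [hck, Units.val_mul, translation_val, embed_val, bordered_mul] at this
      simpa using this
    · rw [← hgK.2, hck, map_mul, det_embed, det_eq_one_of_mem_unipotent
        (translation_mem_unipotent c), one_mul]
  · rw [← hck, hgL, map_inv]
    group

end Reduction

end LocalBirch

namespace LocalBirch

section Key

open Measure

variable {F : Type*} [NontriviallyNormedField F] [IsUltrametricDist F] [ProperSpace F]

/-! ### Integration over the maximal compact subgroup -/

theorem continuous_char_det {n : ℕ} (χ : Fˣ →ₜ* ℂˣ) :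
    Continuous fun g : GL (Fin n) F => (χ (Matrix.GeneralLinearGroup.det g) : ℂ) :=
  Units.continuous_val.comp (χ.continuous_toFun.comp continuous_det_GL)

theorem continuous_torusIntegrand {n : ℕ} {w : GL (Fin (n + 1)) F → ℂ} (hw : Continuous w)
    {v : GL (Fin n) F → ℂ} (hv : Continuous v) (f : Fˣ) (χ : Fˣ →ₜ* ℂˣ) :
    Continuous (torusIntegrand f w v χ) := by
  refine ((hw.comp (continuous_embed.comp ?_)).mul (hv.comp ?_)).mul (continuous_char_det χ)
  · exact (continuous_mul_const _).comp (continuous_mul_const _)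
  · exact continuous_mul_const _

theorem continuous_coreIntegrand {n : ℕ} {w : GL (Fin (n + 1)) F → ℂ} (hw : Continuous w)
    {v : GL (Fin n) F → ℂ} (hv : Continuous v) (f : Fˣ) (χ : Fˣ →ₜ* ℂˣ) :
    Continuous (coreIntegrand f w v χ) := by
  refine ((hw.comp ?_).mul (hv.comp ?_)).mul (continuous_char_det χ)
  · exact (continuous_mul_const _).comp ((continuous_mul_const _).comp continuous_embed)
  · exact continuous_mul_const _

theorem setIntegral_mul_right {n : ℕ} (ν : Measure (GL (Fin n) F)) [ν.IsHaarMeasure]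
    {k₀ : GL (Fin n) F} (hk₀ : k₀ ∈ maximalCompact F n) (Φ : GL (Fin n) F → ℂ) :
    ∫ k in maximalCompact F n, Φ (k * k₀) ∂ν = ∫ k in maximalCompact F n, Φ k ∂ν := by
  have h1 : MeasurePreserving (· * k₀) ν ν :=
    ⟨measurable_mul_const k₀, map_mul_right_maximalCompact ν hk₀⟩
  have h2 := h1.setIntegral_preimage_emb (Homeomorph.mulRight k₀).measurableEmbedding Φ
    (maximalCompact F n)
  rw [← h2]
  congr 2
  ext k
  exact ((maximalCompact F n).mul_mem_cancel_right hk₀).symm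

theorem setIntegral_mul_left {n : ℕ} (ν : Measure (GL (Fin n) F)) [ν.IsHaarMeasure]
    {k₀ : GL (Fin n) F} (hk₀ : k₀ ∈ maximalCompact F n) (Φ : GL (Fin n) F → ℂ) :
    ∫ k in maximalCompact F n, Φ (k₀ * k) ∂ν = ∫ k in maximalCompact F n, Φ k ∂ν := by
  have h2 := (measurePreserving_mul_left ν k₀).setIntegral_preimage_emb
    (Homeomorph.mulLeft k₀).measurableEmbedding Φ (maximalCompact F n)
  rw [← h2]
  congr 2
  ext k
  exact ((maximalCompact F n).mul_mem_cancel_left hk₀).symm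

theorem addChar_sum {ι : Type*} (ψ : AddChar F ℂ) (s : Finset ι) (y : ι → F) :
    ψ (∑ i ∈ s, y i) = ∏ i ∈ s, ψ (y i) := by
  classical
  induction s using Finset.induction_on with
  | empty => simp
  | insert i s hi ih => rw [Finset.sum_insert hi, Finset.prod_insert hi, AddChar.map_add_eq_mul, ih]

variable [MeasurableSpace F] [BorelSpace F] (lam : Measure F) [lam.IsAddHaarMeasure]
  {ϖ : Fˣ} {ψ : AddChar F ℂ} {α : ℕ}

/-- The function obtained from `coreIntegrand` by averaging over the diagonal matrices of
units. -/
noncomputable def averagedIntegrand (ψ : AddChar F ℂ) {n : ℕ} (f : Fˣ) (θ : Fin (n + 2) → (Fˣ →ₜ* ℂˣ))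
    (w : GL (Fin (n + 2)) F → ℂ) (θ' : Fin (n + 1) → (Fˣ →ₜ* ℂˣ)) (v : GL (Fin (n + 1)) F → ℂ)
    (χ : Fˣ →ₜ* ℂˣ) (g : GL (Fin (n + 1)) F) : ℂ :=
  (∏ i, unitIntegral lam ψ (twistedChar χ θ θ' (Fin.last n) i)
    ((g : Matrix (Fin (n + 1)) (Fin (n + 1)) F) (Fin.last n) i)) * torusIntegrand f w v χ g

theorem continuous_averagedIntegrand (hψ : HasConductorIntegers ψ) {n : ℕ} (f : Fˣ)
    (θ : Fin (n + 2) → (Fˣ →ₜ* ℂˣ)) {w : GL (Fin (n + 2)) F → ℂ} (hw : Continuous w)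
    (θ' : Fin (n + 1) → (Fˣ →ₜ* ℂˣ)) {v : GL (Fin (n + 1)) F → ℂ} (hv : Continuous v)
    (χ : Fˣ →ₜ* ℂˣ) : Continuous (averagedIntegrand lam ψ f θ w θ' v χ) := by
  refine Continuous.mul (continuous_finsetProd _ fun i _ => ?_)
    (continuous_torusIntegrand hw hv f χ)
  exact (continuous_unitIntegral lam hψ _).comp (continuous_entry _ _)

theorem setIntegral_averagedIntegrand (hψ : HasConductorIntegers ψ) {n : ℕ} (f : Fˣ)
    {θ : Fin (n + 2) → (Fˣ →ₜ* ℂˣ)} {w : GL (Fin (n + 2)) F → ℂ} (hw : IsWhittaker ϖ ψ α θ w)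
    {θ' : Fin (n + 1) → (Fˣ →ₜ* ℂˣ)} {v : GL (Fin (n + 1)) F → ℂ}
    (hv : IsWhittaker ϖ ψ⁻¹ α θ' v) (χ : Fˣ →ₜ* ℂˣ)
    (ν : Measure (GL (Fin (n + 1)) F)) [ν.IsHaarMeasure] (g : GL (Fin (n + 1)) F) :
    (lam.real (Metric.sphere 0 1) : ℂ) ^ (n + 1) *
        ∫ k in maximalCompact F (n + 1), coreIntegrand f w v χ (g * k) ∂ν =
      ∫ k in maximalCompact F (n + 1), averagedIntegrand lam ψ f θ w θ' v χ (g * k) ∂ν := by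
  set S : Set (Fin (n + 1) → F) := Set.pi Set.univ fun _ => Metric.sphere 0 1 with hS
  have hSmem : ∀ y, y ∈ S ↔ ∀ i, ‖y i‖ = 1 := fun y => by simp [hS, Set.mem_pi]
  have hSc : IsCompact S := isCompact_univ_pi fun _ => isCompact_sphere _ _
  have hSm : MeasurableSet S := hSc.measurableSet
  set Λ : Fin (n + 1) → (Fˣ →ₜ* ℂˣ) := fun i => twistedChar χ θ θ' (Fin.last n) i with hΛ
  set row : GL (Fin (n + 1)) F → Fin (n + 1) → F := fun k i =>
    ((g * k : GL (Fin (n + 1)) F) : Matrix (Fin (n + 1)) (Fin (n + 1)) F) (Fin.last n) i with hrow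
  set H : GL (Fin (n + 1)) F → (Fin (n + 1) → F) → ℂ := fun k d =>
    (∏ i, (charVal (Λ i) (d i) * ψ (row k i * d i))) * torusIntegrand f w v χ (g * k) with hH
  have hrowc : ∀ i, Continuous fun k => row k i := fun i =>
    (continuous_entry (Fin.last n) i).comp (continuous_const_mul g)
  have hcont : ContinuousOn (Function.uncurry H)
      ((maximalCompact F (n + 1) : Set (GL (Fin (n + 1)) F)) ×ˢ S) := by
    refine ContinuousOn.mul (continuousOn_finsetProd _ fun i _ => ContinuousOn.mul ?_ ?_) ?_
    · intro p hp
      have h1 : ‖p.2 i‖ = 1 := (hSmem _).1 hp.2 i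
      have h2 : p.2 i ≠ 0 := norm_ne_zero_iff.1 (by rw [h1]; exact one_ne_zero)
      exact (ContinuousAt.comp (f := fun p : GL (Fin (n + 1)) F × (Fin (n + 1) → F) => p.2 i)
        (continuousAt_charVal (Λ i) h2)
        ((continuous_apply i).comp continuous_snd).continuousAt).continuousWithinAt
    · exact (hψ.continuous.comp (((hrowc i).comp continuous_fst).mul
        ((continuous_apply i).comp continuous_snd))).continuousOn
    · exact ((continuous_torusIntegrand hw.continuous hv.continuous f χ).comp
        ((continuous_const_mul g).comp continuous_fst)).continuousOn
  have hswap := setIntegral_swap_of_continuousOn ν (Measure.pi fun _ : Fin (n + 1) => lam)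
    (isCompact_maximalCompact (n + 1)) hSc hcont
  have hleft : ∀ k, ∫ d in S, H k d ∂(Measure.pi fun _ : Fin (n + 1) => lam) =
      averagedIntegrand lam ψ f θ w θ' v χ (g * k) := by
    intro k
    rw [hS, Measure.restrict_pi_pi]
    simp only [hH]
    rw [integral_mul_const, integral_fintype_prod_eq_prod (fun i (r : F) =>
      charVal (Λ i) r * ψ (row k i * r))]
    rfl
  have hright : ∀ d ∈ S, ∫ k in maximalCompact F (n + 1), H k d ∂ν =
      ∫ k in maximalCompact F (n + 1), coreIntegrand f w v χ (g * k) ∂ν := by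
    intro d hd
    rw [hSmem] at hd
    have hne : ∀ i, d i ≠ 0 := fun i => norm_ne_zero_iff.1 (by rw [hd i]; exact one_ne_zero)
    set D : Fin (n + 1) → Fˣ := fun i => Units.mk0 (d i) (hne i) with hD
    have hD1 : ∀ i, ‖(D i : F)‖ = 1 := hd
    rw [← setIntegral_mul_right ν (diagGL_mem_maximalCompact D hD1)
      (fun k => coreIntegrand f w v χ (g * k))]
    congr 1
    ext k
    rw [← mul_assoc, coreIntegrand_eq hw, torusIntegrand_mul_diagGL hw f hv χ _ D hD1]
    have h3 : ∀ i, charVal (Λ i) (d i) = (Λ i (D i) : ℂ) := fun i => charVal_of_ne _ (hne i)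
    simp only [hH, h3, Finset.prod_mul_distrib, mul_diagGL_apply]
    rw [addChar_sum]
    rw [mul_comm (∏ i, (Λ i (D i) : ℂ)), mul_assoc]
    rfl
  have hS1 : (Measure.pi fun _ : Fin (n + 1) => lam).real S =
      lam.real (Metric.sphere 0 1) ^ (n + 1) := by
    rw [measureReal_def, hS, Measure.pi_pi]
    simp [measureReal_def]
  rw [setIntegral_congr_fun hSm hright, setIntegral_const, hS1] at hswap
  simp only [hleft] at hswap
  rw [hswap]
  simp [Complex.real_smul]

/-- The diagonal matrix of powers of `ϖ`. -/
def powGL {n : ℕ} (ϖ : Fˣ) (a : Fin n → ℤ) : GL (Fin n) F := diagGL fun i => ϖ ^ a i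

theorem powGL_last_row {n : ℕ} (a : Fin (n + 1) → ℤ) (k : GL (Fin (n + 1)) F) (i : Fin (n + 1)) :
    ((powGL ϖ a * k : GL (Fin (n + 1)) F) : Matrix (Fin (n + 1)) (Fin (n + 1)) F) (Fin.last n) i =
      (ϖ : F) ^ a (Fin.last n) * (k : Matrix (Fin (n + 1)) (Fin (n + 1)) F) (Fin.last n) i := by
  rw [powGL, diagGL_mul_apply]
  simp

theorem averagedIntegrand_eq_zero (hϖ : IsUniformizer ϖ) (hψ : HasConductorIntegers ψ) {n : ℕ}
    (f : Fˣ) (θ : Fin (n + 2) → (Fˣ →ₜ* ℂˣ)) (w : GL (Fin (n + 2)) F → ℂ)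
    (θ' : Fin (n + 1) → (Fˣ →ₜ* ℂˣ)) (v : GL (Fin (n + 1)) F → ℂ) (χ : Fˣ →ₜ* ℂˣ) {e : ℕ}
    (he : 1 ≤ e) (hcond : ∀ i, conductorExp ϖ (twistedChar χ θ θ' (Fin.last n) i) = e)
    (a : Fin (n + 1) → ℤ) {k : GL (Fin (n + 1)) F} (hk : k ∈ maximalCompact F (n + 1))
    (h : averagedIntegrand lam ψ f θ w θ' v χ (powGL ϖ a * k) ≠ 0) :
    a (Fin.last n) = -e ∧ k ∈ unitRow F n := by
  have h1 : ∀ i, ‖(ϖ : F)‖ ^ a (Fin.last n) *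
      ‖(k : Matrix (Fin (n + 1)) (Fin (n + 1)) F) (Fin.last n) i‖ = ‖(ϖ : F)‖ ^ (-(e : ℤ)) := by
    intro i
    have h2 := Finset.prod_ne_zero_iff.1 (left_ne_zero_of_mul h) i (Finset.mem_univ i)
    have h3 := norm_eq_of_unitIntegral_ne_zero lam hψ hϖ (by rw [hcond i]; exact he) h2
    rwa [hcond i, powGL_last_row, norm_mul, norm_zpow] at h3
  obtain ⟨i, hi⟩ := exists_norm_last_row_eq_one hk
  have h2 := h1 i
  rw [hi, mul_one] at h2
  refine ⟨hϖ.zpow_inj h2, hk, fun j => ?_⟩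
  have h3 := h1 j
  rw [h2] at h3
  exact mul_right_eq_self₀.1 h3 |>.resolve_right (zpow_pos (norm_unit_pos ϖ) _).ne'

theorem averagedIntegrand_eq (hϖ : IsUniformizer ϖ) {n : ℕ}
    {θ : Fin (n + 2) → (Fˣ →ₜ* ℂˣ)} {w : GL (Fin (n + 2)) F → ℂ} (hw : IsWhittaker ϖ ψ α θ w)
    {θ' : Fin (n + 1) → (Fˣ →ₜ* ℂˣ)} {v : GL (Fin (n + 1)) F → ℂ}
    (hv : IsWhittaker ϖ ψ⁻¹ α θ' v) (χ : Fˣ →ₜ* ℂˣ) {e : ℕ}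
    (a : Fin (n + 1) → ℤ) (ha : a (Fin.last n) = -e) {c : Fin n → F} {k₀ : GL (Fin n) F}
    {d : Fin (n + 1) → Fˣ} (hd : ∀ i, ‖(d i : F)‖ = 1) :
    averagedIntegrand lam ψ (ϖ ^ α) θ w θ' v χ
        (powGL ϖ a * (translation c * embed k₀ * lowerOnes F (n + 1) * diagGL d)) =
      (∏ i, unitIntegral lam ψ (twistedChar χ θ θ' (Fin.last n) i) ((ϖ : F) ^ e)⁻¹) *
        ((θ (Fin.last n).castSucc (-1) : ℂ) * ((χ (ϖ ^ e) : ℂ)⁻¹) ^ (n + 1)) *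
        coreIntegrand (ϖ ^ α)
          (fun g => w (embed (scalarGL (n + 1) (ϖ ^ α * (ϖ ^ e)⁻¹) * g)))
          (fun g => v (scalarGL (n + 1) (ϖ ^ α * (ϖ ^ e)⁻¹) * embed g)) χ
          (powGL ϖ (fun i => a i.castSucc + e) * k₀) := by
  have hlast : ∀ i, ((powGL ϖ a * (translation c * embed k₀ * lowerOnes F (n + 1) * diagGL d) :
      GL (Fin (n + 1)) F) : Matrix (Fin (n + 1)) (Fin (n + 1)) F) (Fin.last n) i =
      ((ϖ : F) ^ e)⁻¹ * d i := by
    intro i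
    rw [powGL_last_row, ha, mul_diagGL_apply, zpow_neg, zpow_natCast]
    congr 1
    have : ((translation c * embed k₀ * lowerOnes F (n + 1) : GL (Fin (n + 1)) F) :
        Matrix (Fin (n + 1)) (Fin (n + 1)) F) (Fin.last n) i = 1 := by
      rw [Units.val_mul, Units.val_mul, translation_val, embed_val, bordered_mul, Matrix.mul_apply,
        Fin.sum_univ_castSucc]
      simp [lowerOnes_apply, Fin.le_last]
    rw [this, one_mul]
  have hpow : powGL ϖ a = scalarGL (n + 1) (ϖ ^ e)⁻¹ *
      embed (powGL ϖ fun i => a i.castSucc + e) := by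
    rw [powGL, diagGL_eq_scalar_mul]
    have h1 : ϖ ^ a (Fin.last n) = (ϖ ^ e)⁻¹ := by rw [ha, zpow_neg, zpow_natCast]
    rw [h1]
    congr 3
    ext i
    rw [inv_inv, zpow_add, mul_comm, zpow_natCast]
  have hg : powGL ϖ a * (translation c * embed k₀ * lowerOnes F (n + 1) * diagGL d) =
      (powGL ϖ a * translation c * (powGL ϖ a)⁻¹) *
        (scalarGL (n + 1) (ϖ ^ e)⁻¹ * embed ((powGL ϖ fun i => a i.castSucc + e) * k₀) *
          lowerOnes F (n + 1) * diagGL d) := by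
    rw [embed_mul, ← mul_assoc (scalarGL _ _), ← hpow]
    group
  rw [averagedIntegrand]
  simp only [hlast]
  have hu : powGL ϖ a * translation c * (powGL ϖ a)⁻¹ ∈ unipotent F (n + 1) :=
    diagGL_conj_mem_unipotent _ (translation_mem_unipotent c)
  rw [hg, torusIntegrand_unipotent_mul hw _ hv χ hu,
    torusIntegrand_mul_diagGL hw _ hv χ _ d hd,
    torusIntegrand_mul_lowerOnes hϖ.norm_lt_one.le hw hv]
  have h5 : ∀ i, unitIntegral lam ψ (twistedChar χ θ θ' (Fin.last n) i) (((ϖ : F) ^ e)⁻¹) =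
      (twistedChar χ θ θ' (Fin.last n) i (d i) : ℂ) *
      unitIntegral lam ψ (twistedChar χ θ θ' (Fin.last n) i) (((ϖ : F) ^ e)⁻¹ * d i) := fun i =>
    (unitIntegral_mul_unit lam ψ _ _ (d i) (hd i)).symm
  simp only [h5, Finset.prod_mul_distrib, map_inv, Units.val_inv_eq_inv_val]
  ring

theorem setIntegral_coreIntegrand_succ (hϖ : IsUniformizer ϖ)
    (hnorm : ‖(ϖ : F)‖ = (residueCard F : ℝ)⁻¹) (hlam : lam (Metric.closedBall 0 1) = 1)
    (hψ : HasConductorIntegers ψ) {n : ℕ}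
    {θ : Fin (n + 2) → (Fˣ →ₜ* ℂˣ)} {w : GL (Fin (n + 2)) F → ℂ} (hw : IsWhittaker ϖ ψ α θ w)
    {θ' : Fin (n + 1) → (Fˣ →ₜ* ℂˣ)} {v : GL (Fin (n + 1)) F → ℂ}
    (hv : IsWhittaker ϖ ψ⁻¹ α θ' v) (χ : Fˣ →ₜ* ℂˣ) {e : ℕ} (he : 1 ≤ e)
    (hcond : ∀ i, conductorExp ϖ (twistedChar χ θ θ' (Fin.last n) i) = e)
    (ν : Measure (GL (Fin (n + 1)) F)) [ν.IsHaarMeasure]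
    (hν : ν (maximalCompact F (n + 1)) = 1)
    (ν' : Measure (GL (Fin n) F)) [ν'.IsHaarMeasure]
    (hν' : ν' (maximalCompact F n) = 1) (a : Fin (n + 1) → ℤ) :
    ∫ k in maximalCompact F (n + 1), coreIntegrand (ϖ ^ α) w v χ (powGL ϖ a * k) ∂ν =
      if a (Fin.last n) = -e then
        (1 - ((residueCard F : ℂ) ^ (n + 1))⁻¹)⁻¹ *
        ((∏ i, unitIntegral lam ψ (twistedChar χ θ θ' (Fin.last n) i) ((ϖ : F) ^ e)⁻¹) *
        ((θ (Fin.last n).castSucc (-1) : ℂ) * ((χ (ϖ ^ e) : ℂ)⁻¹) ^ (n + 1))) *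
        ∫ k in maximalCompact F n, coreIntegrand (ϖ ^ α)
          (fun g => w (embed (scalarGL (n + 1) (ϖ ^ α * (ϖ ^ e)⁻¹) * g)))
          (fun g => v (scalarGL (n + 1) (ϖ ^ α * (ϖ ^ e)⁻¹) * embed g)) χ
          (powGL ϖ (fun i => a i.castSucc + e) * k) ∂ν'
      else 0 := by
  set K : Set (GL (Fin (n + 1)) F) := ↑(maximalCompact F (n + 1)) with hK
  have hKm : MeasurableSet K := (isOpen_maximalCompact _).measurableSet
  set G : GL (Fin (n + 1)) F → ℂ := fun k =>
    averagedIntegrand lam ψ (ϖ ^ α) θ w θ' v χ (powGL ϖ a * k) with hG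
  have hGc : Continuous G :=
    (continuous_averagedIntegrand lam hψ _ θ hw.continuous θ' hv.continuous χ).comp
      (continuous_const_mul _)
  have hq := one_lt_residueCard hϖ hnorm
  have hS0 : (lam.real (Metric.sphere 0 1) : ℂ) ≠ 0 := by
    rw [Complex.ofReal_ne_zero, measureReal_def, measure_sphere lam hϖ hnorm hlam,
      ENNReal.toReal_ne_zero]
    constructor
    · refine (tsub_pos_of_lt (ENNReal.inv_lt_one.2 ?_)).ne'
      exact_mod_cast hq
    · exact ENNReal.sub_ne_top ENNReal.one_ne_top
  have hmain := setIntegral_averagedIntegrand lam hψ (ϖ ^ α) hw hv χ ν (powGL ϖ a)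
  change _ = ∫ k in K, G k ∂ν at hmain
  have hzero : ∀ k ∈ K, ¬ (a (Fin.last n) = -e ∧ k ∈ unitRow F n) → G k = 0 := by
    intro k hk h
    by_contra h'
    exact h (averagedIntegrand_eq_zero lam hϖ hψ _ θ w θ' v χ he hcond a hk h')
  split_ifs with ha
  swap
  · rw [setIntegral_congr_fun hKm (g := fun _ => 0) fun k hk => hzero k hk fun h => ha h.1] at hmain
    rw [integral_zero] at hmain
    exact (mul_eq_zero.1 hmain).resolve_left (pow_ne_zero _ hS0)
  set C : ℂ := (∏ i, unitIntegral lam ψ (twistedChar χ θ θ' (Fin.last n) i) ((ϖ : F) ^ e)⁻¹) *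
        ((θ (Fin.last n).castSucc (-1) : ℂ) * ((χ (ϖ ^ e) : ℂ)⁻¹) ^ (n + 1)) with hC
  set Φ : GL (Fin n) F → ℂ := fun k => coreIntegrand (ϖ ^ α)
          (fun g => w (embed (scalarGL (n + 1) (ϖ ^ α * (ϖ ^ e)⁻¹) * g)))
          (fun g => v (scalarGL (n + 1) (ϖ ^ α * (ϖ ^ e)⁻¹) * embed g)) χ
          (powGL ϖ (fun i => a i.castSucc + e) * k) with hΦ
  have hrow : ∀ (k'' : GL (Fin n) F) (k : GL (Fin (n + 1)) F) (i : Fin (n + 1)),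
      ((embed k'' * k : GL (Fin (n + 1)) F) : Matrix (Fin (n + 1)) (Fin (n + 1)) F)
        (Fin.last n) i = (k : Matrix (Fin (n + 1)) (Fin (n + 1)) F) (Fin.last n) i := by
    intro k'' k i
    rw [Units.val_mul, embed_val, Matrix.mul_apply, Fin.sum_univ_castSucc]
    simp
  have hinner : ∀ k ∈ K, ∫ k'' in maximalCompact F n, G (embed k'' * k) ∂ν' =
      (unitRow F n).indicator (fun _ => C * ∫ k'' in maximalCompact F n, Φ k'' ∂ν') k := by
    intro k hk
    by_cases hkE : k ∈ unitRow F n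
    · rw [Set.indicator_of_mem hkE]
      obtain ⟨c, k₀, d, hk₀, hd, -, hkeq⟩ := exists_eq_of_mem_unitRow hkE
      rw [← setIntegral_mul_right ν' hk₀ Φ, ← integral_const_mul]
      congr 1
      ext k''
      have h6 : embed k'' * k = translation (Matrix.mulVec (k'' : Matrix (Fin n) (Fin n) F) c) *
          embed (k'' * k₀) * lowerOnes F (n + 1) * diagGL d := by
        rw [hkeq, embed_mul, ← mul_assoc, ← mul_assoc, ← mul_assoc, embed_mul_translation]
        simp only [mul_assoc]
      simp only [hG, hΦ]
      rw [h6, averagedIntegrand_eq lam hϖ hw hv χ a ha hd]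
    · rw [Set.indicator_of_notMem hkE]
      rw [setIntegral_congr_fun (isOpen_maximalCompact n).measurableSet (g := fun _ => 0),
        integral_zero]
      intro k'' hk''
      refine hzero _ (mul_mem (embed_mem_maximalCompact hk'') hk) fun h => hkE ⟨hk, fun i => ?_⟩
      rw [← hrow k'' k i]
      exact h.2.2 i
  have hswap := setIntegral_swap_of_continuousOn ν ν' (isCompact_maximalCompact (n + 1))
    (isCompact_maximalCompact n) (f := fun k k'' => G (embed k'' * k))
    (hGc.comp ((continuous_embed.comp continuous_snd).mul continuous_fst)).continuousOn
  have hEm : MeasurableSet (unitRow F n) := (isOpen_unitRow n).measurableSet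
  rw [setIntegral_congr_fun hKm hinner, setIntegral_indicator hEm,
    setIntegral_congr_fun (isOpen_maximalCompact n).measurableSet
      (g := fun _ => ∫ k in K, G k ∂ν) (fun k'' hk'' =>
        setIntegral_mul_left ν (embed_mem_maximalCompact hk'') G),
    setIntegral_const, setIntegral_const, measureReal_def ν', hν', ENNReal.toReal_one, one_smul,
    Set.inter_eq_right.2 (fun k hk => hk.1), ← hmain] at hswap
  have hvol := congrArg ENNReal.toReal (measure_unitRow lam hϖ hnorm hlam ν hν)
  rw [ENNReal.toReal_mul, ENNReal.toReal_pow, ← measureReal_def, ← measureReal_def,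
    ENNReal.toReal_sub_of_le _ ENNReal.one_ne_top] at hvol
  swap
  · refine pow_le_one₀ zero_le (ENNReal.inv_le_one.2 ?_)
    exact_mod_cast hq.le
  have hvol' : (ν.real (unitRow F n) : ℂ) * (1 - ((residueCard F : ℂ) ^ (n + 1))⁻¹) =
      (lam.real (Metric.sphere 0 1) : ℂ) ^ (n + 1) := by
    rw [← Complex.ofReal_pow, ← hvol]
    simp
  have hne : (1 - ((residueCard F : ℂ) ^ (n + 1))⁻¹) ≠ 0 := by
    intro h
    rw [h, mul_zero] at hvol'
    exact pow_ne_zero _ hS0 hvol'.symm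
  rw [Complex.real_smul, ← hvol'] at hswap
  have hE0 : (ν.real (unitRow F n) : ℂ) ≠ 0 := by
    intro h
    rw [h, zero_mul] at hvol'
    exact pow_ne_zero _ hS0 hvol'.symm
  have h8 := mul_left_cancel₀ hE0 (hswap.trans (mul_assoc _ _ _))
  rw [mul_assoc, h8, inv_mul_cancel_left₀ hne]

/-- The compact integrals of the core of the zeta integrand. -/
theorem setIntegral_coreIntegrand (hϖ : IsUniformizer ϖ)
    (hnorm : ‖(ϖ : F)‖ = (residueCard F : ℝ)⁻¹) (hlam : lam (Metric.closedBall 0 1) = 1)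
    (hψ : HasConductorIntegers ψ) (χ : Fˣ →ₜ* ℂˣ) {e : ℕ} (he : 1 ≤ e) (n : ℕ)
    (θ : Fin (n + 1) → (Fˣ →ₜ* ℂˣ)) (w : GL (Fin (n + 1)) F → ℂ) (hw : IsWhittaker ϖ ψ α θ w)
    (θ' : Fin n → (Fˣ →ₜ* ℂˣ)) (v : GL (Fin n) F → ℂ) (hv : IsWhittaker ϖ ψ⁻¹ α θ' v)
    (hcond : ∀ μ ν : Fin n, ν ≤ μ → conductorExp ϖ (twistedChar χ θ θ' μ ν) = e)
    (ν : Measure (GL (Fin n) F)) [ν.IsHaarMeasure]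
    (hν : ν (maximalCompact F n) = 1) (a : Fin n → ℤ) :
    ∫ k in maximalCompact F n, coreIntegrand (ϖ ^ α) w v χ (powGL ϖ a * k) ∂ν =
      if ∀ i, a i = -(e * (n - i : ℤ)) then
        (∏ i : Fin n, (θ i.castSucc (-1) : ℂ)) *
        (∏ μ ∈ Finset.Icc 1 n, (1 - ((residueCard F : ℂ) ^ μ)⁻¹)⁻¹) *
        (∏ μ : Fin n, ∏ ν ∈ Finset.Iic μ, ((χ (ϖ ^ e) : ℂ)⁻¹ *
          unitIntegral lam ψ (twistedChar χ θ θ' μ ν) ((ϖ : F) ^ e)⁻¹)) *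
        w (embed (tMatrix (ϖ ^ α * (ϖ ^ e)⁻¹))) * v (tMatrix (ϖ ^ α * (ϖ ^ e)⁻¹))
      else 0 := by
  induction n with
  | zero =>
    have h1 : ∀ g : GL (Fin 0) F, g = 1 := fun g => Subsingleton.elim _ _
    have h2 : hMatrix F 0 = 1 := by
      apply Units.ext; ext i j; fin_cases i; fin_cases j; simp [hMatrix_val]; rfl
    have h3 : ∀ k : GL (Fin 0) F, coreIntegrand (ϖ ^ α) w v χ (powGL ϖ a * k) =
        w (embed 1) * v 1 := by
      intro k
      rw [coreIntegrand, h1 (powGL ϖ a * k), h1 (tMatrix (ϖ ^ α)), h1 (tMatrix (-ϖ ^ α)), h2,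
        embed_one]
      simp
    simp only [h3]
    rw [setIntegral_const, measureReal_def, hν, h1 (tMatrix (ϖ ^ α * (ϖ ^ e)⁻¹))]
    simp
  | succ n ih =>
    obtain ⟨ν', hν'1, hν'2⟩ := exists_isHaarMeasure_maximalCompact (F := F) n
    rw [setIntegral_coreIntegrand_succ lam hϖ hnorm hlam hψ hw hv χ he
      (fun i => hcond _ _ (Fin.le_last i)) ν hν ν' hν'2 a,
      ih _ _ (hw.restrict_embed _) _ _ (hv.restrict_scalar_embed _)
        (fun μ ν' h => hcond μ.castSucc ν'.castSucc (by simpa using h)) ν' hν'2]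
    have hiff : (∀ i : Fin (n + 1), a i = -(e * ((n + 1 : ℕ) - (i : ℕ) : ℤ))) ↔
        a (Fin.last n) = -e ∧ ∀ i : Fin n, a i.castSucc + e = -(e * ((n : ℤ) - (i : ℕ))) := by
      rw [Fin.forall_fin_succ', and_comm]
      refine and_congr ?_ (forall_congr' fun i => ?_)
      · simp
      · push_cast
        rw [Fin.val_castSucc]
        constructor <;> intro h <;> linear_combination h
    by_cases h : ∀ i : Fin (n + 1), a i = -(e * ((n + 1 : ℕ) - (i : ℕ) : ℤ))
    · rw [if_pos h, if_pos (hiff.1 h).1, if_pos (hiff.1 h).2]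
      have hA : ∏ i : Fin (n + 1), (θ i.castSucc (-1) : ℂ) =
          (∏ i : Fin n, (θ i.castSucc.castSucc (-1) : ℂ)) * (θ (Fin.last n).castSucc (-1) : ℂ) :=
        Fin.prod_univ_castSucc _
      have hB : ∏ μ : Fin (n + 1), ∏ ν ∈ Finset.Iic μ, ((χ (ϖ ^ e) : ℂ)⁻¹ *
          unitIntegral lam ψ (twistedChar χ θ θ' μ ν) ((ϖ : F) ^ e)⁻¹) =
          (∏ μ : Fin n, ∏ ν ∈ Finset.Iic μ, ((χ (ϖ ^ e) : ℂ)⁻¹ *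
            unitIntegral lam ψ (twistedChar χ (fun i => θ i.castSucc) (fun i => θ' i.castSucc) μ ν)
              ((ϖ : F) ^ e)⁻¹)) *
          (((χ (ϖ ^ e) : ℂ)⁻¹) ^ (n + 1) *
            ∏ ν : Fin (n + 1), unitIntegral lam ψ (twistedChar χ θ θ' (Fin.last n) ν)
              ((ϖ : F) ^ e)⁻¹) := by
        have h9 : Finset.Iic (Fin.last n) = Finset.univ := by
          ext i; simp [Fin.le_last]
        rw [Fin.prod_univ_castSucc, h9, Finset.prod_mul_distrib, Finset.prod_const,
          Finset.card_univ, Fintype.card_fin]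
        simp only [Fin.prod_Iic_castSucc]
        rfl
      rw [hA, hB, Finset.prod_Icc_succ_top (by omega : 1 ≤ n + 1)]
      simp only [tMatrix_succ (n := n)]
      ring
    · rw [if_neg h]
      by_cases ha : a (Fin.last n) = -e
      · rw [if_pos ha, if_neg (fun h' => h (hiff.2 ⟨ha, h'⟩)), mul_zero]
      · rw [if_neg ha]

end Key

end LocalBirch

namespace LocalBirch

/-! ### Weil's formula for the quotient measure -/

section Weil

open Measure

variable {G : Type*} [Group G] [MeasurableSpace G] (H : Subgroup G)

theorem measurable_toCoset : Measurable (toCoset H) := measurable_quotient_mk''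

theorem toCoset_mul {h : G} (hh : h ∈ H) (g : G) : toCoset H (h * g) = toCoset H g := by
  refine Quotient.sound ?_
  change QuotientGroup.rightRel H _ _
  rw [QuotientGroup.rightRel_apply, mul_inv_rev, mul_inv_cancel_left]
  exact inv_mem hh

theorem exists_out_eq (g : G) : ∃ h ∈ H, (toCoset H g).out = h * g := by
  have h1 : QuotientGroup.rightRel H (toCoset H g).out g := Quotient.exact (Quotient.out_eq _)
  rw [QuotientGroup.rightRel_apply] at h1
  refine ⟨(toCoset H g).out * g⁻¹, ?_, by group⟩
  have := inv_mem h1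
  rwa [mul_inv_rev, inv_inv] at this

/-- The supremum in the definition of the quotient measure is attained at every function whose
integrals over the cosets are equal to one. -/
theorem quotientMeasure_eq_map [MeasurableMul₂ G] (ν : Measure G) (η : Measure H) [SFinite ν] [SFinite η]
    [ν.IsMulLeftInvariant] [MeasurableInv G] [η.IsInvInvariant] {φ : G → ℝ≥0∞} (hφ : Measurable φ)
    (hφ1 : ∀ g : G, ∫⁻ h : H, φ ((h : G) * g) ∂η = 1) :
    quotientMeasure H ν η = (ν.withDensity φ).map (toCoset H) := by
  refine le_antisymm (iSup_le fun f => iSup_le fun hf => iSup_le fun hf1 => ?_) ?_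
  swap
  · refine le_iSup_of_le φ (le_iSup_of_le hφ (le_iSup_of_le (fun g => (hφ1 g).le) le_rfl))
  rw [Measure.le_iff]
  intro A hA
  have hm := measurable_toCoset H
  rw [map_apply hm hA, map_apply hm hA]
  set B := toCoset H ⁻¹' A with hB
  have hBm : MeasurableSet B := hm hA
  have hBinv : ∀ (h : H) (g : G), ((h : G) * g ∈ B) ↔ g ∈ B := by
    intro h g
    rw [hB, Set.mem_preimage, Set.mem_preimage, toCoset_mul H h.2]
  rw [withDensity_apply _ hBm, withDensity_apply _ hBm]
  have hmul : Measurable fun p : H × G => (p.1 : G) * p.2 :=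
    (measurable_subtype_coe.comp measurable_fst).mul measurable_snd
  have hmul' : Measurable fun p : G × H => (p.2 : G) * p.1 :=
    (measurable_subtype_coe.comp measurable_snd).mul measurable_fst
  have : MeasurableInv H := ⟨(measurable_subtype_coe.inv).subtype_mk⟩
  have hmul2 : Measurable fun p : H × G => ((p.1⁻¹ : H) : G) * p.2 :=
    (measurable_subtype_coe.comp (measurable_fst.inv)).mul measurable_snd
  have hfB : Measurable (B.indicator f) := hf.indicator hBm
  calc ∫⁻ g in B, f g ∂ν
      = ∫⁻ g, B.indicator f g * ∫⁻ h : H, φ ((h : G) * g) ∂η ∂ν := by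
        simp only [hφ1, mul_one]
        rw [lintegral_indicator hBm]
    _ = ∫⁻ g, ∫⁻ h : H, B.indicator f g * φ ((h : G) * g) ∂η ∂ν := by
        congr 1
        ext g
        exact (lintegral_const_mul _ (show Measurable fun h : H => φ ((h : G) * g) from
          hφ.comp (hmul'.comp measurable_prodMk_left))).symm
    _ = ∫⁻ h : H, ∫⁻ g, B.indicator f g * φ ((h : G) * g) ∂ν ∂η := by
        refine lintegral_lintegral_swap ?_
        exact ((hfB.comp measurable_fst).mul (hφ.comp hmul')).aemeasurable
    _ = ∫⁻ h : H, ∫⁻ g, B.indicator f (((h⁻¹ : H) : G) * g) * φ g ∂ν ∂η := by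
        congr 1
        ext h
        rw [← lintegral_mul_left_eq_self
          (fun g => B.indicator f (((h⁻¹ : H) : G) * g) * φ g) (h : G)]
        simp only [Subgroup.coe_inv, inv_mul_cancel_left]
    _ = ∫⁻ g, ∫⁻ h : H, B.indicator f (((h⁻¹ : H) : G) * g) * φ g ∂η ∂ν := by
        refine lintegral_lintegral_swap ?_
        exact ((hfB.comp hmul2).mul (hφ.comp measurable_snd)).aemeasurable
    _ = ∫⁻ g, (∫⁻ h : H, B.indicator f ((h : G) * g) ∂η) * φ g ∂ν := by
        congr 1
        ext g
        rw [lintegral_mul_const _ (show Measurable fun h : H => B.indicator f (((h⁻¹ : H) : G) * g)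
          from hfB.comp (hmul2.comp measurable_prodMk_right)),
          lintegral_inv_eq_self (fun h : H => B.indicator f ((h : G) * g))]
    _ ≤ ∫⁻ g, B.indicator φ g ∂ν := by
        refine lintegral_mono fun g => ?_
        by_cases hg : g ∈ B
        · have h1 : ∀ h : H, B.indicator f ((h : G) * g) = f ((h : G) * g) := fun h =>
            Set.indicator_of_mem ((hBinv h g).2 hg) _
          simp only [h1]
          rw [Set.indicator_of_mem hg]
          exact mul_le_of_le_one_left' (hf1 g)
        · have h1 : ∀ h : H, B.indicator f ((h : G) * g) = 0 := fun h =>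
            Set.indicator_of_notMem (fun h' => hg ((hBinv h g).1 h')) _
          simp [h1]
    _ = ∫⁻ g in B, φ g ∂ν := lintegral_indicator hBm _

end Weil

section Iwasawa

variable {F : Type*} [NontriviallyNormedField F] [IsUltrametricDist F] {ϖ : Fˣ}

/-! ### The Iwasawa decomposition -/

theorem exists_iwasawa (hϖ : IsUniformizer ϖ) {n : ℕ} (g : GL (Fin n) F) :
    ∃ u ∈ unipotent F n, ∃ a : Fin n → ℤ, ∃ k ∈ maximalCompact F n, g = u * powGL ϖ a * k := by
  induction n with
  | zero => exact ⟨1, one_mem _, 0, 1, one_mem _, Subsingleton.elim _ _⟩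
  | succ n ih =>
    set r : Fin (n + 1) → F := fun j =>
      (g : Matrix (Fin (n + 1)) (Fin (n + 1)) F) (Fin.last n) j with hr
    obtain ⟨i₀, -, hi₀⟩ := Finset.exists_max_image Finset.univ (fun i => ‖r i‖)
      ⟨Fin.last n, Finset.mem_univ _⟩
    have hne : r i₀ ≠ 0 := by
      intro h
      have h0 : ∀ j, r j = 0 := fun j => by
        have := hi₀ j (Finset.mem_univ j)
        rw [h, norm_zero] at this
        exact norm_le_zero_iff.1 this
      have := (Matrix.isUnits_det_units g).ne_zero
      exact this (Matrix.det_eq_zero_of_row_eq_zero (Fin.last n) h0)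
    obtain ⟨m, hm⟩ := hϖ.exists_norm_eq hne
    have hp := norm_unit_pos ϖ
    obtain ⟨k₀, hk₀, hk₀r⟩ := exists_last_row (fun j => (ϖ : F) ^ (-m) * r j) (i₀ := i₀)
      (fun j => by
        rw [norm_mul, norm_zpow, zpow_neg, inv_mul_le_iff₀ (zpow_pos hp _), mul_one, ← hm]
        exact hi₀ j (Finset.mem_univ j))
      (by rw [norm_mul, norm_zpow, zpow_neg, hm, inv_mul_cancel₀ (zpow_pos hp _).ne'])
    obtain ⟨g₁, hg₁⟩ : ∃ g₁, g₁ = scalarGL (n + 1) (ϖ ^ (-m)) * g * k₀⁻¹ := ⟨_, rfl⟩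
    have hlast : ∀ j, (g₁ : Matrix (Fin (n + 1)) (Fin (n + 1)) F) (Fin.last n) j =
        if j = Fin.last n then 1 else 0 := by
      intro j
      have h1 : ∀ i, ((scalarGL (n + 1) (ϖ ^ (-m)) * g : GL (Fin (n + 1)) F) :
          Matrix (Fin (n + 1)) (Fin (n + 1)) F) (Fin.last n) i =
          (k₀ : Matrix (Fin (n + 1)) (Fin (n + 1)) F) (Fin.last n) i := by
        intro i
        rw [scalarGL, diagGL_mul_apply, hk₀r]
        simp [hr]
      have h2 : ((k₀ * k₀⁻¹ : GL (Fin (n + 1)) F) : Matrix (Fin (n + 1)) (Fin (n + 1)) F)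
          (Fin.last n) j = if j = Fin.last n then 1 else 0 := by
        rw [mul_inv_cancel, Units.val_one, Matrix.one_apply]
        simp [eq_comm]
      rw [hg₁, ← h2, Units.val_mul, Units.val_mul k₀, Matrix.mul_apply, Matrix.mul_apply]
      simp only [h1]
    obtain ⟨c, g', hg'⟩ := exists_eq_translation_mul_embed g₁
      (fun j => by rw [hlast, if_neg (Fin.castSucc_ne_last j)]) (by rw [hlast, if_pos rfl])
    obtain ⟨u', hu', a', k', hk', hdec⟩ := ih g'
    refine ⟨translation c * embed u', mul_mem (translation_mem_unipotent c)
      (embed_mem_unipotent hu'), Fin.snoc (fun i => a' i + m) m, embed k' * k₀,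
      mul_mem (embed_mem_maximalCompact hk') hk₀, ?_⟩
    have h3 : powGL ϖ (Fin.snoc (fun i => a' i + m) m : Fin (n + 1) → ℤ) =
        scalarGL (n + 1) (ϖ ^ m) * embed (powGL ϖ a') := by
      rw [powGL, diagGL_eq_scalar_mul]
      simp only [Fin.snoc_last, Fin.snoc_castSucc]
      congr 3
      ext i
      rw [zpow_add, mul_comm (ϖ ^ a' i), inv_mul_cancel_left]
    have h4 : g = scalarGL (n + 1) (ϖ ^ m) * g₁ * k₀ := by
      rw [hg₁, ← mul_assoc, ← mul_assoc, ← scalarGL_mul, zpow_neg, mul_inv_cancel, scalarGL,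
        show (fun _ : Fin (n + 1) => (1 : Fˣ)) = 1 from rfl, map_one, one_mul,
        inv_mul_cancel_right]
    rw [h3, h4, hg', hdec, embed_mul, embed_mul, ← mul_assoc (translation c * embed u'),
      ← scalarGL_comm]
    simp only [mul_assoc]

theorem powGL_inv_mul_mul_apply {n : ℕ} (a b : Fin n → ℤ) (u : GL (Fin n) F) (i j : Fin n) :
    (((powGL ϖ a)⁻¹ * u * powGL ϖ b : GL (Fin n) F) : Matrix (Fin n) (Fin n) F) i j =
      (ϖ : F) ^ (b j - a i) * (u : Matrix (Fin n) (Fin n) F) i j := by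
  rw [powGL, powGL, ← map_inv, diagGL_conj_apply]
  simp only [Pi.inv_apply, Units.val_inv_eq_inv_val, Units.val_zpow_eq_zpow_val]
  rw [zpow_sub₀ ϖ.ne_zero, div_eq_inv_mul]
  ring

theorem iwasawa_unique (hϖ : IsUniformizer ϖ) {n : ℕ} {a b : Fin n → ℤ} {u : GL (Fin n) F}
    (hu : u ∈ unipotent F n) (h : (powGL ϖ a)⁻¹ * u * powGL ϖ b ∈ maximalCompact F n) : a = b := by
  have key : ∀ (a b : Fin n → ℤ) (u : GL (Fin n) F), u ∈ unipotent F n →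
      (powGL ϖ a)⁻¹ * u * powGL ϖ b ∈ maximalCompact F n → ∀ i, a i ≤ b i := by
    intro a b u hu h i
    have h1 := norm_entry_le_one h i i
    rw [powGL_inv_mul_mul_apply, hu.2 i, mul_one, norm_zpow, ← zpow_zero ‖(ϖ : F)‖,
      hϖ.zpow_le_zpow_iff] at h1
    omega
  refine funext fun i => le_antisymm (key a b u hu h i) (key b a u⁻¹ (inv_mem hu) ?_ i)
  have := inv_mem h
  rwa [mul_inv_rev, mul_inv_rev, inv_inv, ← mul_assoc] at this

/-- The subgroup of the elements `u` of `U_n(F)` such that `a⁻¹ u a` is integral, for a diagonal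
matrix `a` of powers of `ϖ`. -/
noncomputable def latticeUnipotent (ϖ : Fˣ) {n : ℕ} (a : Fin n → ℤ) : Subgroup (unipotent F n) :=
  ((maximalCompact F n).comap (MulAut.conj (powGL ϖ a)⁻¹).toMonoidHom).comap
    (unipotent F n).subtype

theorem mem_latticeUnipotent {n : ℕ} (a : Fin n → ℤ) (u : unipotent F n) :
    u ∈ latticeUnipotent ϖ a ↔
      (powGL ϖ a)⁻¹ * (u : GL (Fin n) F) * powGL ϖ a ∈ maximalCompact F n := by
  rw [latticeUnipotent, Subgroup.mem_comap, Subgroup.mem_comap]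
  simp

theorem mem_latticeUnipotent_iff {n : ℕ} (a : Fin n → ℤ) (u : unipotent F n) :
    u ∈ latticeUnipotent ϖ a ↔ ∀ i j : Fin n, i < j →
      ‖((u : GL (Fin n) F) : Matrix (Fin n) (Fin n) F) i j‖ ≤ ‖(ϖ : F)‖ ^ (a i - a j) := by
  have hp := norm_unit_pos ϖ
  have hdet : ‖(Matrix.GeneralLinearGroup.det ((powGL ϖ a)⁻¹ * (u : GL (Fin n) F) * powGL ϖ a) :
      F)‖ = 1 := by
    rw [map_mul, map_mul, det_eq_one_of_mem_unipotent u.2, map_inv]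
    simp
  have hiff : ∀ i j : Fin n, ‖(ϖ : F) ^ (a j - a i) *
      ((u : GL (Fin n) F) : Matrix (Fin n) (Fin n) F) i j‖ ≤ 1 ↔
      ‖((u : GL (Fin n) F) : Matrix (Fin n) (Fin n) F) i j‖ ≤ ‖(ϖ : F)‖ ^ (a i - a j) := by
    intro i j
    rw [norm_mul, norm_zpow, ← neg_sub (a i) (a j), zpow_neg, inv_mul_le_iff₀ (zpow_pos hp _),
      mul_one]
  rw [mem_latticeUnipotent, mem_maximalCompact_iff]
  simp only [powGL_inv_mul_mul_apply, hiff, hdet, and_true]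
  refine ⟨fun h i j _ => h i j, fun h i j => ?_⟩
  rcases lt_trichotomy i j with hij | rfl | hij
  · exact h i j hij
  · rw [u.2.2 i]; simp
  · rw [u.2.1 hij, norm_zero]
    exact (zpow_pos hp _).le

theorem isClosed_unipotent (n : ℕ) : IsClosed (unipotent F n : Set (GL (Fin n) F)) := by
  have : (unipotent F n : Set (GL (Fin n) F)) =
      (⋂ i, ⋂ j, ⋂ _ : j < i, (fun g : GL (Fin n) F => (g : Matrix (Fin n) (Fin n) F) i j) ⁻¹' {0}) ∩
      ⋂ i, (fun g : GL (Fin n) F => (g : Matrix (Fin n) (Fin n) F) i i) ⁻¹' {1} := by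
    ext g
    simp only [SetLike.mem_coe, Set.mem_inter_iff, Set.mem_iInter, Set.mem_preimage,
      Set.mem_singleton_iff]
    exact ⟨fun h => ⟨fun i j hij => h.1 hij, h.2⟩, fun h => ⟨fun i j hij => h.1 i j hij, h.2⟩⟩
  rw [this]
  exact (isClosed_iInter fun i => isClosed_iInter fun j => isClosed_iInter fun _ =>
    isClosed_singleton.preimage (continuous_entry i j)).inter
    (isClosed_iInter fun i => isClosed_singleton.preimage (continuous_entry i i))

theorem continuous_conj_powGL {n : ℕ} (a : Fin n → ℤ) :
    Continuous fun g : GL (Fin n) F => (powGL ϖ a)⁻¹ * g * powGL ϖ a :=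
  (continuous_mul_const _).comp (continuous_const_mul _)

theorem isOpen_latticeUnipotent {n : ℕ} (a : Fin n → ℤ) :
    IsOpen (latticeUnipotent ϖ a : Set (unipotent F n)) := by
  have : (latticeUnipotent ϖ a : Set (unipotent F n)) =
      (fun u : unipotent F n => (powGL ϖ a)⁻¹ * (u : GL (Fin n) F) * powGL ϖ a) ⁻¹'
        (maximalCompact F n) := by
    ext u
    exact mem_latticeUnipotent a u
  rw [this]
  exact (isOpen_maximalCompact n).preimage ((continuous_conj_powGL a).comp continuous_subtype_val)

theorem exists_mem_latticeUnipotent (hϖ : IsUniformizer ϖ) {n : ℕ} (u : unipotent F n) :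
    ∃ a : Fin n → ℤ, u ∈ latticeUnipotent ϖ a := by
  have hp := norm_unit_pos ϖ
  have h1 : ∀ i j : Fin n, ∀ᶠ M : ℕ in Filter.atTop, ‖(ϖ : F)‖ ^ M *
      ‖((u : GL (Fin n) F) : Matrix (Fin n) (Fin n) F) i j‖ ≤ 1 := by
    intro i j
    have h2 := (tendsto_pow_atTop_nhds_zero_of_lt_one hp.le hϖ.norm_lt_one).mul_const
      ‖((u : GL (Fin n) F) : Matrix (Fin n) (Fin n) F) i j‖
    rw [zero_mul] at h2
    exact (h2.eventually (gt_mem_nhds one_pos)).mono fun _ h => h.le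
  obtain ⟨M, hM⟩ := (Filter.eventually_all.2 fun i => Filter.eventually_all.2 (h1 i)).exists
  refine ⟨fun i => M * (i : ℕ), (mem_latticeUnipotent_iff _ _).2 fun i j hij => ?_⟩
  have h3 : ‖((u : GL (Fin n) F) : Matrix (Fin n) (Fin n) F) i j‖ ≤ ‖(ϖ : F)‖ ^ (-(M : ℤ)) := by
    rw [zpow_neg, zpow_natCast, ← one_div, le_div_iff₀ (pow_pos hp _), mul_comm]
    exact hM i j
  refine h3.trans (hϖ.zpow_le_zpow_iff.2 ?_)
  have h4 : (1 : ℤ) ≤ (j : ℕ) - (i : ℕ) := by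
    have : (i : ℕ) < j := hij
    omega
  nlinarith [Int.natCast_nonneg M]

section Proper

variable [ProperSpace F]

theorem isCompact_latticeUnipotent {n : ℕ} (a : Fin n → ℤ) :
    IsCompact (latticeUnipotent ϖ a : Set (unipotent F n)) := by
  have h1 : IsCompact ((fun k => powGL ϖ a * k * (powGL ϖ a)⁻¹) ''
      (maximalCompact F n : Set (GL (Fin n) F))) :=
    (isCompact_maximalCompact n).image ((continuous_mul_const _).comp (continuous_const_mul _))
  have h2 := (isClosed_unipotent n).isClosedEmbedding_subtypeVal.isCompact_preimage h1
  refine (congrArg IsCompact (Set.ext fun u => ?_)).mpr h2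
  rw [SetLike.mem_coe, mem_latticeUnipotent]
  constructor
  · intro h
    exact ⟨_, h, by group⟩
  · rintro ⟨k, hk, hku⟩
    rw [← hku]
    have h3 : (powGL ϖ a)⁻¹ * (powGL ϖ a * k * (powGL ϖ a)⁻¹) * powGL ϖ a = k := by group
    change (powGL ϖ a)⁻¹ * (powGL ϖ a * k * (powGL ϖ a)⁻¹) * powGL ϖ a ∈ maximalCompact F n
    rw [h3]
    exact hk

instance (n : ℕ) : SecondCountableTopology (unipotent F n) :=
  TopologicalSpace.Subtype.secondCountableTopology _

instance (n : ℕ) : LocallyCompactSpace (unipotent F n) :=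
  (isClosed_unipotent n).isClosedEmbedding_subtypeVal.locallyCompactSpace

theorem isMulRightInvariant_unipotent (hϖ : IsUniformizer ϖ) {n : ℕ} (η : Measure (unipotent F n))
    [η.IsHaarMeasure] : η.IsMulRightInvariant :=
  isMulRightInvariant_of_compact_union η fun u =>
    let ⟨a, ha⟩ := exists_mem_latticeUnipotent hϖ u
    ⟨_, isOpen_latticeUnipotent a, isCompact_latticeUnipotent a, ha⟩

theorem isInvInvariant_unipotent (hϖ : IsUniformizer ϖ) {n : ℕ} (η : Measure (unipotent F n))
    [η.IsHaarMeasure] : η.IsInvInvariant :=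
  isInvInvariant_of_compact_union η fun u =>
    let ⟨a, ha⟩ := exists_mem_latticeUnipotent hϖ u
    ⟨_, isOpen_latticeUnipotent a, isCompact_latticeUnipotent a, ha⟩

theorem measure_latticeUnipotent_ne_zero {n : ℕ} (η : Measure (unipotent F n)) [η.IsHaarMeasure]
    (a : Fin n → ℤ) : η (latticeUnipotent ϖ a) ≠ 0 :=
  ((isOpen_latticeUnipotent a).measure_pos η ⟨1, one_mem _⟩).ne'

theorem measure_latticeUnipotent_ne_top {n : ℕ} (η : Measure (unipotent F n)) [η.IsHaarMeasure]
    (a : Fin n → ℤ) : η (latticeUnipotent ϖ a) ≠ ∞ :=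
  (isCompact_latticeUnipotent a).measure_ne_top

/-- The set `a K`, where `K` is the maximal compact subgroup. -/
def cell (ϖ : Fˣ) {n : ℕ} (a : Fin n → ℤ) : Set (GL (Fin n) F) :=
  (fun g => (powGL ϖ a)⁻¹ * g) ⁻¹' maximalCompact F n

theorem measurableSet_cell {n : ℕ} (a : Fin n → ℤ) :
    MeasurableSet (cell ϖ a : Set (GL (Fin n) F)) :=
  ((isOpen_maximalCompact n).preimage (continuous_const_mul _)).measurableSet

theorem isCompact_cell {n : ℕ} (a : Fin n → ℤ) : IsCompact (cell ϖ a : Set (GL (Fin n) F)) :=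
  (Homeomorph.mulLeft (powGL ϖ a)⁻¹).isCompact_preimage.2 (isCompact_maximalCompact n)

theorem disjoint_cell (hϖ : IsUniformizer ϖ) {n : ℕ} {a b : Fin n → ℤ} (h : a ≠ b) :
    Disjoint (cell ϖ a : Set (GL (Fin n) F)) (cell ϖ b) := by
  rw [Set.disjoint_left]
  intro g (hg : (powGL ϖ a)⁻¹ * g ∈ maximalCompact F n)
    (hg' : (powGL ϖ b)⁻¹ * g ∈ maximalCompact F n)
  refine h (iwasawa_unique hϖ (one_mem _) ?_)
  have := mul_mem hg (inv_mem hg')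
  rwa [mul_inv_rev, inv_inv, mul_assoc, mul_inv_cancel_left, ← mul_one (powGL ϖ a)⁻¹] at this

/-- A function on `GL_n(F)` whose integrals over the cosets of `U_n(F)` are equal to one. -/
noncomputable def cosetDensity (ϖ : Fˣ) {n : ℕ} (η : Measure (unipotent F n)) (g : GL (Fin n) F) :
    ℝ≥0∞ :=
  ∑' a : Fin n → ℤ, (cell ϖ a).indicator (fun _ => (η (latticeUnipotent ϖ a))⁻¹) g

theorem measurable_cosetDensity {n : ℕ} (η : Measure (unipotent F n)) :
    Measurable (cosetDensity ϖ η) :=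
  Measurable.tsum fun a => measurable_const.indicator (measurableSet_cell a)

theorem lintegral_cosetDensity (hϖ : IsUniformizer ϖ) {n : ℕ} (η : Measure (unipotent F n))
    [η.IsHaarMeasure] (g : GL (Fin n) F) :
    ∫⁻ u : unipotent F n, cosetDensity ϖ η ((u : GL (Fin n) F) * g) ∂η = 1 := by
  have := isMulRightInvariant_unipotent hϖ η
  obtain ⟨u₀, hu₀, b, k₀, hk₀, hg⟩ := exists_iwasawa hϖ g
  have hm : Measurable fun u : unipotent F n => (u : GL (Fin n) F) * g :=
    ((continuous_mul_const g).comp continuous_subtype_val).measurable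
  unfold cosetDensity
  rw [lintegral_tsum fun a => (show Measurable fun u : unipotent F n => (cell ϖ a).indicator
    (fun _ => (η (latticeUnipotent ϖ a))⁻¹) ((u : GL (Fin n) F) * g) from
      (measurable_const.indicator (measurableSet_cell a)).comp hm).aemeasurable]
  have h1 : ∀ (a : Fin n → ℤ) (u : unipotent F n), (u : GL (Fin n) F) * g ∈ cell ϖ a ↔
      (powGL ϖ a)⁻¹ * ((u * ⟨u₀, hu₀⟩ : unipotent F n) : GL (Fin n) F) * powGL ϖ b ∈
        maximalCompact F n := by
    intro a u
    rw [cell, Set.mem_preimage, SetLike.mem_coe, hg, ← mul_assoc, ← mul_assoc,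
      (maximalCompact F n).mul_mem_cancel_right hk₀]
    simp only [Subgroup.coe_mul, mul_assoc]
  have h2 : ∀ a : Fin n → ℤ, ∫⁻ u : unipotent F n, (cell ϖ a).indicator
      (fun _ => (η (latticeUnipotent ϖ a))⁻¹) ((u : GL (Fin n) F) * g) ∂η =
      if a = b then 1 else 0 := by
    intro a
    have h3 : ∀ u : unipotent F n, (cell ϖ a).indicator
        (fun _ => (η (latticeUnipotent ϖ a))⁻¹) ((u : GL (Fin n) F) * g) =
        ((fun u : unipotent F n => (u : GL (Fin n) F) * g) ⁻¹' cell ϖ a).indicator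
          (fun _ => (η (latticeUnipotent ϖ a))⁻¹) u := fun u => rfl
    simp only [h3]
    rw [lintegral_indicator_const (hm (measurableSet_cell a))]
    split_ifs with hab
    · subst hab
      have h4 : (fun u : unipotent F n => (u : GL (Fin n) F) * g) ⁻¹' cell ϖ a =
          (fun u => u * ⟨u₀, hu₀⟩) ⁻¹' (latticeUnipotent ϖ a) := by
        ext u
        rw [Set.mem_preimage, h1, Set.mem_preimage, SetLike.mem_coe, mem_latticeUnipotent]
      rw [h4, measure_preimage_mul_right]
      exact ENNReal.inv_mul_cancel (measure_latticeUnipotent_ne_zero η a)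
        (measure_latticeUnipotent_ne_top η a)
    · have h4 : (fun u : unipotent F n => (u : GL (Fin n) F) * g) ⁻¹' cell ϖ a = ∅ := by
        ext u
        rw [Set.mem_preimage, h1, Set.mem_empty_iff_false, iff_false]
        exact fun h => hab (iwasawa_unique hϖ (SetLike.coe_mem _) h)
      rw [h4, measure_empty, mul_zero]
  simp only [h2]
  rw [tsum_ite_eq]

theorem quotientMeasure_unipotent (hϖ : IsUniformizer ϖ) {n : ℕ} (ν : Measure (GL (Fin n) F))
    [ν.IsHaarMeasure] (η : Measure (unipotent F n)) [η.IsHaarMeasure] :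
    quotientMeasure (unipotent F n) ν η =
      (ν.withDensity (cosetDensity ϖ η)).map (toCoset (unipotent F n)) := by
  have := isInvInvariant_unipotent hϖ η
  exact quotientMeasure_eq_map _ ν η (measurable_cosetDensity η) (lintegral_cosetDensity hϖ η)

theorem withDensity_restrict_cell (hϖ : IsUniformizer ϖ) {n : ℕ} (ν : Measure (GL (Fin n) F))
    (η : Measure (unipotent F n)) (a : Fin n → ℤ) :
    (ν.withDensity (cosetDensity ϖ η)).restrict (cell ϖ a) =
      (η (latticeUnipotent ϖ a))⁻¹ • ν.restrict (cell ϖ a) := by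
  rw [restrict_withDensity (measurableSet_cell a), ← withDensity_const]
  refine withDensity_congr_ae ?_
  filter_upwards [ae_restrict_mem (measurableSet_cell a)] with g hg
  rw [cosetDensity, tsum_eq_single a]
  · rw [Set.indicator_of_mem hg]
  · intro b hb
    exact Set.indicator_of_notMem (fun h => Set.disjoint_left.1 (disjoint_cell hϖ hb) h hg) _

end Proper

end Iwasawa

end LocalBirch

namespace LocalBirch

/-! ### The Haar measure of `U_n(F)` in coordinates -/

section Coordinates

variable {F : Type*} [NontriviallyNormedField F] [IsUltrametricDist F] {ϖ : Fˣ} {n : ℕ}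

/-- The positions above the diagonal. -/
abbrev UpperIndex (n : ℕ) : Type := {p : Fin n × Fin n // p.1 < p.2}

/-- The strictly upper triangular matrix with the given entries above the diagonal. -/
def strictUpper (x : UpperIndex n → F) : Matrix (Fin n) (Fin n) F :=
  Matrix.of fun i j => if h : i < j then x ⟨(i, j), h⟩ else 0

theorem strictUpper_of_lt (x : UpperIndex n → F) {i j : Fin n} (h : i < j) :
    strictUpper x i j = x ⟨(i, j), h⟩ := dif_pos h

theorem strictUpper_of_le (x : UpperIndex n → F) {i j : Fin n} (h : j ≤ i) :
    strictUpper x i j = 0 := dif_neg h.not_gt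

theorem strictUpper_add (x y : UpperIndex n → F) :
    strictUpper (x + y) = strictUpper x + strictUpper y := by
  ext i j
  by_cases h : i < j
  · simp [strictUpper, h]
  · simp [strictUpper, h]

theorem continuous_strictUpper :
    Continuous (strictUpper : (UpperIndex n → F) → Matrix (Fin n) (Fin n) F) := by
  refine continuous_matrix fun i j => ?_
  by_cases h : i < j
  · simpa only [strictUpper_of_lt _ h] using continuous_apply _
  · simpa only [strictUpper_of_le _ (not_lt.1 h)] using continuous_const

theorem det_one_add_strictUpper (x : UpperIndex n → F) : (1 + strictUpper x).det = 1 := by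
  rw [Matrix.det_of_isUpperTriangular]
  · exact Finset.prod_eq_one fun i _ => by simp [strictUpper_of_le x le_rfl]
  · intro i j (hij : j < i)
    simp [strictUpper_of_le x hij.le, Matrix.one_apply_ne hij.ne']

/-- The unipotent matrix with the given entries above the diagonal. -/
def unipotentOfCoord (x : UpperIndex n → F) : unipotent F n :=
  ⟨Matrix.GeneralLinearGroup.mkOfDetNeZero (1 + strictUpper x) (by
    rw [det_one_add_strictUpper]
    exact one_ne_zero), by
    refine ⟨fun i j (hij : j < i) => ?_, fun i => ?_⟩
    · change (1 + strictUpper x) i j = 0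
      simp [strictUpper_of_le x hij.le, Matrix.one_apply_ne hij.ne']
    · change (1 + strictUpper x) i i = 1
      simp [strictUpper_of_le x le_rfl]⟩

theorem coe_unipotentOfCoord (x : UpperIndex n → F) :
    ((unipotentOfCoord x : GL (Fin n) F) : Matrix (Fin n) (Fin n) F) = 1 + strictUpper x := rfl

/-- The entries above the diagonal. -/
def coordOfUnipotent (u : unipotent F n) (p : UpperIndex n) : F :=
  ((u : GL (Fin n) F) : Matrix (Fin n) (Fin n) F) p.1.1 p.1.2

theorem coordOfUnipotent_unipotentOfCoord (x : UpperIndex n → F) :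
    coordOfUnipotent (unipotentOfCoord x) = x := by
  ext ⟨⟨i, j⟩, h⟩
  have h' : i < j := h
  rw [coordOfUnipotent, coe_unipotentOfCoord, Matrix.add_apply, Matrix.one_apply_ne h'.ne, zero_add,
    strictUpper_of_lt x h']

theorem unipotentOfCoord_coordOfUnipotent (u : unipotent F n) :
    unipotentOfCoord (coordOfUnipotent u) = u := by
  refine Subtype.ext (Units.ext (Matrix.ext fun i j => ?_))
  rw [coe_unipotentOfCoord, Matrix.add_apply]
  rcases lt_trichotomy i j with h | rfl | h
  · rw [Matrix.one_apply_ne h.ne, zero_add, strictUpper_of_lt _ h, coordOfUnipotent]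
  · rw [Matrix.one_apply_eq, strictUpper_of_le _ le_rfl, add_zero, u.2.2]
  · rw [Matrix.one_apply_ne h.ne', strictUpper_of_le _ h.le, add_zero, u.2.1 h]

theorem continuous_coordOfUnipotent :
    Continuous (coordOfUnipotent : unipotent F n → UpperIndex n → F) :=
  continuous_pi fun p => (continuous_entry p.1.1 p.1.2).comp continuous_subtype_val

theorem continuous_unipotentOfCoord :
    Continuous (unipotentOfCoord : (UpperIndex n → F) → unipotent F n) := by
  have h1 : Continuous fun x : UpperIndex n → F => 1 + strictUpper x :=
    continuous_const.add continuous_strictUpper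
  refine Continuous.subtype_mk ?_ _
  rw [Units.continuous_iff]
  refine ⟨h1, ?_⟩
  have h2 : ∀ x : UpperIndex n → F, (((unipotentOfCoord x : GL (Fin n) F)⁻¹ : GL (Fin n) F) :
      Matrix (Fin n) (Fin n) F) = (1 + strictUpper x).adjugate := by
    intro x
    rw [Matrix.coe_units_inv, Matrix.inv_def, coe_unipotentOfCoord, det_one_add_strictUpper]
    simp
  exact h1.matrix_adjugate.congr fun x => (h2 x).symm

/-- Multiplication by `u` from the left in coordinates, up to a translation. -/
def unipotentLinear (u : unipotent F n) (x : UpperIndex n → F) (p : UpperIndex n) : F :=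
  (((u : GL (Fin n) F) : Matrix (Fin n) (Fin n) F) * strictUpper x) p.1.1 p.1.2

theorem coordOfUnipotent_mul (u : unipotent F n) (x : UpperIndex n → F) :
    coordOfUnipotent (u * unipotentOfCoord x) = coordOfUnipotent u + unipotentLinear u x := by
  ext p
  rw [coordOfUnipotent, Subgroup.coe_mul, Units.val_mul, coe_unipotentOfCoord, mul_add, mul_one]
  rfl

theorem unipotentLinear_add (u : unipotent F n) (x y : UpperIndex n → F) :
    unipotentLinear u (x + y) = unipotentLinear u x + unipotentLinear u y := by
  ext p
  simp only [unipotentLinear, strictUpper_add, mul_add, Matrix.add_apply, Pi.add_apply]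

theorem strictUpper_unipotentLinear (u : unipotent F n) (x : UpperIndex n → F) :
    strictUpper (unipotentLinear u x) =
      ((u : GL (Fin n) F) : Matrix (Fin n) (Fin n) F) * strictUpper x := by
  ext i j
  rcases lt_or_ge i j with h | h
  · rw [strictUpper_of_lt _ h, unipotentLinear]
  · rw [strictUpper_of_le _ h, Matrix.mul_apply]
    refine (Finset.sum_eq_zero fun k _ => ?_).symm
    rcases lt_or_ge k i with hk | hk
    · rw [u.2.1 hk, zero_mul]
    · rw [strictUpper_of_le _ (h.trans hk), mul_zero]

theorem unipotentLinear_mul (u u' : unipotent F n) (x : UpperIndex n → F) :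
    unipotentLinear u (unipotentLinear u' x) = unipotentLinear (u * u') x := by
  ext p
  rw [unipotentLinear, strictUpper_unipotentLinear, unipotentLinear, Subgroup.coe_mul,
    Units.val_mul, mul_assoc]

theorem unipotentLinear_one (x : UpperIndex n → F) :
    unipotentLinear (1 : unipotent F n) x = x := by
  ext p
  rw [unipotentLinear, Subgroup.coe_one, Units.val_one, one_mul, strictUpper_of_lt x p.2]

theorem continuous_unipotentLinear (u : unipotent F n) : Continuous (unipotentLinear u) :=
  continuous_pi fun _ => (continuous_const.matrix_mul continuous_strictUpper).matrix_elem _ _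

/-- Multiplication by `u` as an automorphism of the group of strictly upper triangular
matrices. -/
def unipotentLinearEquiv (u : unipotent F n) : (UpperIndex n → F) ≃+ (UpperIndex n → F) where
  toFun := unipotentLinear u
  invFun := unipotentLinear u⁻¹
  left_inv x := by rw [unipotentLinear_mul, inv_mul_cancel, unipotentLinear_one]
  right_inv x := by rw [unipotentLinear_mul, mul_inv_cancel, unipotentLinear_one]
  map_add' := unipotentLinear_add u

theorem preimage_latticeUnipotent (a : Fin n → ℤ) :
    (unipotentOfCoord : (UpperIndex n → F) → unipotent F n) ⁻¹' (latticeUnipotent ϖ a) =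
      Set.univ.pi fun p : UpperIndex n =>
        Metric.closedBall (0 : F) (‖(ϖ : F)‖ ^ (a p.1.1 - a p.1.2)) := by
  ext x
  rw [Set.mem_preimage, SetLike.mem_coe, mem_latticeUnipotent_iff, Set.mem_univ_pi]
  have h1 : ∀ p : UpperIndex n, ((unipotentOfCoord x : GL (Fin n) F) :
      Matrix (Fin n) (Fin n) F) p.1.1 p.1.2 = x p := fun p =>
    congrFun (coordOfUnipotent_unipotentOfCoord x) p
  constructor
  · intro h p
    rw [mem_closedBall_zero_iff, ← h1]
    exact h _ _ p.2
  · intro h i j hij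
    rw [h1 ⟨(i, j), hij⟩]
    exact mem_closedBall_zero_iff.1 (h ⟨(i, j), hij⟩)

theorem add_mem_preimage_latticeUnipotent {a : Fin n → ℤ} {x y : UpperIndex n → F}
    (hx : unipotentOfCoord x ∈ latticeUnipotent ϖ a) :
    unipotentOfCoord (x + y) ∈ latticeUnipotent ϖ a ↔
      unipotentOfCoord y ∈ latticeUnipotent ϖ a := by
  have key : ∀ {x y : UpperIndex n → F}, unipotentOfCoord x ∈ latticeUnipotent ϖ a →
      unipotentOfCoord y ∈ latticeUnipotent ϖ a →
      unipotentOfCoord (x + y) ∈ latticeUnipotent ϖ a := by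
    intro x y hx hy
    have hx' := (preimage_latticeUnipotent (ϖ := ϖ) a).subset hx
    have hy' := (preimage_latticeUnipotent (ϖ := ϖ) a).subset hy
    refine (preimage_latticeUnipotent (ϖ := ϖ) a).superset fun p hp => ?_
    have h1 := mem_closedBall_zero_iff.1 (hx' p hp)
    have h2 := mem_closedBall_zero_iff.1 (hy' p hp)
    exact mem_closedBall_zero_iff.2
      ((IsUltrametricDist.norm_add_le_max _ _).trans (max_le h1 h2))
  have hneg : unipotentOfCoord (-x) ∈ latticeUnipotent ϖ a := by
    have hx' := (preimage_latticeUnipotent (ϖ := ϖ) a).subset hx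
    refine (preimage_latticeUnipotent (ϖ := ϖ) a).superset fun p hp => ?_
    have h1 := hx' p hp
    rw [mem_closedBall_zero_iff] at h1 ⊢
    rwa [Pi.neg_apply, norm_neg]
  refine ⟨fun h => ?_, key hx⟩
  have := key hneg h
  rwa [neg_add_cancel_left] at this

variable [ProperSpace F] [MeasurableSpace F] [BorelSpace F] (lam : Measure F) [lam.IsAddHaarMeasure]

theorem map_unipotentLinear (hϖ : IsUniformizer ϖ) (u : unipotent F n) :
    (Measure.pi fun _ : UpperIndex n => lam).map (unipotentLinear u) =
      Measure.pi fun _ : UpperIndex n => lam := by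
  have : ((Measure.pi fun _ : UpperIndex n => lam).map (unipotentLinear u)).IsAddHaarMeasure :=
    (unipotentLinearEquiv u).isAddHaarMeasure_map _ (continuous_unipotentLinear u)
      (continuous_unipotentLinear u⁻¹)
  obtain ⟨a, ha⟩ := exists_mem_latticeUnipotent hϖ u
  have ho := (isOpen_latticeUnipotent (F := F) (ϖ := ϖ) a).preimage continuous_unipotentOfCoord
  refine isAddHaarMeasure_eq_of_apply_eq _ _ (unipotentOfCoord ⁻¹' (latticeUnipotent ϖ a)) ?_ ?_ ?_
  · refine (ho.measure_pos _ ⟨0, ?_⟩).ne'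
    rw [Set.mem_preimage, SetLike.mem_coe, mem_latticeUnipotent_iff]
    intro i j hij
    rw [coe_unipotentOfCoord, Matrix.add_apply, strictUpper_of_lt _ hij,
      Matrix.one_apply_ne hij.ne, Pi.zero_apply, add_zero, norm_zero]
    exact (zpow_pos (norm_unit_pos ϖ) _).le
  · rw [preimage_latticeUnipotent]
    exact (isCompact_univ_pi fun p => isCompact_closedBall _ _).measure_ne_top
  · rw [Measure.map_apply (continuous_unipotentLinear u).measurable ho.measurableSet]
    congr 1
    ext x
    have h1 : unipotentOfCoord (coordOfUnipotent u) ∈ latticeUnipotent ϖ a := by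
      rwa [unipotentOfCoord_coordOfUnipotent]
    rw [Set.mem_preimage, Set.mem_preimage, SetLike.mem_coe, Set.mem_preimage, SetLike.mem_coe,
      ← add_mem_preimage_latticeUnipotent h1, ← coordOfUnipotent_mul,
      unipotentOfCoord_coordOfUnipotent]
    exact (latticeUnipotent ϖ a).mul_mem_cancel_left ha

theorem haar_unipotent_eq (hϖ : IsUniformizer ϖ) (hlam : lam (Metric.closedBall 0 1) = 1)
    (η : Measure (unipotent F n)) [η.IsHaarMeasure]
    (hη : η {u | (u : GL (Fin n) F) ∈ maximalCompact F n} = 1) :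
    η = (Measure.pi fun _ : UpperIndex n => lam).map unipotentOfCoord := by
  set μ := (Measure.pi fun _ : UpperIndex n => lam).map unipotentOfCoord with hμ
  have hc := (continuous_unipotentOfCoord (F := F) (n := n)).measurable
  have h1 : μ.IsMulLeftInvariant := by
    refine ⟨fun u => ?_⟩
    have h2 : (fun x : UpperIndex n → F => u * unipotentOfCoord x) =
        unipotentOfCoord ∘ (fun x => coordOfUnipotent u + x) ∘ unipotentLinear u := by
      ext1 x
      simp only [Function.comp_apply]
      rw [← coordOfUnipotent_mul, unipotentOfCoord_coordOfUnipotent]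
    rw [hμ, Measure.map_map (measurable_const_mul u) hc]
    change Measure.map (fun x : UpperIndex n → F => u * unipotentOfCoord x) _ = _
    rw [h2, ← Measure.map_map hc ((measurable_const_add _).comp
      (continuous_unipotentLinear u).measurable), ← Measure.map_map (measurable_const_add _)
      (continuous_unipotentLinear u).measurable, map_unipotentLinear lam hϖ,
      map_add_left_eq_self]
  have h3 : IsFiniteMeasureOnCompacts μ := by
    refine ⟨fun K hK => ?_⟩
    rw [hμ, Measure.map_apply hc hK.measurableSet]
    have : unipotentOfCoord ⁻¹' K = coordOfUnipotent '' K := by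
      ext x
      refine ⟨fun h => ⟨_, h, coordOfUnipotent_unipotentOfCoord x⟩, ?_⟩
      rintro ⟨u, hu, rfl⟩
      rwa [Set.mem_preimage, unipotentOfCoord_coordOfUnipotent]
    rw [this]
    exact (hK.image continuous_coordOfUnipotent).measure_lt_top
  have h4 := Measure.isMulLeftInvariant_eq_smul μ η
  have h0 : {u : unipotent F n | (u : GL (Fin n) F) ∈ maximalCompact F n} =
      (latticeUnipotent ϖ (0 : Fin n → ℤ) : Set (unipotent F n)) := by
    ext u
    rw [SetLike.mem_coe, mem_latticeUnipotent, powGL]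
    simp [← Pi.one_def]
  have h5 : μ {u | (u : GL (Fin n) F) ∈ maximalCompact F n} = 1 := by
    rw [h0, hμ, Measure.map_apply hc (isOpen_latticeUnipotent _).measurableSet,
      preimage_latticeUnipotent, Measure.pi_pi]
    simp [hlam]
  rw [h4, Measure.smul_apply, hη, ENNReal.smul_def, smul_eq_mul, mul_one] at h5
  have h6 : Measure.haarScalarFactor μ η = 1 := by exact_mod_cast h5
  rw [h4, h6, one_smul]

theorem measure_latticeUnipotent (hϖ : IsUniformizer ϖ)
    (hnorm : ‖(ϖ : F)‖ = (residueCard F : ℝ)⁻¹) (hlam : lam (Metric.closedBall 0 1) = 1)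
    (η : Measure (unipotent F n)) [η.IsHaarMeasure]
    (hη : η {u | (u : GL (Fin n) F) ∈ maximalCompact F n} = 1) (e : ℕ) :
    η (latticeUnipotent ϖ fun i : Fin n => -(e * (n - i : ℤ))) =
      (residueCard F : ℝ≥0∞) ^ (e * ∑ p : UpperIndex n, ((p.1.2 : ℕ) - (p.1.1 : ℕ))) := by
  rw [haar_unipotent_eq lam hϖ hlam η hη, Measure.map_apply continuous_unipotentOfCoord.measurable
    (isOpen_latticeUnipotent _).measurableSet, preimage_latticeUnipotent, Measure.pi_pi,
    Finset.mul_sum, ← Finset.prod_pow_eq_pow_sum]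
  refine Finset.prod_congr rfl fun p _ => ?_
  rw [← measure_closedBall_inv_pow lam hϖ hnorm hlam]
  have h1 : (p.1.1 : ℕ) < p.1.2 := p.2
  congr 2
  rw [← zpow_natCast, ← zpow_neg]
  congr 1
  push_cast [h1.le]
  ring

end Coordinates

theorem sum_range_sub (n : ℕ) : 2 * ∑ i ∈ Finset.range n, (n - i) = n * (n + 1) := by
  have h := Finset.sum_range_reflect (fun i => i + 1) n
  have h1 : ∀ i ∈ Finset.range n, n - 1 - i + 1 = n - i := fun i hi => by
    have := Finset.mem_range.1 hi
    omega
  rw [Finset.sum_congr rfl h1] at h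
  rw [h, Finset.sum_add_distrib, Finset.sum_const, Finset.card_range, mul_add, mul_comm 2,
    Finset.sum_range_id_mul_two]
  rcases n with _ | n
  · rfl
  · simp only [Nat.add_sub_cancel, smul_eq_mul, mul_one]
    ring

theorem sum_upperIndex (n : ℕ) :
    (∑ p : UpperIndex n, ((p.1.2 : ℕ) - (p.1.1 : ℕ))) + n * (n + 1) / 2 =
      (n + 2) * (n + 1) * n / 6 := by
  have h1 : ∑ p : UpperIndex n, ((p.1.2 : ℕ) - (p.1.1 : ℕ)) =
      ∑ i ∈ Finset.range n, ∑ j ∈ Finset.range n, (j - i) := by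
    rw [← Finset.sum_subtype (Finset.univ.filter fun p : Fin n × Fin n => p.1 < p.2)
      (fun p => by simp) fun p => (p.2 : ℕ) - (p.1 : ℕ),
      Finset.sum_filter_of_ne fun p _ hp => Fin.lt_def.2 (by omega), Fintype.sum_prod_type,
      ← Fin.sum_univ_eq_sum_range fun i => ∑ j ∈ Finset.range n, (j - i)]
    exact Finset.sum_congr rfl fun i _ =>
      Fin.sum_univ_eq_sum_range (fun j => j - (i : ℕ)) n
  have h2 : ∀ n : ℕ, 6 * ∑ i ∈ Finset.range n, ∑ j ∈ Finset.range n, (j - i) + 3 * (n * (n + 1)) =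
      (n + 2) * (n + 1) * n := by
    intro n
    induction n with
    | zero => rfl
    | succ n ih =>
      have h3 : ∑ i ∈ Finset.range (n + 1), ∑ j ∈ Finset.range (n + 1), (j - i) =
          ∑ i ∈ Finset.range n, ∑ j ∈ Finset.range n, (j - i) + ∑ i ∈ Finset.range n, (n - i) := by
        rw [Finset.sum_range_succ]
        simp only [Finset.sum_range_succ _ n, Finset.sum_add_distrib]
        rw [Finset.sum_eq_zero (f := fun j => j - n) fun j hj => by
          have := Finset.mem_range.1 hj
          omega]
        simp
      have h4 := sum_range_sub n
      rw [h3]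
      nlinarith
  have h5 := h2 n
  obtain ⟨T, hT⟩ := (Nat.even_mul_succ_self n).two_dvd
  rw [h1]
  rw [hT] at h5 ⊢
  omega

end LocalBirch

namespace LocalBirch

/-! ### The support of Whittaker functions -/

section Support

variable {F : Type*} [NontriviallyNormedField F] [IsUltrametricDist F] {ϖ : Fˣ} {ψ : AddChar F ℂ}
  {α : ℕ}

theorem addChar_eq_one_of_norm_sub_one_le (ψ : AddChar F ℂ) {S : Set F}
    (hS : ∀ t ∈ S, t + t ∈ S) (h : ∀ t ∈ S, ‖ψ t - 1‖ ≤ 1 / 2) {t : F} (ht : t ∈ S) :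
    ψ t = 1 := by
  have key : ∀ (N : ℕ) (t : F), t ∈ S → (3 / 2 : ℝ) ^ N * ‖ψ t - 1‖ ≤ 1 / 2 := by
    intro N
    induction N with
    | zero => intro t ht; simpa using h t ht
    | succ N ih =>
      intro t ht
      have h1 := ih _ (hS t ht)
      have h2 : ψ (t + t) - 1 = (ψ t - 1) * (2 + (ψ t - 1)) := by
        rw [AddChar.map_add_eq_mul]
        ring
      have h3 : (3 / 2 : ℝ) ≤ ‖2 + (ψ t - 1)‖ := by
        have h4 := norm_sub_le (2 + (ψ t - 1)) (ψ t - 1)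
        rw [add_sub_cancel_right, Complex.norm_ofNat] at h4
        linarith [h t ht]
      rw [h2, norm_mul] at h1
      refine le_trans ?_ h1
      rw [pow_succ, mul_assoc]
      refine mul_le_mul_of_nonneg_left ?_ (by positivity)
      rw [mul_comm]
      exact mul_le_mul_of_nonneg_left h3 (norm_nonneg _)
  by_contra hne
  have hpos : 0 < ‖ψ t - 1‖ := norm_pos_iff.2 (sub_ne_zero.2 hne)
  obtain ⟨N, hN⟩ := pow_unbounded_of_one_lt (1 / 2 / ‖ψ t - 1‖) (by norm_num : (1 : ℝ) < 3 / 2)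
  rw [div_lt_iff₀ hpos] at hN
  exact absurd (key N t ht) (not_le.2 hN)

/-- The unipotent matrix with the entry `x` at the position `p`. -/
def rootUnipotent {n : ℕ} (p : UpperIndex n) (x : F) : unipotent F n :=
  unipotentOfCoord (Pi.single p x)

theorem continuous_rootUnipotent {n : ℕ} (p : UpperIndex n) :
    Continuous fun x : F => (rootUnipotent p x : GL (Fin n) F) :=
  continuous_subtype_val.comp (continuous_unipotentOfCoord.comp
    (continuous_single (A := fun _ : UpperIndex n => F) p))

theorem rootUnipotent_zero {n : ℕ} (p : UpperIndex n) : (rootUnipotent p (0 : F)) = 1 := by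
  rw [rootUnipotent, Pi.single_zero]
  refine Subtype.ext (Units.ext ?_)
  rw [coe_unipotentOfCoord]
  ext i j
  simp [strictUpper]

theorem genericChar_conj_rootUnipotent {n : ℕ} (ψ : AddChar F ℂ) (b : Fin n → ℤ) (p : UpperIndex n)
    (hp : (p.1.1 : ℕ) + 1 = p.1.2) (x : F) :
    genericChar ψ (powGL ϖ b * (rootUnipotent p x : GL (Fin n) F) * (powGL ϖ b)⁻¹) =
      ψ ((ϖ : F) ^ (b p.1.1 - b p.1.2) * x) := by
  have h0 : ∀ i j : Fin n, ((powGL ϖ b * (rootUnipotent p x : GL (Fin n) F) * (powGL ϖ b)⁻¹ :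
      GL (Fin n) F) : Matrix (Fin n) (Fin n) F) i j = (ϖ : F) ^ (b i - b j) *
        ((rootUnipotent p x : GL (Fin n) F) : Matrix (Fin n) (Fin n) F) i j := by
    intro i j
    rw [powGL, ← map_inv, diagGL_conj_apply]
    simp only [Pi.inv_apply, Units.val_inv_eq_inv_val, Units.val_zpow_eq_zpow_val]
    rw [zpow_sub₀ ϖ.ne_zero]
    ring
  have hlt : ∀ i j : Fin n, (i : ℕ) + 1 = j → i < j := fun i j h => Fin.lt_def.2 (by omega)
  have h1 : ∀ i j : Fin n, (h : (i : ℕ) + 1 = j) →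
      ((rootUnipotent p x : GL (Fin n) F) : Matrix (Fin n) (Fin n) F) i j =
        (Pi.single p x : UpperIndex n → F) ⟨(i, j), hlt i j h⟩ := by
    intro i j h
    exact congrFun (coordOfUnipotent_unipotentOfCoord (Pi.single p x : UpperIndex n → F))
      ⟨(i, j), hlt i j h⟩
  rw [genericChar, Finset.prod_eq_single p.1.1, Finset.prod_eq_single p.1.2]
  · rw [if_pos hp, h0, h1 _ _ hp]
    simp
  · intro j _ hj
    rw [if_neg fun h => hj (Fin.ext (by omega))]
  · simp
  · intro i _ hi
    refine Finset.prod_eq_one fun j _ => ?_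
    split_ifs with h
    · rw [h0, h1 _ _ h, Pi.single_eq_of_ne, mul_zero, AddChar.map_zero_eq_one]
      intro h'
      exact hi (by rw [← h'])
    · rfl
  · simp

variable [ProperSpace F]

theorem IsWhittaker.exists_support_bound (hψ : HasConductorIntegers ψ) (hϖ : IsUniformizer ϖ)
    {m : ℕ} {θ : Fin m → (Fˣ →ₜ* ℂˣ)} {w : GL (Fin m) F → ℂ} (hw : IsWhittaker ϖ ψ α θ w)
    (y : GL (Fin m) F) :
    ∃ M : ℕ, ∀ (b : Fin m → ℤ), ∀ k ∈ maximalCompact F m, w (powGL ϖ b * k * y) ≠ 0 →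
      ∀ i j : Fin m, (i : ℕ) + 1 = j → b j ≤ b i + M := by
  have hp := norm_unit_pos ϖ
  set V : Set (GL (Fin m) F) := {r | r ∈ iwahori ϖ m α ∧ ‖diagChar θ r - 1‖ ≤ 1 / 2} with hV
  have hV1 : V ∈ nhds (1 : GL (Fin m) F) := by
    refine Filter.inter_mem ((isOpen_iwahori ϖ m α).mem_nhds (one_mem_iwahori ϖ m α)) ?_
    have h1 : diagChar θ (1 : GL (Fin m) F) = 1 := by simp [diagChar, charVal_one]
    have h2 := (continuousAt_diagChar θ).preimage_mem_nhds (Metric.closedBall_mem_nhds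
      (diagChar θ (1 : GL (Fin m) F)) (by norm_num : (0 : ℝ) < 1 / 2))
    filter_upwards [h2] with r hr
    rwa [Set.mem_preimage, h1, mem_closedBall_iff_norm] at hr
  have h1 : ∀ p : UpperIndex m, ∀ᶠ x : F in nhds 0, ∀ k ∈ maximalCompact F m,
      (k * y)⁻¹ * (rootUnipotent p x : GL (Fin m) F) * (k * y) ∈ V := by
    intro p
    refine (isCompact_maximalCompact m).eventually_forall_of_forall_eventually fun k _ => ?_
    have hcont : Continuous fun z : F × GL (Fin m) F =>
        (z.2 * y)⁻¹ * (rootUnipotent p z.1 : GL (Fin m) F) * (z.2 * y) := by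
      have h2 : Continuous fun z : F × GL (Fin m) F => z.2 * y :=
        (continuous_mul_const y).comp continuous_snd
      exact (h2.inv.mul ((continuous_rootUnipotent p).comp continuous_fst)).mul h2
    refine hcont.continuousAt.eventually ?_
    simpa [rootUnipotent_zero] using hV1
  obtain ⟨δ, hδ, hball⟩ := Metric.eventually_nhds_iff_ball.1 (Filter.eventually_all.2 h1)
  obtain ⟨M, hM⟩ := exists_pow_lt_of_lt_one hδ hϖ.norm_lt_one
  refine ⟨M, fun b k hk hne i j hij => ?_⟩
  have hlt : i < j := Fin.lt_def.2 (by omega)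
  set p : UpperIndex m := ⟨(i, j), hlt⟩ with hpdef
  have h2 : ∀ x : F, ‖x‖ ≤ ‖(ϖ : F)‖ ^ M → ‖ψ ((ϖ : F) ^ (b i - b j) * x) - 1‖ ≤ 1 / 2 := by
    intro x hx
    have h3 := hball x (mem_ball_zero_iff.2 (hx.trans_lt hM)) p k hk
    have h4 := hw.right (powGL ϖ b * k * y) _ h3.1
    have h5 : powGL ϖ b * k * y * ((k * y)⁻¹ * (rootUnipotent p x : GL (Fin m) F) * (k * y)) =
        (powGL ϖ b * (rootUnipotent p x : GL (Fin m) F) * (powGL ϖ b)⁻¹) *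
          (powGL ϖ b * k * y) := by
      group
    have h7 : powGL ϖ b * (rootUnipotent p x : GL (Fin m) F) * (powGL ϖ b)⁻¹ ∈ unipotent F m :=
      diagGL_conj_mem_unipotent _ (SetLike.coe_mem _)
    rw [h5, hw.left _ h7, genericChar_conj_rootUnipotent ψ b p hij] at h4
    have h6 := mul_right_cancel₀ hne h4
    change ψ ((ϖ : F) ^ (b i - b j) * x) = _ at h6
    rw [h6]
    exact h3.2
  have h3 : ∀ z : F, ‖z‖ ≤ 1 → ψ ((ϖ : F) ^ (b i - b j + M) * z) = 1 := by
    intro z hz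
    refine addChar_eq_one_of_norm_sub_one_le ψ
      (S := {t | ∃ x : F, ‖x‖ ≤ ‖(ϖ : F)‖ ^ M ∧ t = (ϖ : F) ^ (b i - b j) * x}) ?_ ?_
      ⟨(ϖ : F) ^ M * z, ?_, ?_⟩
    · rintro t ⟨x, hx, rfl⟩
      exact ⟨x + x, (IsUltrametricDist.norm_add_le_max _ _).trans (max_le hx hx),
        (mul_add _ _ _).symm⟩
    · rintro t ⟨x, hx, rfl⟩
      exact h2 x hx
    · rw [norm_mul, norm_pow]
      exact mul_le_of_le_one_right (pow_pos hp _).le hz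
    · rw [zpow_add₀ ϖ.ne_zero, zpow_natCast, mul_assoc]
  have h4 := (hψ _).1 h3
  rw [norm_zpow, ← zpow_zero ‖(ϖ : F)‖, hϖ.zpow_le_zpow_iff] at h4
  omega

theorem exists_finite_support (hψ : HasConductorIntegers ψ) (hϖ : IsUniformizer ϖ)
    {n : ℕ} {θ : Fin (n + 1) → (Fˣ →ₜ* ℂˣ)} {w : GL (Fin (n + 1)) F → ℂ}
    (hw : IsWhittaker ϖ ψ α θ w) (f : Fˣ) (v : GL (Fin n) F → ℂ) (χ : Fˣ →ₜ* ℂˣ)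
    (a₀ : Fin n → ℤ) :
    ∀ k : ℤ, ∃ A : Finset (Fin n → ℤ), (∀ a, a ∈ A → ∑ i, a i = k) ∧ (∑ i, a₀ i = k → a₀ ∈ A) ∧
      ∀ a : Fin n → ℤ, ∑ i, a i = k → a ∉ A → ∀ c ∈ maximalCompact F n,
        coreIntegrand f w v χ (powGL ϖ a * c) = 0 := by
  classical
  obtain ⟨M, hM⟩ := hw.exists_support_bound hψ hϖ (hMatrix F n * embed (tMatrix (-f)))
  intro k
  refine ⟨(insert a₀ (Finset.Icc (fun _ => -((n : ℤ) * M)) fun _ => k + n * ((n : ℤ) * M))).filter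
    fun a => ∑ i, a i = k, fun a ha => (Finset.mem_filter.1 ha).2,
    fun h => Finset.mem_filter.2 ⟨Finset.mem_insert_self _ _, h⟩, fun a ha haA c hc => ?_⟩
  by_contra hne
  refine haA (Finset.mem_filter.2 ⟨Finset.mem_insert_of_mem (Finset.mem_Icc.2 ?_), ha⟩)
  have h1 : w (powGL ϖ (Fin.snoc a 0 : Fin (n + 1) → ℤ) * embed c *
      (hMatrix F n * embed (tMatrix (-f)))) ≠ 0 := by
    have h2 : powGL ϖ (Fin.snoc a 0 : Fin (n + 1) → ℤ) = embed (powGL ϖ a) := by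
      rw [powGL, powGL, embed_diagGL]
      congr 1
      ext i
      refine Fin.lastCases ?_ (fun i => ?_) i <;> simp
    rw [h2, ← embed_mul, ← mul_assoc]
    intro h3
    exact hne (by rw [coreIntegrand, h3, zero_mul, zero_mul])
  have h2 := hM _ _ (embed_mem_maximalCompact hc) h1
  have h3 : ∀ i : Fin (n + 1), -((n - (i : ℕ) : ℤ) * M) ≤
      (Fin.snoc a 0 : Fin (n + 1) → ℤ) i := by
    intro i
    induction i using Fin.reverseInduction with
    | last => simp
    | cast i ih =>
      have h4 := h2 i.castSucc i.succ (by simp)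
      rw [Fin.val_succ] at ih
      rw [Fin.val_castSucc]
      push_cast at ih
      linarith
  have h4 : ∀ i, -((n : ℤ) * M) ≤ a i := by
    intro i
    have h5 := h3 i.castSucc
    rw [Fin.snoc_castSucc, Fin.val_castSucc] at h5
    have h6 : (0 : ℤ) ≤ (i : ℕ) * M := by positivity
    linarith
  refine ⟨h4, fun i => ?_⟩
  have h5 : ∑ j ∈ Finset.univ.erase i, -((n : ℤ) * M) ≤ ∑ j ∈ Finset.univ.erase i, a j :=
    Finset.sum_le_sum fun j _ => h4 j
  have h6 := Finset.add_sum_erase Finset.univ a (Finset.mem_univ i)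
  rw [Finset.sum_const, Finset.card_erase_of_mem (Finset.mem_univ i), Finset.card_univ,
    Fintype.card_fin, nsmul_eq_mul] at h5
  have h7 : ((n - 1 : ℕ) : ℤ) * ((n : ℤ) * M) ≤ n * ((n : ℤ) * M) :=
    mul_le_mul_of_nonneg_right (by omega) (by positivity)
  change a i ≤ k + n * ((n : ℤ) * M)
  linarith

end Support

end LocalBirch

namespace LocalBirch

/-! ### Integration over the sets where the determinant has a fixed absolute value -/

section Shells

variable {F : Type*} [NontriviallyNormedField F] [IsUltrametricDist F] {ϖ : Fˣ} {n : ℕ}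

theorem onCosets_toCoset {Φ : GL (Fin n) F → ℂ}
    (hΦ : ∀ u ∈ unipotent F n, ∀ g, Φ (u * g) = Φ g) (g : GL (Fin n) F) :
    onCosets Φ (toCoset (unipotent F n) g) = Φ g := by
  obtain ⟨u, hu, h⟩ := exists_out_eq (unipotent F n) g
  rw [onCosets, h, hΦ u hu]

theorem preimage_shell (k : ℤ) :
    toCoset (unipotent F n) ⁻¹' shell ϖ n k =
      {g | ‖(Matrix.GeneralLinearGroup.det g : F)‖ = ‖(ϖ : F)‖ ^ k} := by
  ext g
  obtain ⟨u, hu, h⟩ := exists_out_eq (unipotent F n) g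
  rw [Set.mem_preimage, shell, Set.mem_ofPred_eq, Set.mem_ofPred_eq, h, map_mul,
    det_eq_one_of_mem_unipotent hu, one_mul]

theorem measurableSet_shell (k : ℤ) : MeasurableSet (shell ϖ n k : Set (RightCosets (unipotent F n))) := by
  have h1 : IsClosed {g : GL (Fin n) F | ‖(Matrix.GeneralLinearGroup.det g : F)‖ = ‖(ϖ : F)‖ ^ k} :=
    isClosed_eq (Units.continuous_val.comp continuous_det_GL).norm continuous_const
  rw [← preimage_shell] at h1
  exact measurableSet_quotient.2 h1.measurableSet

theorem pairwise_disjoint_shell (hϖ : IsUniformizer ϖ) :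
    Pairwise (Function.onFun Disjoint
      (fun k : ℤ => (shell ϖ n k : Set (RightCosets (unipotent F n))))) := by
  intro k l hkl
  refine Set.disjoint_left.2 fun x hx hx' => hkl ?_
  exact hϖ.zpow_inj ((Eq.symm hx).trans hx')

theorem iUnion_shell (hϖ : IsUniformizer ϖ) :
    ⋃ k : ℤ, (shell ϖ n k : Set (RightCosets (unipotent F n))) = Set.univ := by
  refine Set.eq_univ_of_forall fun x => Set.mem_iUnion.2 ?_
  exact hϖ.exists_norm_eq (Units.ne_zero (Matrix.GeneralLinearGroup.det x.out))

theorem det_powGL (a : Fin n → ℤ) :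
    Matrix.GeneralLinearGroup.det (powGL ϖ a) = ϖ ^ ∑ i, a i := by
  rw [powGL, det_diagGL]
  induction (Finset.univ : Finset (Fin n)) using Finset.cons_induction with
  | empty => simp
  | cons i s hi ih => rw [Finset.prod_cons, Finset.sum_cons, ih, zpow_add]

theorem norm_det_of_mem_cell {a : Fin n → ℤ} {g : GL (Fin n) F} (hg : g ∈ cell ϖ a) :
    ‖(Matrix.GeneralLinearGroup.det g : F)‖ = ‖(ϖ : F)‖ ^ ∑ i, a i := by
  have h1 : (powGL ϖ a)⁻¹ * g ∈ maximalCompact F n := hg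
  rw [← mul_inv_cancel_left (powGL ϖ a) g, map_mul, Units.val_mul, norm_mul, norm_det_eq_one h1,
    mul_one, det_powGL, Units.val_zpow_eq_zpow_val, norm_zpow]

variable [ProperSpace F]

theorem setIntegral_cell (ν : Measure (GL (Fin n) F)) [ν.IsHaarMeasure] (a : Fin n → ℤ)
    (Φ : GL (Fin n) F → ℂ) :
    ∫ g in cell ϖ a, Φ g ∂ν = ∫ c in maximalCompact F n, Φ (powGL ϖ a * c) ∂ν := by
  rw [cell, ← (measurePreserving_mul_left ν (powGL ϖ a)⁻¹).setIntegral_preimage_emb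
    (Homeomorph.mulLeft (powGL ϖ a)⁻¹).measurableEmbedding (fun c => Φ (powGL ϖ a * c))]
  simp only [mul_inv_cancel_left]

theorem ae_mem_cell (ν : Measure (GL (Fin n) F)) (η : Measure (unipotent F n)) :
    ∀ᵐ g ∂ν.withDensity (cosetDensity ϖ η), ∃ a : Fin n → ℤ, g ∈ cell ϖ a := by
  rw [ae_withDensity_iff (measurable_cosetDensity η)]
  refine ae_of_all _ fun g hg => ?_
  by_contra! h
  refine hg (ENNReal.tsum_eq_zero.2 fun a => Set.indicator_of_notMem (h a) _)

/-- The integral over a shell as a finite sum of integrals over the maximal compact subgroup. -/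
theorem integral_shell (hϖ : IsUniformizer ϖ) (ν : Measure (GL (Fin n) F)) [ν.IsHaarMeasure]
    (η : Measure (unipotent F n)) [η.IsHaarMeasure] {Φ : GL (Fin n) F → ℂ} (hc : Continuous Φ)
    (hΦ : ∀ u ∈ unipotent F n, ∀ g, Φ (u * g) = Φ g) {k : ℤ} {A : Finset (Fin n → ℤ)}
    (hA : ∀ a ∈ A, ∑ i, a i = k)
    (hA' : ∀ a : Fin n → ℤ, ∑ i, a i = k → a ∉ A → ∀ c ∈ maximalCompact F n,
      Φ (powGL ϖ a * c) = 0) :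
    IntegrableOn (onCosets Φ) (shell ϖ n k) (quotientMeasure (unipotent F n) ν η) ∧
    ∫ x in shell ϖ n k, onCosets Φ x ∂(quotientMeasure (unipotent F n) ν η) =
      ∑ a ∈ A, ((η (latticeUnipotent ϖ a)).toReal : ℂ)⁻¹ *
        ∫ c in maximalCompact F n, Φ (powGL ϖ a * c) ∂ν := by
  have hm := measurable_toCoset (unipotent F n)
  have hmeas : Measurable (onCosets Φ) := by
    refine measurable_from_quotient.2 ?_
    have h1 : onCosets Φ ∘ Quotient.mk'' = Φ := funext (onCosets_toCoset hΦ)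
    rw [h1]
    exact hc.measurable
  set μ := ν.withDensity (cosetDensity ϖ η) with hμ
  set S := toCoset (unipotent F n) ⁻¹' shell ϖ n k with hS
  have hSm : MeasurableSet S := hm (measurableSet_shell k)
  set T : Set (GL (Fin n) F) := ⋃ a ∈ A, cell ϖ a with hT
  have hTS : T ⊆ S := by
    intro g hg
    obtain ⟨a, ha, hga⟩ := Set.mem_iUnion₂.1 hg
    rw [hS, preimage_shell, Set.mem_ofPred_eq, norm_det_of_mem_cell hga, hA a ha]
  have hzero : ∀ᵐ g ∂μ, g ∈ S \ T → Φ g = 0 := by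
    filter_upwards [ae_mem_cell ν η] with g ⟨a, ha⟩ hg
    have h1 : ∑ i, a i = k := by
      have h2 := hg.1
      rw [hS, preimage_shell, Set.mem_ofPred_eq, norm_det_of_mem_cell ha] at h2
      exact hϖ.zpow_inj h2
    have h2 := hA' a h1 (fun h => hg.2 (Set.mem_biUnion h ha)) ((powGL ϖ a)⁻¹ * g) ha
    rwa [mul_inv_cancel_left] at h2
  have hcell : ∀ a : Fin n → ℤ, IntegrableOn Φ (cell ϖ a) μ := by
    intro a
    rw [IntegrableOn, hμ, withDensity_restrict_cell hϖ]
    exact (hc.continuousOn.integrableOn_compact (isCompact_cell a)).smul_measure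
      (ENNReal.inv_ne_top.2 (measure_latticeUnipotent_ne_zero η a))
  have hT1 : IntegrableOn Φ T μ := integrableOn_finset_iUnion.2 fun a _ => hcell a
  have hS1 : IntegrableOn Φ S μ := hT1.of_ae_sdiff_eq_zero hSm.nullMeasurableSet hzero
  rw [quotientMeasure_unipotent hϖ]
  constructor
  · rw [IntegrableOn, Measure.restrict_map hm (measurableSet_shell k),
      integrable_map_measure hmeas.aestronglyMeasurable hm.aemeasurable]
    refine hS1.congr (ae_of_all _ fun g => ?_)
    exact (onCosets_toCoset hΦ g).symm
  · rw [setIntegral_map (measurableSet_shell k) hmeas.aestronglyMeasurable hm.aemeasurable]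
    simp only [onCosets_toCoset hΦ]
    rw [setIntegral_eq_of_subset_of_ae_sdiff_eq_zero hSm.nullMeasurableSet hTS hzero,
      integral_biUnion_finset A (fun a _ => measurableSet_cell a)
        (fun a _ b _ hab => disjoint_cell hϖ hab) (fun a _ => hcell a)]
    refine Finset.sum_congr rfl fun a _ => ?_
    rw [hμ, withDensity_restrict_cell hϖ, integral_smul_measure, setIntegral_cell,
      ENNReal.toReal_inv, Complex.real_smul, Complex.ofReal_inv]

end Shells

end LocalBirch

namespace LocalBirch

/-! ### The value of the zeta integral -/

section Value

variable {F : Type*} [NontriviallyNormedField F] [IsUltrametricDist F] {ϖ : Fˣ} {ψ : AddChar F ℂ}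
  {α : ℕ}

theorem continuous_absDet {n : ℕ} (z : ℂ) : Continuous fun g : GL (Fin n) F => absDet g z := by
  refine Continuous.cpow ?_ continuous_const fun g => ?_
  · exact Complex.continuous_ofReal.comp
      (continuous_norm.comp (Units.continuous_val.comp continuous_det_GL))
  · exact Complex.ofReal_mem_slitPlane.2 (norm_pos_iff.2 (Units.ne_zero _))

theorem absDet_mul_of_norm_det_eq_one {n : ℕ} {g h : GL (Fin n) F}
    (hh : ‖(Matrix.GeneralLinearGroup.det h : F)‖ = 1) (z : ℂ) :
    absDet (g * h) z = absDet g z ∧ absDet (h * g) z = absDet g z := by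
  constructor
  · rw [absDet, absDet, map_mul, Units.val_mul, norm_mul, hh, mul_one]
  · rw [absDet, absDet, map_mul, Units.val_mul, norm_mul, hh, one_mul]

theorem absDet_inv {n : ℕ} (g : GL (Fin n) F) (z : ℂ) : absDet g⁻¹ z = absDet g (-z) := by
  rw [absDet, absDet, map_inv, Units.val_inv_eq_inv_val, norm_inv, Complex.ofReal_inv,
    Complex.inv_cpow, Complex.cpow_neg]
  rw [Complex.arg_ofReal_of_nonneg (norm_nonneg _)]
  exact Real.pi_pos.ne

theorem zetaIntegrand_unipotent_mul {n : ℕ} {θ : Fin (n + 1) → (Fˣ →ₜ* ℂˣ)}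
    {w : GL (Fin (n + 1)) F → ℂ} (hw : IsWhittaker ϖ ψ α θ w) (f : Fˣ)
    {θ' : Fin n → (Fˣ →ₜ* ℂˣ)} {v : GL (Fin n) F → ℂ} (hv : IsWhittaker ϖ ψ⁻¹ α θ' v)
    (χ : Fˣ →ₜ* ℂˣ) (s : ℂ) {u : GL (Fin n) F} (hu : u ∈ unipotent F n) (g : GL (Fin n) F) :
    zetaIntegrand f w v χ s (u * g) = zetaIntegrand f w v χ s g := by
  change coreIntegrand f w v χ (u * g) * absDet (u * g) _ = coreIntegrand f w v χ g * absDet g _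
  rw [coreIntegrand_unipotent_mul hw f hv χ hu, (absDet_mul_of_norm_det_eq_one (by
    rw [det_eq_one_of_mem_unipotent hu]; simp) _).2]

/-- The exponents of the only diagonal matrix that contributes to the zeta integral. -/
def criticalExponent (e n : ℕ) (i : Fin n) : ℤ := -(e * (n - i : ℤ))

theorem powGL_criticalExponent (e n : ℕ) :
    powGL ϖ (criticalExponent e n) = (tMatrix (ϖ ^ e))⁻¹ := by
  rw [powGL, tMatrix_eq, ← map_inv]
  congr 1
  ext1 i
  have hi : (i : ℕ) ≤ n := i.2.le
  rw [criticalExponent, Pi.inv_apply, zpow_neg, ← pow_mul, ← zpow_natCast]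
  push_cast [hi]
  rfl

theorem exists_isAddHaarMeasure_closedBall [ProperSpace F] [MeasurableSpace F] [BorelSpace F] :
    ∃ lam : Measure F, lam.IsAddHaarMeasure ∧ lam (Metric.closedBall 0 1) = 1 := by
  let K₀ : TopologicalSpace.PositiveCompacts F :=
    { carrier := Metric.closedBall 0 1
      isCompact' := isCompact_closedBall 0 1
      interior_nonempty' := ⟨0, mem_interior_iff_mem_nhds.2 (Metric.closedBall_mem_nhds 0 one_pos)⟩ }
  exact ⟨Measure.addHaarMeasure K₀, inferInstance, Measure.addHaarMeasure_self⟩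

theorem prod_Iic_const (n : ℕ) (c : ℂ) :
    ∏ μ : Fin n, ∏ _ν ∈ Finset.Iic μ, c = c ^ (n * (n + 1) / 2) := by
  simp only [Finset.prod_const, Fin.card_Iic]
  rw [Finset.prod_pow_eq_pow_sum, Fin.sum_univ_eq_sum_range fun i => i + 1]
  congr 1
  have h := Finset.sum_range_id_mul_two (n + 1)
  rw [Finset.sum_range_succ', add_zero, Nat.add_sub_cancel] at h
  rw [mul_comm n, ← h, Nat.mul_div_cancel _ two_pos]

theorem twistedChar_apply_eq {n : ℕ} (χ : Fˣ →ₜ* ℂˣ) (θ : Fin (n + 1) → (Fˣ →ₜ* ℂˣ))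
    (θ' : Fin n → (Fˣ →ₜ* ℂˣ)) (μ ν : Fin n) (x : Fˣ) :
    (twistedChar χ θ θ' μ ν x : ℂ) = χ x * twistedChar 1 θ θ' μ ν x := by
  simp [twistedChar]

variable [ProperSpace F]

theorem hasSum_integral_shell (hϖ : IsUniformizer ϖ) (hnorm : ‖(ϖ : F)‖ = (residueCard F : ℝ)⁻¹)
    (hψ : HasConductorIntegers ψ) (n : ℕ)
    (dg : Measure (GL (Fin n) F)) [dg.IsHaarMeasure] (hdg : dg (maximalCompact F n) = 1)
    (du : Measure (unipotent F n)) [du.IsHaarMeasure]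
    (hdu : du {u | (u : GL (Fin n) F) ∈ maximalCompact F n} = 1)
    (θ : Fin (n + 1) → (Fˣ →ₜ* ℂˣ)) (θ' : Fin n → (Fˣ →ₜ* ℂˣ))
    (w : GL (Fin (n + 1)) F → ℂ) (hw : IsWhittaker ϖ ψ α θ w)
    (v : GL (Fin n) F → ℂ) (hv : IsWhittaker ϖ ψ⁻¹ α θ' v) (χ : Fˣ →ₜ* ℂˣ)
    (e : ℕ) (he : 1 ≤ e)
    (hcond : ∀ μ ν : Fin n, ν ≤ μ → conductorExp ϖ (twistedChar χ θ θ' μ ν) = e) (s : ℂ) :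
    (∀ k : ℤ, IntegrableOn (onCosets (zetaIntegrand (ϖ ^ α) w v χ s)) (shell ϖ n k)
      (quotientMeasure (unipotent F n) dg du)) ∧
    HasSum (fun k : ℤ => ∫ x in shell ϖ n k, onCosets (zetaIntegrand (ϖ ^ α) w v χ s) x
        ∂(quotientMeasure (unipotent F n) dg du))
      ((∏ i : Fin n, (θ i.castSucc (-1) : ℂ)) *
      (∏ μ ∈ Finset.Icc 1 n, (1 - ((residueCard F : ℂ) ^ μ)⁻¹)⁻¹) *
      (((residueCard F : ℂ) ^ e) ^ ((n + 2) * (n + 1) * n / 6))⁻¹ *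
      absDet (tMatrix (n := n) (ϖ ^ e)) (1 / 2 - s) *
      (∏ μ : Fin n, ∏ ν ∈ Finset.Iic μ,
        (twistedChar 1 θ θ' μ ν (ϖ ^ e) : ℂ) *
          LocalBirch.gaussSum ϖ ψ (twistedChar χ θ θ' μ ν)) *
      w (embed (tMatrix (ϖ ^ α * (ϖ ^ e)⁻¹))) * v (tMatrix (ϖ ^ α * (ϖ ^ e)⁻¹))) := by
  borelize F
  obtain ⟨lam, hlamH, hlam⟩ := exists_isAddHaarMeasure_closedBall (F := F)
  set Φ := zetaIntegrand (ϖ ^ α) w v χ s with hΦdef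
  have hΦ : ∀ u ∈ unipotent F n, ∀ g, Φ (u * g) = Φ g := fun u hu g =>
    zetaIntegrand_unipotent_mul hw _ hv χ s hu g
  have hΦc : Continuous Φ :=
    (continuous_coreIntegrand hw.continuous hv.continuous _ χ).mul (continuous_absDet _)
  have hΦcell : ∀ (a : Fin n → ℤ), ∀ c ∈ maximalCompact F n, Φ (powGL ϖ a * c) =
      coreIntegrand (ϖ ^ α) w v χ (powGL ϖ a * c) * absDet (powGL ϖ a) (s - 1 / 2) := by
    intro a c hc
    rw [← (absDet_mul_of_norm_det_eq_one (norm_det_eq_one hc) _).1]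
    rfl
  choose A hA hA₀ hA' using exists_finite_support hψ hϖ hw (ϖ ^ α) v χ (criticalExponent e n)
  have hshell := fun k => integral_shell hϖ dg du hΦc hΦ (hA k) fun a ha haA c hc => by
    rw [hΦcell a c hc, hA' k a ha haA c hc, zero_mul]
  refine ⟨fun k => (hshell k).1, ?_⟩
  set V : ℂ := _
  change HasSum _ V
  have hterm : ∀ a : Fin n → ℤ, ((du (latticeUnipotent ϖ a)).toReal : ℂ)⁻¹ *
      ∫ c in maximalCompact F n, Φ (powGL ϖ a * c) ∂dg =
      if a = criticalExponent e n then V else 0 := by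
    intro a
    rw [setIntegral_congr_fun (isOpen_maximalCompact n).measurableSet (hΦcell a),
      integral_mul_const, setIntegral_coreIntegrand lam hϖ hnorm hlam hψ χ he n θ w hw θ' v hv hcond
        dg hdg a]
    by_cases ha : a = criticalExponent e n
    · subst ha
      rw [if_pos rfl, if_pos (show ∀ i : Fin n, criticalExponent e n i =
        -(e * (n - i : ℤ)) from fun _ => rfl), powGL_criticalExponent, absDet_inv, neg_sub]
      have h1 : du (latticeUnipotent ϖ (criticalExponent e n)) = _ :=
        measure_latticeUnipotent lam hϖ hnorm hlam du hdu e
      have h2 : ∀ μ : Fin n, ∀ ν ∈ Finset.Iic μ, (χ (ϖ ^ e) : ℂ)⁻¹ *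
          unitIntegral lam ψ (twistedChar χ θ θ' μ ν) ((ϖ : F) ^ e)⁻¹ =
          ((residueCard F : ℂ) ^ e)⁻¹ * ((twistedChar 1 θ θ' μ ν (ϖ ^ e) : ℂ) *
            LocalBirch.gaussSum ϖ ψ (twistedChar χ θ θ' μ ν)) := by
        intro μ ν hν
        have hc := hcond μ ν (Finset.mem_Iic.1 hν)
        have h3 := gaussSum_eq_unitIntegral lam hψ hϖ hnorm hlam
          (χ := twistedChar χ θ θ' μ ν) (by rw [hc]; exact he)
        rw [hc, twistedChar_apply_eq] at h3
        have hq : (residueCard F : ℂ) ^ e ≠ 0 :=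
          pow_ne_zero _ (Nat.cast_ne_zero.2 (residueCard_ne_zero hnorm))
        have hχ0 : (χ (ϖ ^ e) : ℂ) ≠ 0 := Units.ne_zero _
        generalize unitIntegral lam ψ (twistedChar χ θ θ' μ ν) ((ϖ : F) ^ e)⁻¹ = U at h3 ⊢
        field_simp
        linear_combination -h3
      have h4 : ∏ μ : Fin n, ∏ ν ∈ Finset.Iic μ, ((χ (ϖ ^ e) : ℂ)⁻¹ *
          unitIntegral lam ψ (twistedChar χ θ θ' μ ν) ((ϖ : F) ^ e)⁻¹) =
          (((residueCard F : ℂ) ^ e)⁻¹) ^ (n * (n + 1) / 2) *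
          ∏ μ : Fin n, ∏ ν ∈ Finset.Iic μ, ((twistedChar 1 θ θ' μ ν (ϖ ^ e) : ℂ) *
            LocalBirch.gaussSum ϖ ψ (twistedChar χ θ θ' μ ν)) := by
        rw [← prod_Iic_const, ← Finset.prod_mul_distrib]
        refine Finset.prod_congr rfl fun μ _ => ?_
        rw [← Finset.prod_mul_distrib]
        exact Finset.prod_congr rfl (h2 μ)
      have h5 : (((residueCard F : ℂ) ^ e) ^ ((n + 2) * (n + 1) * n / 6))⁻¹ =
          ((du (latticeUnipotent ϖ (criticalExponent e n))).toReal : ℂ)⁻¹ *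
            (((residueCard F : ℂ) ^ e)⁻¹) ^ (n * (n + 1) / 2) := by
        rw [h1, ← sum_upperIndex, pow_add, pow_mul, mul_inv, inv_pow, ENNReal.toReal_pow,
          ENNReal.toReal_pow, ENNReal.toReal_natCast]
        push_cast
        rfl
      rw [h4]
      change _ = _ * _ * _ * _ * _ * _ * _
      rw [h5]
      ring
    · rw [if_neg ha, if_neg (show ¬ ∀ i : Fin n, a i = -(e * (n - i : ℤ)) from
        fun h => ha (funext h)), zero_mul, mul_zero]
  have hval : ∀ k : ℤ, ∫ x in shell ϖ n k, onCosets Φ x ∂(quotientMeasure (unipotent F n) dg du) =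
      if k = ∑ i, criticalExponent e n i then V else 0 := by
    intro k
    rw [(hshell k).2, Finset.sum_congr rfl fun a _ => hterm a, Finset.sum_ite_eq']
    refine if_congr ⟨fun h => (hA k _ h).symm, fun h => hA₀ k h.symm⟩ rfl rfl
  simp only [hval]
  exact hasSum_ite_eq _ _

end Value

end LocalBirch

open LocalBirch in
theorem mainTheorem6
    {F : Type*} [NontriviallyNormedField F] [IsUltrametricDist F] [ProperSpace F]
    -- a uniformizer, the normalization `|ϖ| = 1 / q`, and `f = ϖ ^ α`
    (ϖ : Fˣ) (hϖ : IsUniformizer ϖ) (hnorm : ‖(ϖ : F)‖ = (residueCard F : ℝ)⁻¹)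
    (α : ℕ) (hα : 1 ≤ α)
    (ψ : AddChar F ℂ) (hψ : HasConductorIntegers ψ)
    (n : ℕ)
    -- Haar measures: `dg` gives `GL_n(𝒪)` volume one, `du` gives `U_n(𝒪)` volume one
    (dg : Measure (GL (Fin n) F)) [dg.IsHaarMeasure] (hdg : dg (maximalCompact F n) = 1)
    (du : Measure (unipotent F n)) [du.IsHaarMeasure]
    (hdu : du {u | (u : GL (Fin n) F) ∈ maximalCompact F n} = 1)
    (θ : Fin (n + 1) → (Fˣ →ₜ* ℂˣ)) (hθ : ∀ i, conductorExp ϖ (θ i) ≤ α)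
    (θ' : Fin n → (Fˣ →ₜ* ℂˣ)) (hθ' : ∀ i, conductorExp ϖ (θ' i) ≤ α)
    (w : GL (Fin (n + 1)) F → ℂ) (hw : IsWhittaker ϖ ψ α θ w)
    (v : GL (Fin n) F → ℂ) (hv : IsWhittaker ϖ ψ⁻¹ α θ' v)
    (χ : Fˣ →ₜ* ℂˣ) (hχ : conductorExp ϖ χ ≤ α)
    (e : ℕ) (he : 1 ≤ e) (hcond : ∀ μ ν : Fin n, ν ≤ μ → conductorExp ϖ (twistedChar χ θ θ' μ ν) = e)
    (s : ℂ)
    (I : RightCosets (unipotent F n) → ℂ)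
    (hI : I = onCosets (zetaIntegrand (ϖ ^ α) w v χ s))
    (value : ℂ)
    (hvalue : value =
      (∏ i : Fin n, (θ i.castSucc (-1) : ℂ)) *
      (∏ μ ∈ Finset.Icc 1 n, (1 - ((residueCard F : ℂ) ^ μ)⁻¹)⁻¹) *
      -- the exponent is an integer, the division is exact
      (((residueCard F : ℂ) ^ e) ^ ((n + 2) * (n + 1) * n / 6))⁻¹ *
      absDet (tMatrix (n := n) (ϖ ^ e)) (1 / 2 - s) *
      (∏ μ : Fin n, ∏ ν ∈ Finset.Iic μ,
        (twistedChar 1 θ θ' μ ν (ϖ ^ e) : ℂ) *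
          LocalBirch.gaussSum ϖ ψ (twistedChar χ θ θ' μ ν)) *
      w (embed (tMatrix (ϖ ^ α * (ϖ ^ e)⁻¹))) * v (tMatrix (ϖ ^ α * (ϖ ^ e)⁻¹))) :
    -- the integral converges absolutely on each set `|det g| = |ϖ| ^ k`,
    -- the sum over `k` of these integrals is the asserted value,
    -- and so is the whole integral whenever it converges absolutely
    (∀ k : ℤ, IntegrableOn I (shell ϖ n k) (quotientMeasure (unipotent F n) dg du)) ∧
    HasSum (fun k : ℤ => ∫ x in shell ϖ n k, I x ∂(quotientMeasure (unipotent F n) dg du)) value ∧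
    (Integrable I (quotientMeasure (unipotent F n) dg du) →
      ∫ x, I x ∂(quotientMeasure (unipotent F n) dg du) = value) := by
  subst hI hvalue
  obtain ⟨h1, h2⟩ := hasSum_integral_shell hϖ hnorm hψ n dg hdg du hdu θ θ' w hw v hv χ e he hcond s
  refine ⟨h1, h2, fun hint => ?_⟩
  have h3 := hasSum_integral_iUnion (fun k => measurableSet_shell k) (pairwise_disjoint_shell hϖ)
    hint.integrableOn
  rw [iUnion_shell hϖ, setIntegral_univ] at h3
  exact h3.unique h2
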